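/- Let $n\ge 2$ and $r\in\{1,\dots,n\}$, and let $o\in\mathbb S^n$. Hypersurfaces are smooth, oriented and (possibly only) immersed. A hypersurface $\Sigma$ of $\mathbb S^n\times\mathbb R$ is called $r$-minimal if the $r$-th elementary symmetric polynomial $H_r$ of its principal curvatures vanishes identically. It is called rotational with axis $\{o\}\times\mathbb R$ if every connected component of every horizontal section of $\Sigma$ (transversal intersection of $\Sigma$ with a horizontal hyperplane $\mathbb S^n\times\{t\}$) is contained in a geodesic sphere of $\mathbb S^n\times\{t\}$ centered at $(o,t)$; it is called rotational if this holds for some axis. Set $\mathcal R_0=\pi$ if $r=n$, and $\mathcal R_0=\pi/2$ if $r<n$. There exists a one-parameter family $\mathscr S=\{\Sigma(\lambda)\,;\,0<\lambda<\mathcal R_0\}$ of complete, properly embedded $r$-minimal hypersurfaces of $\mathbb S^n\times\mathbb R$, rotational with axis $\{o\}\times\mathbb R$ and homeomorphic to the $n$-annulus $\mathbb S^{n-1}\times\mathbb R$, such that: (i) if $r=n$, then $\Sigma(\lambda)$ is the cylinder over the geodesic sphere of $\mathbb S^n$ of radius $\lambda$ centered at $o$; (ii) if $r<n$, then $\Sigma(\lambda)$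 is of Delaunay type with neck radius $\lambda$. That is, there are $\ell>0$, $\bar\lambda\in(\lambda,\pi)$ and a smooth even $2\ell$-periodic function $R:\mathbb R\to\mathbb R$ with $R(0)=\lambda$, $R(\ell)=\bar\lambda$ and $R'>0$ on $(0,\ell)$ such that $\Sigma(\lambda)=\{(p,t)\in\mathbb S^n\times\mathbb R\,;\,\operatorname{dist}_{\mathbb S^n}(o,p)=R(t)\}$. The horizontal hyperplanes $\mathbb S^n\times\{t\}$ and the cylinder over the totally geodesic sphere of radius $\pi/2$ centered at $o$ are also complete, properly embedded rotational $r$-minimal hypersurfaces. Furthermore, up to ambient isometries, any complete connected rotational $r$-minimal hypersurface of $\mathbb S^n\times\mathbb R$ coincides, as a set, with a member of $\mathscr S$, with a horizontal hyperplane or, in the case $r<n$, with the cylinder over the totally geodesic sphere of radius $\pi/2$ centered at $o$. -/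

import Mathlib

open scoped Manifold ContDiff

/-- The Euclidean space `ℝⁿ⁺¹ × ℝ` (with the `ℓ²` product norm), in which `𝕊ⁿ × ℝ` sits. -/
abbrev EucProd (n : ℕ) : Type := WithLp 2 (EuclideanSpace ℝ (Fin (n + 1)) × ℝ)

/-- The product `𝕊ⁿ × ℝ` of the unit sphere with the line, with the metric induced by
`ℝⁿ⁺¹ × ℝ`; this is the product of the round metric with `dt²`. -/
def sphereProd (n : ℕ) : Set (EucProd n) := {x | ‖x.fst‖ = 1}

/-- For `x = (p, t) ∈ 𝕊ⁿ × ℝ`: the orthogonal projection of `ℝⁿ⁺¹ × ℝ` onto `T_x(𝕊ⁿ × ℝ)`, that is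
`w ↦ w - ⟨w, (p, 0)⟩ (p, 0)`. -/
noncomputable def tangentProj {n : ℕ} (x : EucProd n) : EucProd n →ₗ[ℝ] EucProd n :=
  LinearMap.id -
    ((innerSL ℝ (WithLp.toLp 2 (x.fst, (0 : ℝ)) : EucProd n)).toLinearMap).smulRight
      (WithLp.toLp 2 (x.fst, (0 : ℝ)) : EucProd n)

/-- An oriented (immersed) smooth hypersurface of `𝕊ⁿ × ℝ`: an immersion of an `n`-manifold `M`
together with a smooth unit normal field. -/
structure OrientedHypersurface (n : ℕ) (M : Type*) [TopologicalSpace M]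
    [ChartedSpace (EuclideanSpace ℝ (Fin n)) M] where
  toFun : M → EucProd n
  normal : M → EucProd n
  contMDiff_toFun : ContMDiff (𝓡 n) 𝓘(ℝ, EucProd n) ∞ toFun
  mem_sphereProd : ∀ x, toFun x ∈ sphereProd n
  injective_mvfderiv : ∀ x, Function.Injective (mvfderiv (𝓡 n) toFun x)
  contMDiff_normal : ContMDiff (𝓡 n) 𝓘(ℝ, EucProd n) ∞ normal
  norm_normal : ∀ x, ‖normal x‖ = 1
  /-- the normal is tangent to `𝕊ⁿ × ℝ` -/
  inner_normal_fst : ∀ x, inner ℝ (toFun x).fst (normal x).fst = 0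
  /-- the normal is orthogonal to the hypersurface -/
  inner_normal_mvfderiv : ∀ x v, inner ℝ (normal x) (mvfderiv (𝓡 n) toFun x v) = 0

namespace OrientedHypersurface

variable {n : ℕ} {M : Type*} [TopologicalSpace M] [ChartedSpace (EuclideanSpace ℝ (Fin n)) M]
  (F : OrientedHypersurface n M)

/-- The differential `T_xM → ℝⁿ⁺¹ × ℝ` of the immersion. -/
noncomputable def diff (x : M) : EuclideanSpace ℝ (Fin n) →ₗ[ℝ] EucProd n :=
  (mvfderiv (𝓡 n) F.toFun x : TangentSpace (𝓡 n) x →L[ℝ] EucProd n).toLinearMap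

/-- `v ↦ ∇̄_v N`, with `∇̄` the Levi-Civita connection of `𝕊ⁿ × ℝ`: the tangential part of the
Euclidean derivative of the unit normal field. -/
noncomputable def covDerivNormal (x : M) : EuclideanSpace ℝ (Fin n) →ₗ[ℝ] EucProd n :=
  tangentProj (F.toFun x) ∘ₗ
    (mvfderiv (𝓡 n) F.normal x : TangentSpace (𝓡 n) x →L[ℝ] EucProd n).toLinearMap

/-- The shape operator `A v = -∇̄_v N`, as an endomorphism of `T_xM`; since `∇̄_v N` lies in the
range of the (injective) differential `dF`, it is `-(dF)⁻¹ ∘ ∇̄N`. -/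
noncomputable def shapeOperator (x : M) :
    EuclideanSpace ℝ (Fin n) →ₗ[ℝ] EuclideanSpace ℝ (Fin n) :=
  -((F.diff x).leftInverse ∘ₗ F.covDerivNormal x)

/-- The principal curvatures at `x`: the eigenvalues of the shape operator, with multiplicity. -/
noncomputable def principalCurvatures (x : M) : Multiset ℝ :=
  (F.shapeOperator x).charpoly.roots

/-- The (non-normalized) `r`-th mean curvature: the `r`-th elementary symmetric polynomial of the
principal curvatures. -/
noncomputable def meanCurvature (r : ℕ) (x : M) : ℝ := (F.principalCurvatures x).esymm r

/-- `r`-minimal: the `r`-th mean curvature vanishes identically. -/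
def IsMinimal (r : ℕ) : Prop := ∀ x, F.meanCurvature r x = 0

/-- The distance on `M` of the Riemannian metric induced by the immersion: the infimum of the
lengths of `C¹` paths, where a tangent vector `v` has length `‖dF v‖`. -/
noncomputable def inducedEDist (x y : M) : ENNReal :=
  letI : ∀ z : M, ENorm (TangentSpace (𝓡 n) z) := fun z => ⟨fun v => ‖mvfderiv (𝓡 n) F.toFun z v‖ₑ⟩
  Manifold.riemannianEDist (𝓡 n) x y

/-- Completeness of the induced metric: every Cauchy sequence converges. -/
def IsComplete : Prop :=
  ∀ u : ℕ → M,
    (∀ ε : ENNReal, 0 < ε → ∃ K, ∀ k ≥ K, ∀ l ≥ K, F.inducedEDist (u k) (u l) < ε) →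
      ∃ x, Filter.Tendsto u Filter.atTop (nhds x)

/-- The height function. -/
def height (x : M) : ℝ := (F.toFun x).snd

/-- The hypersurface is transversal to the horizontal hyperplane `𝕊ⁿ × {t}`: the height function has
no critical point at height `t`. -/
def IsTransversalAt (t : ℝ) : Prop :=
  ∀ x, F.height x = t → mvfderiv (𝓡 n) F.height x ≠ 0

/-- Rotational with axis `{o} × ℝ`: every connected component of every horizontal section (transversal
intersection with some `𝕊ⁿ × {t}`) is contained in a geodesic sphere of `𝕊ⁿ × {t}` centered at
`(o, t)`. The geodesic distance of unit vectors is the angle between them. -/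
def IsRotationalAbout (o : EuclideanSpace ℝ (Fin (n + 1))) : Prop :=
  ∀ t, F.IsTransversalAt t → ∀ x, F.height x = t →
    ∃ ρ, 0 < ρ ∧ ρ < Real.pi ∧ ∀ y ∈ connectedComponentIn {z | F.height z = t} x,
      InnerProductGeometry.angle o (F.toFun y).fst = ρ

/-- Rotational, with some axis. -/
def IsRotational : Prop := ∃ o : EuclideanSpace ℝ (Fin (n + 1)), ‖o‖ = 1 ∧ F.IsRotationalAbout o

end OrientedHypersurface

/-- The subset `S` of `𝕊ⁿ × ℝ` is a connected, properly embedded, complete `r`-minimal hypersurface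
that is rotational about the axis `{o} × ℝ`. -/
def IsCompleteRotationalMinimal (n r : ℕ) (o : EuclideanSpace ℝ (Fin (n + 1)))
    (S : Set (EucProd n)) : Prop :=
  ∃ (M : Type) (_ : TopologicalSpace M) (_ : ChartedSpace (EuclideanSpace ℝ (Fin n)) M)
    (F : OrientedHypersurface n M),
    IsManifold (𝓡 n) ∞ M ∧ T2Space M ∧ SecondCountableTopology M ∧ ConnectedSpace M ∧
    Topology.IsClosedEmbedding F.toFun ∧ Set.range F.toFun = S ∧
    F.IsComplete ∧ F.IsRotationalAbout o ∧ F.IsMinimal r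

/-- `S` is homeomorphic to the `n`-annulus `𝕊ⁿ⁻¹ × ℝ`. -/
def IsAnnulus (n : ℕ) (S : Set (EucProd n)) : Prop :=
  Nonempty (S ≃ₜ Metric.sphere (0 : EuclideanSpace ℝ (Fin n)) 1 × ℝ)

/-- The horizontal hyperplane `𝕊ⁿ × {t}`. -/
def horizontalHyperplane (n : ℕ) (t : ℝ) : Set (EucProd n) := {x ∈ sphereProd n | x.snd = t}

/-- The rotational hypersurface of `𝕊ⁿ × ℝ` with axis `{o} × ℝ` and profile `R`: at height `t` it is
the geodesic sphere of radius `R t` centered at `o`. -/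
def rotationalSet {n : ℕ} (o : EuclideanSpace ℝ (Fin (n + 1))) (R : ℝ → ℝ) : Set (EucProd n) :=
  {x ∈ sphereProd n | InnerProductGeometry.angle o x.fst = R x.snd}

/-- The cylinder over the geodesic sphere of `𝕊ⁿ` with center `o` and radius `ρ`. -/
def cylinder {n : ℕ} (o : EuclideanSpace ℝ (Fin (n + 1))) (ρ : ℝ) : Set (EucProd n) :=
  rotationalSet o (fun _ => ρ)

/-- `R` is the profile of an unduloid with neck radius `a`: smooth with values in `(0, π)`, periodic
(with period `2ℓ`), symmetric under the reflections in `t = kℓ`, and strictly increasing from the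
minimum `a` at `t = 0` to the maximum `b` at `t = ℓ`. -/
def IsUnduloidProfile (a : ℝ) (R : ℝ → ℝ) : Prop :=
  ∃ b l : ℝ, 0 < a ∧ a < b ∧ b < Real.pi ∧ 0 < l ∧ ContDiff ℝ ∞ R ∧ R 0 = a ∧ R l = b ∧
    (∀ t, R (-t) = R t) ∧ (∀ t, R (t + 2 * l) = R t) ∧ ∀ t ∈ Set.Ioo 0 l, 0 < deriv R t

/-- Delaunay-type with axis `{o} × ℝ` and neck radius `a`: generated by rotating an unduloid about
the axis. In particular it is periodic in the vertical direction. -/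
def IsDelaunayType {n : ℕ} (o : EuclideanSpace ℝ (Fin (n + 1))) (a : ℝ) (S : Set (EucProd n)) :
    Prop :=
  ∃ R, IsUnduloidProfile a R ∧ S = rotationalSet o R

/-- The isometry `(p, t) ↦ (L p, τ t)` of `𝕊ⁿ × ℝ`, with `L ∈ O(n + 1)` and `τ` an isometry of `ℝ`. -/
noncomputable def ambientIsometry {n : ℕ}
    (L : EuclideanSpace ℝ (Fin (n + 1)) ≃ₗᵢ[ℝ] EuclideanSpace ℝ (Fin (n + 1))) (τ : ℝ ≃ᵢ ℝ)
    (x : EucProd n) : EucProd n :=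
  WithLp.toLp 2 (L x.fst, τ x.snd)

/-- The upper bound for the parameter: `π` if `r = n`, and `π / 2` if `r < n`. -/
noncomputable def parameterBound (n r : ℕ) : ℝ := if r = n then Real.pi else Real.pi / 2

/-!
For a hypersurface of `𝕊ⁿ × ℝ` write `f = ⟨o, p⟩` for the cosine of the distance to the axis, `h` for
the height and `ν` for the vertical component of the unit normal `N`.

*From the definition to an ordinary differential equation.* By Sard's theorem
(`volume_image_fderiv_eq_zero`) almost every horizontal section of a rotational hypersurface is
transversal. Around a point where `dh ≠ 0` the level sets of `h` are connected in suitable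
coordinates, so `f` is constant on a dense set of them and, by continuity, on all of them: near such a
point `f = g ∘ h` with a smooth function `g`, the profile (`IsRotationalAbout.exists_hasProfileAt`).
As `N` is proportional to the gradient of `f - g ∘ h`, the shape operator acts as a multiple of the
identity on `ker dh`, and its eigenvalues can be expressed by `g`, `g'`, `g''`. Thus `H_r = 0` becomes
`g ^ (r - 1) * profileOp n r g = 0` (`HasProfileAt.meanCurvature_eq_zero_iff`).

*The first integral.* The function `(1 - ν²)^r (1 - f²)^(n - r)` (`energy`) is a smooth function on the
whole hypersurface. Where `dh ≠ 0` its derivative vanishes by the profile equation, and where `dh = 0`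
it attains its minimum `0`; hence it is a constant `Q ∈ [0, 1]` (`energy_const`).

*The cases.* If `dh` vanishes identically, the height is constant. Otherwise `Q > 0`, every point has
a profile, and `Q` decides.
* If `Q = 1`, then `ν = 0` and `f` is constant; for `r < n` moreover `f = 0`.
* If `Q < 1`, then `g` and `g'` have no common zero, `profileOp` vanishes along each local profile and
  a profile is determined by its value and slope at a point, so that any global solution tangent to a
  local profile is a global profile (`hasProfileAt_of_tangent`).
  - For `r < n` there is a global solution through each point `(g, g')` with first integral `Q`: all of
    them are translates of a single periodic solution (`exists_unduloid`), obtained by writing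
    `g = g₀ cos φ`, which turns the first integral into a flow `φ' = Ω φ` with a smooth, positive,
    even and `π`-periodic `Ω`.
  - For `r = n` the solutions are `cos` of affine functions of the height. Their meridians reach the
    axis in finite time, at a point which the hypersurface cannot contain
    (`IsComplete.deriv_eq_zero_of_eq`), so this case does not occur.

*From local to global.* A complete hypersurface lying in one of the model hypersurfaces fills it, since
paths in the model can be lifted to it: the lifts have controlled length, and the limit of a maximal
lift exists by completeness (`IsComplete.mem_range_of_path`).

*Existence.* The rotational hypersurface with a given profile with values in `(0, π)` is parametrized by
`ℝⁿ ∖ {0}`, with `log ‖x‖` as the height. The parametrization is a closed embedding, hence complete,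
because chords are shorter than paths.
-/


/-! ### The Morse–Sard theorem for real functions -/

section Sard

open Set MeasureTheory Topology

variable {E : Type*} [NormedAddCommGroup E] [NormedSpace ℝ E]

/-- Taylor's inequality at points where the derivatives of orders `1, …, k` vanish. -/
theorem exists_abs_sub_le_pow_of_iteratedFDeriv_eq_zero {f : E → ℝ} {U : Set E} (hU : IsOpen U)
    (hf : ContDiffOn ℝ ∞ f U) (k : ℕ) {x₀ : E} (hx₀ : x₀ ∈ U) :
    ∃ δ > 0, ∃ C : NNReal, ∀ x ∈ Metric.ball x₀ δ, ∀ y ∈ Metric.ball x₀ δ,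
      (∀ j, 1 ≤ j → j ≤ k → iteratedFDeriv ℝ j f x = 0) → |f y - f x| ≤ C * ‖y - x‖ ^ (k + 1) := by
  have hcd : ∀ j : ℕ, ContDiffOn ℝ ∞ (iteratedFDeriv ℝ j f) U := fun j z hz =>
    ((hf.contDiffAt (hU.mem_nhds hz)).iteratedFDeriv_right
      (m := ∞) (i := j) (by norm_cast)).contDiffWithinAt
  have hcont : ContinuousAt (fun z => ‖iteratedFDeriv ℝ (k + 1) f z‖) x₀ :=
    ((hcd (k + 1)).continuousOn.continuousAt (hU.mem_nhds hx₀)).norm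
  set C : NNReal := ‖iteratedFDeriv ℝ (k + 1) f x₀‖₊ + 1 with hC
  obtain ⟨δ, hδ, hball⟩ : ∃ δ > 0, ∀ z ∈ Metric.ball x₀ δ,
      z ∈ U ∧ ‖iteratedFDeriv ℝ (k + 1) f z‖ ≤ C := by
    have h1 : ∀ᶠ z in 𝓝 x₀, ‖iteratedFDeriv ℝ (k + 1) f z‖ < C :=
      hcont.eventually_lt_const (by simp [hC])
    obtain ⟨δ, hδ, h⟩ := Metric.eventually_nhds_iff_ball.1 ((hU.eventually_mem hx₀).and h1)
    exact ⟨δ, hδ, fun z hz => ⟨(h z hz).1, (h z hz).2.le⟩⟩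
  refine ⟨δ, hδ, C, fun x hx y hy hj => ?_⟩
  -- descending induction on the order `k - i` of the derivative
  have key : ∀ i ≤ k, ∀ y ∈ Metric.ball x₀ δ,
      ‖iteratedFDeriv ℝ (k - i) f y - iteratedFDeriv ℝ (k - i) f x‖ ≤ C * ‖y - x‖ ^ (i + 1) := by
    intro i
    induction i with
    | zero =>
      intro _ y hy
      simp only [Nat.sub_zero, zero_add, pow_one]
      refine (convex_ball x₀ δ).norm_image_sub_le_of_norm_fderiv_le (𝕜 := ℝ) (fun z hz => ?_)
        (fun z hz => ?_) hx hy
      · exact ((hcd k).contDiffAt (hU.mem_nhds (hball z hz).1)).differentiableAt (by simp)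
      · rw [norm_fderiv_iteratedFDeriv]; exact (hball z hz).2
    | succ i ih =>
      intro hi y hy
      have h0 : iteratedFDeriv ℝ (k - i) f x = 0 := hj _ (by omega) (by omega)
      have hki : k - i = k - (i + 1) + 1 := by omega
      have hseg : ∀ z ∈ segment ℝ x y, z ∈ Metric.ball x₀ δ := fun z hz =>
        (convex_ball x₀ δ).segment_subset hx hy hz
      have := (convex_segment x y).norm_image_sub_le_of_norm_fderiv_le (𝕜 := ℝ)
        (f := iteratedFDeriv ℝ (k - (i + 1)) f) (C := C * ‖y - x‖ ^ (i + 1)) (fun z hz => ?_)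
        (fun z hz => ?_) (left_mem_segment ℝ x y) (right_mem_segment ℝ x y)
      · refine this.trans_eq (by ring)
      · exact ((hcd _).contDiffAt (hU.mem_nhds (hball z (hseg z hz)).1)).differentiableAt (by simp)
      · rw [norm_fderiv_iteratedFDeriv, ← hki]
        have h2 := ih (by omega) z (hseg z hz)
        rw [h0, sub_zero] at h2
        refine h2.trans ?_
        have : ‖z - x‖ ≤ ‖y - x‖ := norm_sub_le_of_mem_segment hz
        gcongr
  have := key k le_rfl y hy
  rw [Nat.sub_self, iteratedFDeriv_zero_eq_comp] at this
  have e : ContinuousMultilinearMap.uncurry0 ℝ E (f y) - ContinuousMultilinearMap.uncurry0 ℝ E (f x)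
      = ContinuousMultilinearMap.uncurry0 ℝ E (f y - f x) := by ext; simp
  simpa [e] using this

variable [FiniteDimensional ℝ E]

/-- A nonzero functional `φ`, together with a vector `e` with `φ e = 1`, splits `E` as
`ℝ × ker φ`. -/
noncomputable def equivProdKer (φ : E →L[ℝ] ℝ) (e : E) (he : φ e = 1) :
    E ≃L[ℝ] ℝ × LinearMap.ker φ.toLinearMap :=
  LinearEquiv.toContinuousLinearEquiv
    { toFun := fun y => (φ y, ⟨y - φ y • e, by simp [he]⟩)
      map_add' := fun a b => by
        ext
        · simp
        · simp [add_smul]; abel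
      map_smul' := fun c a => by
        ext
        · simp
        · simp [mul_smul, smul_sub]
      invFun := fun z => (z.2 : E) + z.1 • e
      left_inv := fun y => by simp
      right_inv := fun z => by
        have h : φ (z.2 : E) = 0 := z.2.2
        ext <;> simp [h, he] }

/-- Near a regular point, a smooth function is the first coordinate of a smooth coordinate
system. -/
theorem exists_smooth_straightening {w : E → ℝ} {U : Set E} (hU : IsOpen U)
    (hw : ContDiffOn ℝ ∞ w U) {x : E} (hxU : x ∈ U) (hx : fderiv ℝ w x ≠ 0) :
    ∃ K : Submodule ℝ E, Module.finrank ℝ K + 1 = Module.finrank ℝ E ∧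
      ∃ Ψ : OpenPartialHomeomorph E (ℝ × K), x ∈ Ψ.source ∧ Ψ.source ⊆ U ∧ Ψ x = (w x, 0) ∧
      (∀ y ∈ Ψ.source, (Ψ y).1 = w y) ∧
      ContDiffOn ℝ ∞ Ψ Ψ.source ∧ ContDiffOn ℝ ∞ Ψ.symm Ψ.target := by
  obtain ⟨e, he⟩ : ∃ e, fderiv ℝ w x e = 1 := by
    obtain ⟨v, hv⟩ : ∃ v, fderiv ℝ w x v ≠ 0 := by
      by_contra! h
      exact hx (ContinuousLinearMap.ext h)
    exact ⟨(fderiv ℝ w x v)⁻¹ • v, by simp [hv]⟩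
  set L := equivProdKer (fderiv ℝ w x) e he with hL
  let π : E →L[ℝ] LinearMap.ker (fderiv ℝ w x).toLinearMap :=
    (ContinuousLinearMap.snd ℝ ℝ _).comp L.toContinuousLinearMap
  let ψ : E → ℝ × LinearMap.ker (fderiv ℝ w x).toLinearMap := fun y => (w y, π (y - x))
  have hψ : ContDiffOn ℝ ∞ ψ U := by
    refine hw.prodMk (ContDiff.contDiffOn ?_)
    fun_prop
  have hψx : HasFDerivAt ψ (L : E →L[ℝ] ℝ × LinearMap.ker (fderiv ℝ w x).toLinearMap) x := by
    have h1 : HasFDerivAt w (fderiv ℝ w x) x :=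
      ((hw.contDiffAt (hU.mem_nhds hxU)).differentiableAt (by simp)).hasFDerivAt
    have h2 : HasFDerivAt (fun y => π (y - x)) π x :=
      π.hasFDerivAt.comp x ((hasFDerivAt_id x).sub_const x)
    convert! h1.prodMk h2 using 1
  have hat : ContDiffAt ℝ ∞ ψ x := hψ.contDiffAt (hU.mem_nhds hxU)
  set Ψ₀ := hat.toOpenPartialHomeomorph ψ hψx (by simp) with hΨ₀
  have hcoe : ∀ y, Ψ₀ y = ψ y := fun y => rfl
  -- the points where the differential stays invertible
  let W : Set E := U ∩ fderiv ℝ ψ ⁻¹'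
    range (fun A : E ≃L[ℝ] ℝ × LinearMap.ker (fderiv ℝ w x).toLinearMap =>
      (A : E →L[ℝ] ℝ × LinearMap.ker (fderiv ℝ w x).toLinearMap))
  have hW : IsOpen W :=
    (hψ.continuousOn_fderiv_of_isOpen hU (by simp)).isOpen_inter_preimage hU
      ContinuousLinearEquiv.isOpen
  have hxW : x ∈ W := ⟨hxU, by
    rw [mem_preimage, hψx.fderiv]; exact ⟨L, rfl⟩⟩
  have hK := Module.Dual.finrank_ker_add_one_of_ne_zero (f := (fderiv ℝ w x).toLinearMap)
    (fun h0 => hx (by ext v; exact LinearMap.congr_fun h0 v))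
  refine ⟨_, hK, Ψ₀.restrOpen W hW, ?_, ?_, ?_, ?_, hψ.mono fun y hy => hy.2.1, ?_⟩
  · exact ⟨hat.mem_toOpenPartialHomeomorph_source hψx (by simp), hxW⟩
  · exact fun y hy => hy.2.1
  · change ψ x = _
    simp [ψ]
  · exact fun y hy => rfl
  · intro z hz
    refine ContDiffAt.contDiffWithinAt ?_
    have hz' : Ψ₀.symm z ∈ W := ((Ψ₀.restrOpen W hW).map_target hz).2
    obtain ⟨A, hA⟩ := hz'.2
    have hd : HasFDerivAt ψ (A : E →L[ℝ] ℝ × LinearMap.ker (fderiv ℝ w x).toLinearMap)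
        (Ψ₀.symm z) := by
      change (A : E →L[ℝ] ℝ × LinearMap.ker (fderiv ℝ w x).toLinearMap) = _ at hA
      rw [hA]
      exact ((hψ.contDiffAt (hU.mem_nhds hz'.1)).differentiableAt (by simp)).hasFDerivAt
    exact Ψ₀.contDiffAt_symm hz.1 hd (hψ.contDiffAt (hU.mem_nhds hz'.1))

/-- The critical points of high order have a negligible image: there the function is Hölder
continuous with an exponent exceeding the dimension of the domain. -/
theorem volume_image_iteratedFDeriv_eq_zero {f : E → ℝ} {U : Set E} (hU : IsOpen U)
    (hf : ContDiffOn ℝ ∞ f U) :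
    volume (f '' {x ∈ U | ∀ j, 1 ≤ j → j ≤ Module.finrank ℝ E → iteratedFDeriv ℝ j f x = 0})
      = 0 := by
  set k := Module.finrank ℝ E
  rw [← Measure.toOuterMeasure_apply, ← OuterMeasure.comap_apply]
  refine measure_null_of_locally_null _ fun x₀ hx₀ => ?_
  obtain ⟨δ, hδ, C, h⟩ := exists_abs_sub_le_pow_of_iteratedFDeriv_eq_zero hU hf k hx₀.1
  refine ⟨_, inter_mem_nhdsWithin _ (Metric.ball_mem_nhds x₀ hδ), ?_⟩
  rw [OuterMeasure.comap_apply, Measure.toOuterMeasure_apply]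
  set A := {x ∈ U | ∀ j, 1 ≤ j → j ≤ k → iteratedFDeriv ℝ j f x = 0} ∩ Metric.ball x₀ δ
  have hH : HolderOnWith C ((k : NNReal) + 1) f A := by
    intro x hx y hy
    have := h y hy.2 x hx.2 hy.1.2
    rw [edist_dist, edist_dist, Real.dist_eq, dist_eq_norm]
    have e1 : ((((k : NNReal) + 1 : NNReal)) : ℝ) = ((k + 1 : ℕ) : ℝ) := by push_cast; ring
    rw [e1, ENNReal.rpow_natCast, ← ENNReal.ofReal_pow (norm_nonneg _),
      ← ENNReal.ofReal_coe_nnreal, ← ENNReal.ofReal_mul (NNReal.coe_nonneg C)]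
    exact ENNReal.ofReal_le_ofReal this
  have hdim : dimH (f '' A) < (1 : NNReal) := by
    refine (hH.dimH_image_le (by positivity)).trans_lt ?_
    have h1 : dimH A ≤ k := (dimH_mono (subset_univ A)).trans_eq (Real.dimH_univ_eq_finrank E)
    refine (ENNReal.div_le_div_right h1 _).trans_lt ?_
    refine ENNReal.div_lt_of_lt_mul ?_
    norm_cast
    simp
  have := hausdorffMeasure_of_dimH_lt hdim
  rwa [NNReal.coe_one, hausdorffMeasure_real] at this

/-- The Morse–Sard theorem for real functions: the set of critical values of a smooth function on
an open subset of a finite-dimensional space is a null set. The proof is by induction on the dimension: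
the critical points at which all derivatives up to order `k`, but not those of order `k + 1`, vanish
lie locally on a smooth hypersurface, to which the induction hypothesis applies. -/
theorem volume_image_fderiv_eq_zero {E : Type*} [NormedAddCommGroup E] [NormedSpace ℝ E]
    [FiniteDimensional ℝ E] {f : E → ℝ} {U : Set E} (hU : IsOpen U) (hf : ContDiffOn ℝ ∞ f U) :
    volume (f '' {x ∈ U | fderiv ℝ f x = 0}) = 0 := by
  induction h : Module.finrank ℝ E generalizing E with
  | zero =>
    refine measure_mono_null (image_mono ?_) (volume_image_iteratedFDeriv_eq_zero hU hf)
    exact fun x hx => ⟨hx.1, fun j h1 h2 => by omega⟩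
  | succ n ih =>
    -- `C k`: the points where the derivatives of orders `1, …, k` vanish
    let C : ℕ → Set E := fun k => {x ∈ U | ∀ j, 1 ≤ j → j ≤ k → iteratedFDeriv ℝ j f x = 0}
    have hstep : ∀ k, 1 ≤ k → volume (f '' (C k \ C (k + 1))) = 0 := by
      intro k hk
      rw [← Measure.toOuterMeasure_apply, ← OuterMeasure.comap_apply]
      refine measure_null_of_locally_null _ fun x hx => ?_
      have hne : iteratedFDeriv ℝ (k + 1) f x ≠ 0 := by
        intro h0
        refine hx.2 ⟨hx.1.1, fun j h1 h2 => ?_⟩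
        rcases Nat.lt_or_ge j (k + 1) with h3 | h3
        · exact hx.1.2 j h1 (by omega)
        · rw [le_antisymm h2 h3]; exact h0
      obtain ⟨m, hm⟩ : ∃ m, iteratedFDeriv ℝ (k + 1) f x m ≠ 0 := by
        by_contra! h'
        exact hne (ContinuousMultilinearMap.ext h')
      have hcd : ContDiffOn ℝ ∞ (iteratedFDeriv ℝ k f) U := fun z hz =>
        ((hf.contDiffAt (hU.mem_nhds hz)).iteratedFDeriv_right
          (m := ∞) (i := k) (by norm_cast)).contDiffWithinAt
      -- a derivative of order `k` vanishing on `C k` whose differential does not vanish at `x`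
      let ev := ContinuousMultilinearMap.apply ℝ (fun _ : Fin k => E) ℝ (Fin.tail m)
      let w : E → ℝ := fun z => ev (iteratedFDeriv ℝ k f z)
      have hw : ContDiffOn ℝ ∞ w U := ev.contDiff.comp_contDiffOn hcd
      have hwx : fderiv ℝ w x ≠ 0 := by
        intro h0
        apply hm
        rw [iteratedFDeriv_succ_apply_left]
        have hd : HasFDerivAt w (ev.comp (fderiv ℝ (iteratedFDeriv ℝ k f) x)) x :=
          ev.hasFDerivAt.comp x ((hcd.contDiffAt (hU.mem_nhds hx.1.1)).differentiableAt
            (by simp)).hasFDerivAt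
        rw [hd.fderiv] at h0
        exact DFunLike.congr_fun h0 (m 0)
      obtain ⟨K, hK', Ψ, hxΨ, hΨU, -, hΨw, -, hΨs⟩ := exists_smooth_straightening hU hw hx.1.1 hwx
      refine ⟨_, inter_mem_nhdsWithin _ (Ψ.open_source.mem_nhds hxΨ), ?_⟩
      rw [OuterMeasure.comap_apply, Measure.toOuterMeasure_apply]
      have hK : Module.finrank ℝ K = n := by omega
      -- the restriction of `f` to the hypersurface `w = 0`, in straightened coordinates
      let V : Set K := (fun z : K => ((0 : ℝ), z)) ⁻¹' Ψ.target
      have hV : IsOpen V := Ψ.open_target.preimage (by fun_prop)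
      let f' : K → ℝ := fun z => f (Ψ.symm (0, z))
      have hsec : ContDiffOn ℝ ∞ (fun z : K => Ψ.symm (0, z)) V :=
        hΨs.comp (f := fun z : K => ((0 : ℝ), z))
          (ContDiff.contDiffOn (by fun_prop)) fun z hz => hz
      have hf' : ContDiffOn ℝ ∞ f' V :=
        hf.comp hsec fun z hz => hΨU (Ψ.map_target hz)
      refine measure_mono_null ?_ (ih hV hf' hK)
      rintro _ ⟨y, ⟨⟨hyC, -⟩, hyΨ⟩, rfl⟩
      have hy0 : w y = 0 := by
        change ev (iteratedFDeriv ℝ k f y) = 0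
        rw [hyC.2 k hk le_rfl, map_zero]
      have hΨy : Ψ y = (0, (Ψ y).2) := Prod.ext ((hΨw y hyΨ).trans hy0) rfl
      have hinv : Ψ.symm (0, (Ψ y).2) = y := by rw [← hΨy, Ψ.left_inv hyΨ]
      have hyV : (Ψ y).2 ∈ V := by
        change (0, (Ψ y).2) ∈ Ψ.target
        rw [← hΨy]; exact Ψ.map_source hyΨ
      refine ⟨(Ψ y).2, ⟨hyV, ?_⟩, by simp [f', hinv]⟩
      have hfy : HasFDerivAt f (0 : E →L[ℝ] ℝ) (Ψ.symm (0, (Ψ y).2)) := by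
        rw [hinv]
        have h1 := ((hf.contDiffAt (hU.mem_nhds hyC.1)).differentiableAt (by simp)).hasFDerivAt
        have h2 : fderiv ℝ f y = 0 := by
          rw [← norm_eq_zero, ← norm_iteratedFDeriv_one, hyC.2 1 le_rfl hk, norm_zero]
        rwa [h2] at h1
      have hs := ((hsec.contDiffAt (hV.mem_nhds hyV)).differentiableAt (by simp)).hasFDerivAt
      have hcomp : HasFDerivAt f' _ (Ψ y).2 := hfy.comp (Ψ y).2 hs
      rw [hcomp.fderiv, ContinuousLinearMap.zero_comp]
    -- `C (n + 1)` is covered by the Hölder estimate, the others by descending induction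
    have hall : ∀ i, i ≤ n → volume (f '' C (n + 1 - i)) = 0 := by
      intro i
      induction i with
      | zero =>
        intro _
        have := volume_image_iteratedFDeriv_eq_zero hU hf
        rwa [h] at this
      | succ i ihi =>
        intro hi
        have h1 := ihi (by omega)
        have e : n + 1 - i = n + 1 - (i + 1) + 1 := by omega
        rw [e] at h1
        refine measure_mono_null ?_ (measure_union_null (hstep (n + 1 - (i + 1)) (by omega)) h1)
        rw [← image_union]
        exact image_mono fun x hx => by by_cases h2 : x ∈ C (n + 1 - (i + 1) + 1) <;> simp_all
    refine measure_mono_null (image_mono ?_) (hall n le_rfl)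
    refine fun x hx => ⟨hx.1, fun j h1 h2 => ?_⟩
    obtain rfl : j = 1 := by omega
    have h3 : fderiv ℝ f x = 0 := hx.2
    rw [← norm_eq_zero, norm_iteratedFDeriv_one, h3, norm_zero]

end Sard


/-! ### Endomorphisms acting as a scalar on a hyperplane -/

section LinearAlgebra

open Polynomial

theorem esymm_replicate (m : ℕ) (k : ℝ) (r : ℕ) :
    (Multiset.replicate m k).esymm r = (m.choose r) * k ^ r := by
  have : (Multiset.powersetCard r (Multiset.replicate m k)).map Multiset.prod =
      Multiset.replicate (m.choose r) (k ^ r) := by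
    rw [Multiset.eq_replicate]
    refine ⟨by simp, fun b hb => ?_⟩
    obtain ⟨s, hs, rfl⟩ := Multiset.mem_map.1 hb
    rw [Multiset.mem_powersetCard] at hs
    obtain ⟨j, hj, rfl⟩ := Multiset.le_replicate_iff.1 hs.1
    have := hs.2
    simp at this
    simp [this]
  rw [Multiset.esymm, this, Multiset.sum_replicate, nsmul_eq_mul]

theorem esymm_cons_replicate (m : ℕ) (k κ : ℝ) (r : ℕ) :
    (κ ::ₘ Multiset.replicate m k).esymm (r + 1) =
      (m.choose (r + 1)) * k ^ (r + 1) + κ * ((m.choose r) * k ^ r) := by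
  rw [← esymm_replicate, ← esymm_replicate, Multiset.esymm, Multiset.powersetCard_cons]
  simp [Multiset.esymm, Multiset.map_map, Multiset.sum_map_mul_left]

variable {V : Type*} [AddCommGroup V] [Module ℝ V] [FiniteDimensional ℝ V]

/-- An endomorphism acting as `k` on a hyperplane and as `κ` on the quotient line has characteristic
polynomial `(X - κ) (X - k) ^ (dim - 1)`. -/
theorem charpoly_eq_of_ker {m : ℕ} (hm : Module.finrank ℝ V = m + 1) (A : V →ₗ[ℝ] V)
    (φ : V →ₗ[ℝ] ℝ) (hφ : φ ≠ 0) (k κ : ℝ) (hker : ∀ v, φ v = 0 → A v = k • v)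
    (hφA : ∀ v, φ (A v) = κ * φ v) : A.charpoly = (X - C κ) * (X - C k) ^ m := by
  obtain ⟨e, he⟩ : ∃ e, φ e = 1 := LinearMap.surjective hφ 1
  have hA : ∀ v, A v = k • v + φ v • (A e - k • e) := by
    intro v
    have := hker (v - φ v • e) (by simp [he])
    rw [map_sub, map_smul, sub_eq_iff_eq_add] at this
    rw [this]
    simp only [smul_sub, smul_smul, mul_comm]
    abel
  -- for `t ≠ k`, the endomorphism `t - A` is a multiple of a transvection
  refine Polynomial.eq_of_infinite_eval_eq _ _ ((Set.finite_singleton k).infinite_compl.mono ?_)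
  intro t ht
  have htk : t - k ≠ 0 := sub_ne_zero.2 ht
  have key : (algebraMap ℝ (Module.End ℝ V) t - A) =
      (t - k) • LinearMap.transvection φ (-(t - k)⁻¹ • (A e - k • e)) := by
    ext v
    have h1 : (t - k) • φ v • -(t - k)⁻¹ • (A e - k • e) = -(φ v • (A e - k • e)) := by
      rw [smul_comm (φ v), smul_smul, mul_neg, mul_inv_cancel₀ htk, neg_smul, one_smul]
    simp only [LinearMap.sub_apply, Module.algebraMap_end_apply, LinearMap.smul_apply,
      LinearMap.transvection.apply, smul_add, h1]
    rw [hA v, sub_smul]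
    abel
  rw [Set.mem_ofPred_eq, LinearMap.eval_charpoly, key, LinearMap.det_smul,
    LinearMap.transvection.det, hm]
  simp only [map_smul, map_sub, hφA, he, eval_mul, eval_sub, eval_X, eval_C, eval_pow, smul_eq_mul]
  field_simp
  ring

/-- The elementary symmetric polynomials of the eigenvalues `k` (of multiplicity `m`) and `κ`. -/
theorem esymm_roots_charpoly_of_ker {m : ℕ} (hm : Module.finrank ℝ V = m + 1) (A : V →ₗ[ℝ] V)
    (φ : V →ₗ[ℝ] ℝ) (hφ : φ ≠ 0) (k κ : ℝ) (hker : ∀ v, φ v = 0 → A v = k • v)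
    (hφA : ∀ v, φ (A v) = κ * φ v) (r : ℕ) :
    A.charpoly.roots.esymm (r + 1) =
      (m.choose (r + 1)) * k ^ (r + 1) + κ * ((m.choose r) * k ^ r) := by
  rw [charpoly_eq_of_ker hm A φ hφ k κ hker hφA, Polynomial.roots_mul, Polynomial.roots_pow,
    roots_X_sub_C, roots_X_sub_C, Multiset.nsmul_singleton, Multiset.singleton_add,
    esymm_cons_replicate]
  exact mul_ne_zero (X_sub_C_ne_zero _) (pow_ne_zero _ (X_sub_C_ne_zero _))

end LinearAlgebra


/-! ### Differentials and shape operator in charts -/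

section ChartCalculus

variable {n : ℕ} {M : Type*} [TopologicalSpace M] [ChartedSpace (EuclideanSpace ℝ (Fin n)) M]
  {W : Type*} [NormedAddCommGroup W] [NormedSpace ℝ W]

theorem mvfderiv_eq_fderiv_chart {g : M → W} (hg : ContMDiff (𝓡 n) 𝓘(ℝ, W) ∞ g) (x : M) :
    mvfderiv (𝓡 n) g x = fderiv ℝ (g ∘ (extChartAt (𝓡 n) x).symm) (extChartAt (𝓡 n) x x) := by
  rw [((hg x).mdifferentiableAt (by simp)).mvfderiv]
  rw [ModelWithCorners.range_eq_univ, fderivWithin_univ]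
  rfl

variable [IsManifold (𝓡 n) ∞ M]

theorem contDiffOn_chart {g : M → W} (hg : ContMDiff (𝓡 n) 𝓘(ℝ, W) ∞ g) (x : M) :
    ContDiffOn ℝ ∞ (g ∘ (extChartAt (𝓡 n) x).symm) (extChartAt (𝓡 n) x).target := by
  rw [← contMDiffOn_iff_contDiffOn]
  exact hg.comp_contMDiffOn (contMDiffOn_extChartAt_symm x)

/-- The derivatives at `y`, computed in the charts at `y` and at `x`, differ by an automorphism
which does not depend on the function. -/
theorem exists_mvfderiv_eq_fderiv_comp (x : M) {y : M} (hy : y ∈ (extChartAt (𝓡 n) x).source) :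
    ∃ B : EuclideanSpace ℝ (Fin n) ≃L[ℝ] EuclideanSpace ℝ (Fin n),
      ∀ (W : Type) [NormedAddCommGroup W] [NormedSpace ℝ W] (g : M → W),
        ContMDiff (𝓡 n) 𝓘(ℝ, W) ∞ g → ∀ v : EuclideanSpace ℝ (Fin n),
          mvfderiv (𝓡 n) g y v =
            fderiv ℝ (g ∘ (extChartAt (𝓡 n) x).symm) (extChartAt (𝓡 n) x y) (B v) := by
  have : IsManifold (𝓡 n) 1 M := IsManifold.of_le (n := ∞) (by norm_cast)
  obtain ⟨B, hB⟩ := isInvertible_mfderiv_extChartAt (I := 𝓡 n) (x := x) hy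
  refine ⟨B, fun W _ _ g hg v => ?_⟩
  have hs : (extChartAt (𝓡 n) x).source ∈ nhds y := (isOpen_extChartAt_source x).mem_nhds hy
  have heq : g =ᶠ[nhds y] (g ∘ (extChartAt (𝓡 n) x).symm) ∘ extChartAt (𝓡 n) x := by
    filter_upwards [hs] with z hz
    simp only [Function.comp_apply, (extChartAt (𝓡 n) x).left_inv hz]
  have ht : (extChartAt (𝓡 n) x).target ∈ nhds (extChartAt (𝓡 n) x y) :=
    (isOpen_extChartAt_target x).mem_nhds ((extChartAt (𝓡 n) x).map_source hy)
  have hd : DifferentiableAt ℝ (g ∘ (extChartAt (𝓡 n) x).symm) (extChartAt (𝓡 n) x y) :=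
    ((contDiffOn_chart hg x).contDiffAt ht).differentiableAt (by simp)
  have he : MDifferentiableAt (𝓡 n) 𝓘(ℝ, EuclideanSpace ℝ (Fin n)) (extChartAt (𝓡 n) x) y :=
    mdifferentiableAt_extChartAt (by simpa using hy)
  have := mfderiv_comp y hd.mdifferentiableAt he
  rw [← heq.mfderiv_eq, mfderiv_eq_fderiv, ← hB] at this
  exact DFunLike.congr_fun this v

/-- A smooth function with vanishing derivative on a connected manifold is constant. -/
theorem eq_of_mvfderiv_eq_zero [PreconnectedSpace M] {g : M → ℝ} (hg : ContMDiff (𝓡 n) 𝓘(ℝ, ℝ) ∞ g)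
    (h : ∀ x, mvfderiv (𝓡 n) g x = 0) (x y : M) : g x = g y := by
  have hloc : IsLocallyConstant g := by
    rw [IsLocallyConstant.iff_eventually_eq]
    intro x
    have hto := isOpen_extChartAt_target (I := 𝓡 n) x
    have hxt := mem_extChartAt_target (I := 𝓡 n) x
    obtain ⟨ε, hε, hb⟩ := Metric.isOpen_iff.1 hto _ hxt
    have h1 : ∀ᶠ z in nhds x, extChartAt (𝓡 n) x z ∈ Metric.ball (extChartAt (𝓡 n) x x) ε :=
      (continuousAt_extChartAt x).eventually (Metric.ball_mem_nhds _ hε)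
    filter_upwards [h1, extChartAt_source_mem_nhds (I := 𝓡 n) x] with z hz hzs
    have := Metric.isOpen_ball.is_const_of_fderiv_eq_zero (𝕜 := ℝ)
      (convex_ball _ _).isPreconnected
      (((contDiffOn_chart hg x).mono hb).differentiableOn (by simp)) ?_ hz
        (Metric.mem_ball_self hε)
    · rwa [Function.comp_apply, Function.comp_apply, (extChartAt (𝓡 n) x).left_inv hzs,
        extChartAt_to_inv] at this
    · intro u hu
      have hu' := hb hu
      obtain ⟨B, hB⟩ := exists_mvfderiv_eq_fderiv_comp x ((extChartAt (𝓡 n) x).map_target hu')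
      ext v
      have := hB ℝ g hg (B.symm v)
      rw [h, (extChartAt (𝓡 n) x).right_inv hu', B.apply_symm_apply] at this
      exact this.symm
  exact hloc.apply_eq_of_isPreconnected isPreconnected_univ trivial trivial

end ChartCalculus

namespace OrientedHypersurface

variable {n : ℕ} {M : Type*} [TopologicalSpace M] [ChartedSpace (EuclideanSpace ℝ (Fin n)) M]
  (F : OrientedHypersurface n M)

/-- The differential of the immersion, as a continuous linear map on `ℝⁿ`. -/
noncomputable def dF (x : M) : EuclideanSpace ℝ (Fin n) →L[ℝ] EucProd n :=
  mvfderiv (𝓡 n) F.toFun x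

/-- The differential of the unit normal field, as a continuous linear map on `ℝⁿ`. -/
noncomputable def dN (x : M) : EuclideanSpace ℝ (Fin n) →L[ℝ] EucProd n :=
  mvfderiv (𝓡 n) F.normal x

theorem hasFDerivAt_of_contMDiff {W : Type*} [NormedAddCommGroup W] [NormedSpace ℝ W]
    [IsManifold (𝓡 n) ∞ M] {g : M → W} (hg : ContMDiff (𝓡 n) 𝓘(ℝ, W) ∞ g) (x : M) :
    HasFDerivAt (g ∘ (extChartAt (𝓡 n) x).symm)
      (mvfderiv (𝓡 n) g x : EuclideanSpace ℝ (Fin n) →L[ℝ] W) (extChartAt (𝓡 n) x x) := by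
  rw [mvfderiv_eq_fderiv_chart hg]
  exact (((contDiffOn_chart hg x).contDiffAt ((isOpen_extChartAt_target x).mem_nhds
    (mem_extChartAt_target x))).differentiableAt (by simp)).hasFDerivAt

theorem injective_dF (x : M) : Function.Injective (F.dF x) := F.injective_mvfderiv x

theorem inner_normal_dF (x : M) (v : EuclideanSpace ℝ (Fin n)) :
    inner ℝ (F.normal x) (F.dF x v) = 0 := F.inner_normal_mvfderiv x v

theorem hasFDerivAt_dF [IsManifold (𝓡 n) ∞ M] (x : M) :
    HasFDerivAt (F.toFun ∘ (extChartAt (𝓡 n) x).symm) (F.dF x) (extChartAt (𝓡 n) x x) :=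
  hasFDerivAt_of_contMDiff F.contMDiff_toFun x

theorem hasFDerivAt_dN [IsManifold (𝓡 n) ∞ M] (x : M) :
    HasFDerivAt (F.normal ∘ (extChartAt (𝓡 n) x).symm) (F.dN x) (extChartAt (𝓡 n) x x) :=
  hasFDerivAt_of_contMDiff F.contMDiff_normal x

theorem inner_fst_dF [IsManifold (𝓡 n) ∞ M] (x : M) (v : EuclideanSpace ℝ (Fin n)) :
    inner ℝ (F.toFun x).fst (F.dF x v).fst = 0 := by
  have h1 := (WithLp.fstL 2 ℝ _ _).hasFDerivAt.comp _ (F.hasFDerivAt_dF x)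
  have h2 := h1.inner ℝ h1
  -- differentiate `‖p‖² = 1`
  have h3 : (fun u => inner ℝ ((WithLp.fstL 2 ℝ _ _ ∘ F.toFun ∘ (extChartAt (𝓡 n) x).symm) u)
      ((WithLp.fstL 2 ℝ _ _ ∘ F.toFun ∘ (extChartAt (𝓡 n) x).symm) u)) = fun _ => (1 : ℝ) := by
    ext u
    have : ‖(F.toFun ((extChartAt (𝓡 n) x).symm u)).fst‖ = 1 := F.mem_sphereProd _
    rw [real_inner_self_eq_norm_sq]
    change ‖(F.toFun ((extChartAt (𝓡 n) x).symm u)).fst‖ ^ 2 = 1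
    rw [this, one_pow]
  rw [h3] at h2
  have h4 := DFunLike.congr_fun (h2.unique (hasFDerivAt_const (1 : ℝ) _)) v
  simp [real_inner_comm] at h4
  linarith

theorem inner_normal_dN [IsManifold (𝓡 n) ∞ M] (x : M) (v : EuclideanSpace ℝ (Fin n)) :
    inner ℝ (F.normal x) (F.dN x v) = 0 := by
  have h2 := (F.hasFDerivAt_dN x).inner ℝ (F.hasFDerivAt_dN x)
  have h3 : (fun u => inner ℝ ((F.normal ∘ (extChartAt (𝓡 n) x).symm) u)
      ((F.normal ∘ (extChartAt (𝓡 n) x).symm) u)) = fun _ => (1 : ℝ) := by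
    ext u
    rw [real_inner_self_eq_norm_sq]
    simp [F.norm_normal]
  rw [h3] at h2
  have h4 := DFunLike.congr_fun (h2.unique (hasFDerivAt_const (1 : ℝ) _)) v
  simp only [ContinuousLinearMap.comp_apply, ContinuousLinearMap.prod_apply,
    fderivInnerCLM_apply, Function.comp_apply, extChartAt_to_inv, zero_apply,
    real_inner_comm] at h4
  have h5 := real_inner_comm (F.normal x) (F.dN x v)
  linarith

theorem finrank_eucProd : Module.finrank ℝ (EucProd n) = n + 2 := by
  rw [(WithLp.linearEquiv 2 ℝ (EuclideanSpace ℝ (Fin (n + 1)) × ℝ)).finrank_eq]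
  simp

/-- The tangent space of the hypersurface consists of all vectors orthogonal to the unit normal and
to the sphere. -/
theorem exists_dF_eq [IsManifold (𝓡 n) ∞ M] (x : M) (w : EucProd n) (h1 : inner ℝ (F.normal x) w = 0)
    (h2 : inner ℝ (F.toFun x).fst w.fst = 0) : ∃ v, F.dF x v = w := by
  let ψ : EucProd n →ₗ[ℝ] ℝ × ℝ := LinearMap.prod (innerSL ℝ (F.normal x)).toLinearMap
    ((innerSL ℝ (F.toFun x).fst).toLinearMap ∘ₗ (WithLp.fstL 2 ℝ _ _).toLinearMap)
  have hψ : ∀ w, ψ w = (inner ℝ (F.normal x) w, inner ℝ (F.toFun x).fst w.fst) := fun w => rfl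
  have hp : ‖(F.toFun x).fst‖ = 1 := F.mem_sphereProd x
  have hsurj : LinearMap.range ψ = ⊤ := by
    rw [LinearMap.range_eq_top]
    rintro ⟨a, b⟩
    refine ⟨a • F.normal x + b • WithLp.toLp 2 ((F.toFun x).fst, (0 : ℝ)), ?_⟩
    have e1 : inner ℝ (F.normal x) (F.normal x) = 1 := by
      rw [real_inner_self_eq_norm_sq, F.norm_normal]; norm_num
    have e3 := F.inner_normal_fst x
    have e4 : inner ℝ (F.normal x) (WithLp.toLp 2 ((F.toFun x).fst, (0 : ℝ)) : EucProd n) = 0 := by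
      rw [WithLp.prod_inner_apply]
      simpa [real_inner_comm] using e3
    rw [hψ]
    ext
    · simp only [inner_add_right, inner_smul_right, e1, e4]
      ring
    · simp only [WithLp.add_fst, WithLp.smul_fst, inner_add_right, inner_smul_right, e3]
      simp [hp]
  have hle : LinearMap.range (F.dF x).toLinearMap ≤ LinearMap.ker ψ := by
    rintro _ ⟨v, rfl⟩
    rw [LinearMap.mem_ker, hψ]
    exact Prod.ext (F.inner_normal_dF x v) (F.inner_fst_dF x v)
  have hdim : Module.finrank ℝ (LinearMap.range (F.dF x).toLinearMap) =
      Module.finrank ℝ (LinearMap.ker ψ) := by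
    have a1 := LinearMap.finrank_range_of_inj (f := (F.dF x).toLinearMap) (F.injective_dF x)
    have a2 := LinearMap.finrank_range_add_finrank_ker ψ
    rw [hsurj, finrank_eucProd, finrank_top] at a2
    rw [a1]
    simp at a2 ⊢
    omega
  have hw : w ∈ LinearMap.ker ψ := by
    rw [LinearMap.mem_ker, hψ, h1, h2]; rfl
  rw [← Submodule.eq_of_le_of_finrank_eq hle hdim] at hw
  exact hw

theorem shapeOperator_eq {x : M} {v w : EuclideanSpace ℝ (Fin n)}
    (h : F.dF x w = -tangentProj (F.toFun x) (F.dN x v)) : F.shapeOperator x v = w := by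
  have h1 : F.diff x w = -F.covDerivNormal x v := h
  have hker : LinearMap.ker (F.diff x) = ⊥ := LinearMap.ker_eq_bot.2 (F.injective_dF x)
  have h2 := LinearMap.leftInverse_apply_of_inj hker w
  rw [h1] at h2
  simp only [shapeOperator, LinearMap.neg_apply, LinearMap.comp_apply]
  rw [← h2, map_neg]

end OrientedHypersurface


/-! ### The mean curvature of a rotational hypersurface -/

section ProfileVector

variable {n : ℕ} (o : EuclideanSpace ℝ (Fin (n + 1)))

/-- The vector `(o - ⟨o, p⟩ p, -s)` at `y = (p, t)`. When `s = g' t` it is normal to the rotational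
hypersurface `⟨o, p⟩ = g t`, being the gradient of `⟨o, p⟩ - g t` on `𝕊ⁿ × ℝ`. -/
noncomputable def profileVec (y : EucProd n) (s : ℝ) : EucProd n :=
  WithLp.toLp 2 (o - (inner ℝ o y.fst : ℝ) • y.fst, -s)

variable {o}

theorem inner_profileVec (y : EucProd n) (s : ℝ) (w : EucProd n) :
    inner ℝ (profileVec o y s) w =
      inner ℝ o w.fst - inner ℝ o y.fst * inner ℝ y.fst w.fst - s * w.snd := by
  rw [WithLp.prod_inner_apply]
  simp [profileVec, inner_sub_left, inner_smul_left]
  ring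

theorem norm_sq_profileVec (ho : ‖o‖ = 1) {y : EucProd n} (hy : ‖y.fst‖ = 1) (s : ℝ) :
    inner ℝ (profileVec o y s) (profileVec o y s) = 1 - (inner ℝ o y.fst) ^ 2 + s ^ 2 := by
  rw [inner_profileVec]
  simp only [profileVec, WithLp.toLp_fst, WithLp.toLp_snd, inner_sub_right, inner_smul_right,
    real_inner_self_eq_norm_sq, ho, hy, real_inner_comm o y.fst]
  ring

end ProfileVector

theorem eucProd_ext {n : ℕ} {x y : EucProd n} (h1 : x.fst = y.fst) (h2 : x.snd = y.snd) : x = y :=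
  (WithLp.equiv 2 _).injective (Prod.ext h1 h2)

theorem tangentProj_apply {n : ℕ} (x w : EucProd n) :
    tangentProj x w = WithLp.toLp 2 (w.fst - (inner ℝ x.fst w.fst : ℝ) • x.fst, w.snd) := by
  refine eucProd_ext ?_ ?_ <;> simp [tangentProj]

namespace OrientedHypersurface

variable {n : ℕ} {M : Type*} [TopologicalSpace M] [ChartedSpace (EuclideanSpace ℝ (Fin n)) M]
  (F : OrientedHypersurface n M) {o : EuclideanSpace ℝ (Fin (n + 1))}

/-- If `d⟨o, p⟩ = s dt` on the tangent space of the hypersurface, then `profileVec` is orthogonal to that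
space, hence a multiple of the normal. -/
theorem profileVec_eq_smul_normal [IsManifold (𝓡 n) ∞ M] (x : M) {s : ℝ}
    (h : ∀ v, inner ℝ o (F.dF x v).fst = s * (F.dF x v).snd) :
    profileVec o (F.toFun x) s =
      (inner ℝ (F.normal x) (profileVec o (F.toFun x) s) : ℝ) • F.normal x := by
  set P := profileVec o (F.toFun x) s with hP
  set c : ℝ := inner ℝ (F.normal x) P
  have hp : ‖(F.toFun x).fst‖ = 1 := F.mem_sphereProd x
  have hNN : inner ℝ (F.normal x) (F.normal x) = 1 := by
    rw [real_inner_self_eq_norm_sq, F.norm_normal]; norm_num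
  have horth : ∀ v, inner ℝ (P - c • F.normal x) (F.dF x v) = 0 := by
    intro v
    rw [inner_sub_left, inner_smul_left, F.inner_normal_dF, hP, inner_profileVec, F.inner_fst_dF,
      h v]
    simp
  obtain ⟨v, hv⟩ := F.exists_dF_eq x (P - c • F.normal x)
    (by rw [inner_sub_right, inner_smul_right, hNN]; simp [c])
    (by
      simp only [hP, profileVec, WithLp.sub_fst, WithLp.smul_fst, WithLp.toLp_fst, inner_sub_right,
        inner_smul_right, F.inner_normal_fst, real_inner_self_eq_norm_sq, hp, real_inner_comm o]
      ring)
  have := horth v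
  rw [hv, inner_self_eq_zero] at this
  exact sub_eq_zero.1 this

theorem sq_inner_normal_profileVec [IsManifold (𝓡 n) ∞ M] (ho : ‖o‖ = 1) (x : M)
    {s : ℝ}
    (h : ∀ v, inner ℝ o (F.dF x v).fst = s * (F.dF x v).snd) :
    (inner ℝ (F.normal x) (profileVec o (F.toFun x) s)) ^ 2 =
      1 - (inner ℝ o (F.toFun x).fst) ^ 2 + s ^ 2 := by
  rw [← norm_sq_profileVec ho (F.mem_sphereProd x) s]
  conv_rhs => rw [F.profileVec_eq_smul_normal x h]
  rw [inner_smul_left, inner_smul_right, real_inner_self_eq_norm_sq, F.norm_normal]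
  simp [sq]

/-- `F` is, near `x`, a rotational hypersurface `⟨o, p⟩ = g t` transversal to the horizontal
hyperplanes. -/
structure HasProfileAt (o : EuclideanSpace ℝ (Fin (n + 1))) (g : ℝ → ℝ) (x : M) : Prop where
  eventually_contDiffAt : ∀ᶠ t in nhds (F.height x), ContDiffAt ℝ ∞ g t
  eventually_eq : ∀ᶠ y in nhds x, inner ℝ o (F.toFun y).fst = g (F.height y)
  exists_snd_ne : ∃ v, (F.dF x v).snd ≠ 0
  sq_lt_one : g (F.height x) ^ 2 < 1

variable {F} {g : ℝ → ℝ} {x : M}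

theorem continuous_toFun : Continuous F.toFun := F.contMDiff_toFun.continuous

theorem contMDiff_height : ContMDiff (𝓡 n) 𝓘(ℝ, ℝ) ∞ F.height :=
  (WithLp.sndL 2 ℝ _ _).contMDiff.comp F.contMDiff_toFun

theorem contMDiff_axisInner (o : EuclideanSpace ℝ (Fin (n + 1))) :
    ContMDiff (𝓡 n) 𝓘(ℝ, ℝ) ∞ (fun x => (inner ℝ o (F.toFun x).fst : ℝ)) :=
  ((innerSL ℝ o).comp (WithLp.fstL 2 ℝ _ _)).contMDiff.comp F.contMDiff_toFun

theorem hasFDerivAt_clm_chart [IsManifold (𝓡 n) ∞ M] {W : Type*} [NormedAddCommGroup W]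
    [NormedSpace ℝ W] (L : EucProd n →L[ℝ] W) (x : M) :
    HasFDerivAt (fun u => L (F.toFun ((extChartAt (𝓡 n) x).symm u))) (L.comp (F.dF x))
      (extChartAt (𝓡 n) x x) :=
  HasFDerivAt.comp (g := L) (f := F.toFun ∘ (extChartAt (𝓡 n) x).symm) _ L.hasFDerivAt
    (F.hasFDerivAt_dF x)

theorem mvfderiv_height_apply [IsManifold (𝓡 n) ∞ M] (x : M) (v : EuclideanSpace ℝ (Fin n)) :
    mvfderiv (𝓡 n) F.height x v = (F.dF x v).snd := by
  have h2 : HasFDerivAt (F.height ∘ (extChartAt (𝓡 n) x).symm)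
    ((WithLp.sndL 2 ℝ _ _).comp (F.dF x)) (extChartAt (𝓡 n) x x) :=
      hasFDerivAt_clm_chart (WithLp.sndL 2 ℝ _ _) x
  rw [mvfderiv_eq_fderiv_chart contMDiff_height, h2.fderiv]
  rfl

theorem inner_dF_of_eventually_eq [IsManifold (𝓡 n) ∞ M]
    (hg : DifferentiableAt ℝ g (F.height x))
    (h : ∀ᶠ y in nhds x, inner ℝ o (F.toFun y).fst = g (F.height y))
    (v : EuclideanSpace ℝ (Fin n)) :
    inner ℝ o (F.dF x v).fst = deriv g (F.height x) * (F.dF x v).snd := by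
  set e := extChartAt (𝓡 n) x with he
  have h1 : HasFDerivAt (fun u => (inner ℝ o (F.toFun (e.symm u)).fst : ℝ))
      (((innerSL ℝ o).comp (WithLp.fstL 2 ℝ _ _)).comp (F.dF x)) (e x) :=
    hasFDerivAt_clm_chart ((innerSL ℝ o).comp (WithLp.fstL 2 ℝ _ _)) x
  have h2 : HasFDerivAt (fun u => F.height (e.symm u))
      ((WithLp.sndL 2 ℝ _ _).comp (F.dF x)) (e x) :=
    hasFDerivAt_clm_chart (WithLp.sndL 2 ℝ _ _) x
  have hx : F.height (e.symm (e x)) = F.height x := by rw [he, extChartAt_to_inv]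
  have h3 : HasFDerivAt (fun u => g (F.height (e.symm u)))
      (deriv g (F.height x) • (WithLp.sndL 2 ℝ _ _).comp (F.dF x)) (e x) := by
    have hg' := hg.hasDerivAt
    nth_rw 2 [← hx] at hg'
    exact hg'.comp_hasFDerivAt (f := fun u => F.height (e.symm u)) _ h2
  have hev : (fun u => (inner ℝ o (F.toFun (e.symm u)).fst : ℝ)) =ᶠ[nhds (e x)]
      fun u => g (F.height (e.symm u)) := by
    have := continuousAt_extChartAt_symm (I := 𝓡 n) x
    unfold ContinuousAt at this
    rw [extChartAt_to_inv] at this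
    exact this.eventually h
  exact DFunLike.congr_fun (h1.unique (h3.congr_of_eventuallyEq hev)) v

/-- The derivative of an identity `P = ⟨N, P⟩ N`; its component along `N` remains unspecified. -/
theorem exists_eq_smul_add_of_eventuallyEq_inner_smul {E V : Type*} [NormedAddCommGroup E]
    [NormedSpace ℝ E] [NormedAddCommGroup V] [InnerProductSpace ℝ V] {P N : E → V}
    {P' N' : E →L[ℝ] V} {u : E} (hP : HasFDerivAt P P' u) (hN : HasFDerivAt N N' u)
    (h : P =ᶠ[nhds u] fun w => (inner ℝ (N w) (P w) : ℝ) • N w) (v : E) :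
    ∃ c' : ℝ, P' v = c' • N u + (inner ℝ (N u) (P u) : ℝ) • N' v := by
  have key := DFunLike.congr_fun
    (hP.unique (((hN.inner ℝ hP).smul hN).congr_of_eventuallyEq h)) v
  exact ⟨_, key.trans (add_comm _ _)⟩

theorem hasFDerivAt_profileVec [IsManifold (𝓡 n) ∞ M] (x : M) {a : ℝ → ℝ} {a' : ℝ}
    (ha : HasDerivAt a a' (F.height x)) :
    ∃ P' : EuclideanSpace ℝ (Fin n) →L[ℝ] EucProd n,
      HasFDerivAt (fun u => profileVec o (F.toFun ((extChartAt (𝓡 n) x).symm u))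
        (a (F.height ((extChartAt (𝓡 n) x).symm u)))) P' (extChartAt (𝓡 n) x x) ∧
      ∀ v, P' v = WithLp.toLp 2 (-((inner ℝ o (F.dF x v).fst : ℝ) • (F.toFun x).fst +
        (inner ℝ o (F.toFun x).fst : ℝ) • (F.dF x v).fst), -(a' * (F.dF x v).snd)) := by
  set e := extChartAt (𝓡 n) x with he
  have hex : e.symm (e x) = x := extChartAt_to_inv x
  have hF1 : HasFDerivAt (fun u => (F.toFun (e.symm u)).fst)
      ((WithLp.fstL 2 ℝ _ _).comp (F.dF x)) (e x) :=
    hasFDerivAt_clm_chart (WithLp.fstL 2 ℝ _ _) x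
  have hFi : HasFDerivAt (fun u => (inner ℝ o (F.toFun (e.symm u)).fst : ℝ))
      (((innerSL ℝ o).comp (WithLp.fstL 2 ℝ _ _)).comp (F.dF x)) (e x) :=
    hasFDerivAt_clm_chart ((innerSL ℝ o).comp (WithLp.fstL 2 ℝ _ _)) x
  have hF2 : HasFDerivAt (fun u => F.height (e.symm u))
      ((WithLp.sndL 2 ℝ _ _).comp (F.dF x)) (e x) :=
    hasFDerivAt_clm_chart (WithLp.sndL 2 ℝ _ _) x
  have hg3 : HasFDerivAt (fun u => a (F.height (e.symm u)))
      (a' • (WithLp.sndL 2 ℝ _ _).comp (F.dF x)) (e x) := by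
    nth_rw 1 [← hex] at ha
    exact ha.comp_hasFDerivAt (f := fun u => F.height (e.symm u)) _ hF2
  have hpair := ((hFi.smul hF1).const_sub o).prodMk hg3.neg
  have hL := ((WithLp.prodContinuousLinearEquiv 2 ℝ (EuclideanSpace ℝ (Fin (n + 1))) ℝ).symm :
      _ →L[ℝ] EucProd n).hasFDerivAt.comp (e x) hpair
  refine ⟨_, hL, fun v => ?_⟩
  refine eucProd_ext ?_ ?_
  · simp [hex]
    abel
  · simp

theorem HasProfileAt.contDiffAt (h : F.HasProfileAt o g x) : ContDiffAt ℝ ∞ g (F.height x) :=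
  h.eventually_contDiffAt.self_of_nhds

/-- The covariant derivative of `N`, computed from the profile. Here `c = ⟨N, P⟩`, where
`P = (o - ⟨o, p⟩ p, -g')` is the gradient of `⟨o, p⟩ - g t`, so that `P = c N`. The last factor is the
tangential part of the vertical unit vector. -/
theorem HasProfileAt.tangentProj_dN [IsManifold (𝓡 n) ∞ M] (ho : ‖o‖ = 1)
    (h : F.HasProfileAt o g x) :
    ∃ c : ℝ, c ^ 2 = 1 - g (F.height x) ^ 2 + deriv g (F.height x) ^ 2 ∧
      c * (F.normal x).snd = -deriv g (F.height x) ∧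
      ∀ v, c • tangentProj (F.toFun x) (F.dN x v) =
        -(g (F.height x) • F.dF x v) +
          ((g (F.height x) - deriv (deriv g) (F.height x)) * (F.dF x v).snd) •
            ((WithLp.toLp 2 ((0 : EuclideanSpace ℝ (Fin (n + 1))), (1 : ℝ)) : EucProd n)
              - (F.normal x).snd • F.normal x) := by
  have hdiff : ∀ᶠ t in nhds (F.height x), DifferentiableAt ℝ g t :=
    ((h.contDiffAt.of_le (m := 1) (by norm_cast)).eventually (by simp)).mono
      fun t ht => ht.differentiableAt (by simp)
  have hcont : ContinuousAt F.height x := contMDiff_height.continuous.continuousAt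
  have hD : ∀ᶠ y in nhds x, ∀ v, inner ℝ o (F.dF y v).fst =
      deriv g (F.height y) * (F.dF y v).snd := by
    filter_upwards [h.eventually_eq.eventually_nhds, hcont.eventually hdiff] with y h1 h2
    exact fun v => inner_dF_of_eventually_eq h2 h1 v
  set c : ℝ := inner ℝ (F.normal x) (profileVec o (F.toFun x) (deriv g (F.height x))) with hc
  set p := (F.toFun x).fst with hp
  have hpn : ‖p‖ = 1 := F.mem_sphereProd x
  have hf : inner ℝ o p = g (F.height x) := h.eventually_eq.self_of_nhds
  have hPx := F.profileVec_eq_smul_normal x hD.self_of_nhds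
  rw [← hc] at hPx
  refine ⟨c, ?_, ?_, fun v => ?_⟩
  · rw [hc, F.sq_inner_normal_profileVec ho x hD.self_of_nhds, ← hp, hf]
  · have := congrArg WithLp.snd hPx
    simp [profileVec] at this
    linarith
  have hg2 : HasDerivAt (deriv g) (deriv (deriv g) (F.height x)) (F.height x) := by
    have h2 : ContDiffAt ℝ 1 (deriv g) (F.height x) :=
      (h.contDiffAt.of_le (m := 2) (by norm_cast)).derivWithin (by norm_num)
    exact (h2.differentiableAt (by simp)).hasDerivAt
  -- differentiate `profileVec = ⟨N, profileVec⟩ N` in the chart at `x`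
  obtain ⟨P', hP, hP'⟩ := F.hasFDerivAt_profileVec (o := o) x hg2
  obtain ⟨c', hc'⟩ := exists_eq_smul_add_of_eventuallyEq_inner_smul hP (F.hasFDerivAt_dN x) (by
    have := continuousAt_extChartAt_symm (I := 𝓡 n) x
    unfold ContinuousAt at this
    rw [extChartAt_to_inv] at this
    filter_upwards [this.eventually hD] with u hu
    exact F.profileVec_eq_smul_normal _ hu) v
  simp only [Function.comp_apply, extChartAt_to_inv] at hc'
  rw [← hc, hP' v, ← hp, hf] at hc'
  have hNN : inner ℝ (F.normal x) (F.normal x) = 1 := by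
    rw [real_inner_self_eq_norm_sq, F.norm_normal]; norm_num
  have hpp : inner ℝ p p = 1 := by rw [real_inner_self_eq_norm_sq, hpn]; norm_num
  have hNp : inner ℝ p (F.normal x).fst = 0 := F.inner_normal_fst x
  have hdp : inner ℝ p (F.dF x v).fst = 0 := F.inner_fst_dF x v
  have hNd := F.inner_normal_dF x v
  have hNdN := F.inner_normal_dN x v
  set w := F.dF x v
  set y := F.dN x v
  set N := F.normal x
  -- the component along `N`
  have hc'v : c' = (g (F.height x) - deriv (deriv g) (F.height x)) * w.snd * N.snd := by
    have := congrArg (fun z => inner ℝ N z) hc'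
    simp only [inner_add_right, inner_smul_right, hNN, hNdN] at this
    rw [WithLp.prod_inner_apply] at this hNd
    have hNp' : inner ℝ N.fst p = 0 := by rw [real_inner_comm]; exact hNp
    simp only [WithLp.ofLp_fst, WithLp.ofLp_snd, inner_neg_right,
      inner_add_right, inner_smul_right, hNp', RCLike.inner_apply, conj_trivial] at this hNd
    linear_combination -this - g (F.height x) * hNd
  have e1 := congrArg WithLp.fst hc'
  have e2 := congrArg WithLp.snd hc'
  simp only [WithLp.add_fst, WithLp.smul_fst, WithLp.add_snd, WithLp.smul_snd, WithLp.toLp_fst,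
    WithLp.toLp_snd, smul_eq_mul] at e1 e2
  have e3 := congrArg (fun z => inner ℝ p z) e1
  simp only [inner_add_right, inner_smul_right, inner_neg_right, hNp, hdp, hpp] at e3
  rw [tangentProj_apply, ← hp]
  refine eucProd_ext ?_ ?_
  · have e4 : c • y.fst = -(inner ℝ o w.fst • p + g (F.height x) • w.fst) - c' • N.fst := by
      rw [e1]; abel
    have e5 : c * inner ℝ p y.fst = -inner ℝ o w.fst := by linear_combination -e3
    simp only [WithLp.smul_fst, WithLp.toLp_fst, WithLp.add_fst, WithLp.neg_fst, WithLp.sub_fst,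
      smul_sub, smul_smul, e5]
    rw [e4, hc'v]
    module
  · simp only [WithLp.smul_snd, WithLp.toLp_snd, WithLp.add_snd, WithLp.neg_snd, WithLp.sub_snd,
      smul_eq_mul]
    linear_combination -e2 - N.snd * hc'v

/-- The `r`-th mean curvature of a rotational hypersurface vanishes exactly where its profile
satisfies the displayed equation. The principal curvatures are `g / c`, of multiplicity `n - 1`, and
`(g - (g - g'') (1 - g²) / c²) / c`, where `c² = 1 - g² + g'²`. -/
theorem HasProfileAt.meanCurvature_eq_zero_iff [IsManifold (𝓡 n) ∞ M] (ho : ‖o‖ = 1)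
    (h : F.HasProfileAt o g x) {r : ℕ} (hr : 1 ≤ r) (hrn : r ≤ n) :
    F.meanCurvature r x = 0 ↔
      g (F.height x) ^ (r - 1) *
        (n * g (F.height x) * (1 - g (F.height x) ^ 2 + deriv g (F.height x) ^ 2) -
          r * (g (F.height x) - deriv (deriv g) (F.height x)) * (1 - g (F.height x) ^ 2)) = 0 := by
  obtain ⟨c, hc, hcN, hT⟩ := h.tangentProj_dN ho
  obtain ⟨s, rfl⟩ : ∃ s, r = s + 1 := ⟨r - 1, by omega⟩
  obtain ⟨m, rfl⟩ : ∃ m, n = m + 1 := ⟨n - 1, by omega⟩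
  have hlt := h.sq_lt_one
  set G := g (F.height x)
  set G' := deriv g (F.height x)
  set G'' := deriv (deriv g) (F.height x)
  set ν := (F.normal x).snd
  have hc0 : c ≠ 0 := by
    rintro rfl
    nlinarith [sq_nonneg G']
  have hν : c ^ 2 * (1 - ν ^ 2) = 1 - G ^ 2 := by
    have : c ^ 2 * ν ^ 2 = G' ^ 2 := by rw [← mul_pow, hcN]; ring
    linarith
  have hNN : inner ℝ (F.normal x) (F.normal x) = 1 := by
    rw [real_inner_self_eq_norm_sq, F.norm_normal]; norm_num
  -- the tangential part of the vertical direction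
  obtain ⟨τ, hτ⟩ := F.exists_dF_eq x
    ((WithLp.toLp 2 ((0 : EuclideanSpace ℝ (Fin (m + 1 + 1))), (1 : ℝ)) : EucProd (m + 1))
      - ν • F.normal x)
    (by
      rw [inner_sub_right, inner_smul_right, hNN, WithLp.prod_inner_apply]
      simp [ν])
    (by simp [inner_smul_right, F.inner_normal_fst])
  have hA : ∀ v, F.shapeOperator x v =
      c⁻¹ • (G • v - ((G - G'') * (F.dF x v).snd) • τ) := by
    intro v
    apply F.shapeOperator_eq
    apply smul_right_injective _ hc0
    simp only
    rw [smul_neg, hT v, map_smul, smul_inv_smul₀ hc0, map_sub, map_smul, map_smul, hτ]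
    abel
  let φ : EuclideanSpace ℝ (Fin (m + 1)) →ₗ[ℝ] ℝ := ((WithLp.sndL 2 ℝ _ _).comp (F.dF x)).toLinearMap
  have hφv : ∀ v, φ v = (F.dF x v).snd := fun v => rfl
  have hφτ : φ τ = 1 - ν ^ 2 := by rw [hφv, hτ]; simp [ν, sq]
  have hφ : φ ≠ 0 := by
    obtain ⟨v, hv⟩ := h.exists_snd_ne
    exact fun h0 => hv (by rw [← hφv, h0]; rfl)
  have key := esymm_roots_charpoly_of_ker (m := m) (by simp) (F.shapeOperator x) φ hφ (c⁻¹ * G)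
    (c⁻¹ * (G - (G - G'') * (1 - ν ^ 2)))
    (fun v hv => by
      rw [hA, ← hφv, hv]
      simp [smul_smul])
    (fun v => by
      rw [hA, map_smul, map_sub, map_smul, map_smul, hφτ, ← hφv]
      simp only [smul_eq_mul]
      ring) s
  change (F.shapeOperator x).charpoly.roots.esymm (s + 1) = 0 ↔ _
  rw [key, Nat.add_sub_cancel]
  have hch : ((m.choose (s + 1) : ℕ) : ℝ) * (s + 1) = m.choose s * (m - s) := by
    have := Nat.choose_succ_right_eq m s
    rw [← Nat.cast_sub (by omega : s ≤ m)]
    exact_mod_cast this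
  have hcs : ((m.choose s : ℕ) : ℝ) ≠ 0 := by
    exact_mod_cast (Nat.choose_pos (by omega : s ≤ m)).ne'
  -- multiplication by `(s + 1) c ^ (s + 3)` clears the denominators
  have hid : ((s : ℝ) + 1) * c ^ (s + 3) *
      ((m.choose (s + 1)) * (c⁻¹ * G) ^ (s + 1) +
        (c⁻¹ * (G - (G - G'') * (1 - ν ^ 2))) * ((m.choose s) * (c⁻¹ * G) ^ s)) =
      (m.choose s) * (G ^ s * (((m + 1 : ℕ) : ℝ) * G * (1 - G ^ 2 + G' ^ 2) -
        ((s + 1 : ℕ) : ℝ) * (G - G'') * (1 - G ^ 2))) := by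
    rw [← hc, ← hν]
    have hcc : c ^ (s + 3) * (c⁻¹) ^ (s + 1) = c ^ 2 := by
      rw [inv_pow, show c ^ (s + 3) = c ^ 2 * c ^ (s + 1) by ring,
        mul_inv_cancel_right₀ (pow_ne_zero _ hc0)]
    push_cast
    calc _ = (c ^ (s + 3) * (c⁻¹) ^ (s + 1)) * (((m.choose (s + 1)) * (s + 1)) * G ^ (s + 1) +
        (s + 1) * (G - (G - G'') * (1 - ν ^ 2)) * m.choose s * G ^ s) := by ring
      _ = _ := by rw [hcc, hch]; ring
  have hs : ((s : ℝ) + 1) * c ^ (s + 3) ≠ 0 := mul_ne_zero (by positivity) (pow_ne_zero _ hc0)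
  constructor <;> intro h0
  · rw [h0, mul_zero] at hid
    exact (mul_eq_zero.1 hid.symm).resolve_left hcs
  · rw [h0, mul_zero] at hid
    exact (mul_eq_zero.1 hid).resolve_left hs

end OrientedHypersurface


/-! ### Local profiles of rotational hypersurfaces -/

theorem eq_zero_of_hasFDerivAt_of_eventuallyEq_const {E V : Type*} [NormedAddCommGroup E]
    [NormedSpace ℝ E] [NormedAddCommGroup V] [NormedSpace ℝ V] {f : E → V} {f' : E →L[ℝ] V} {x : E}
    {c : V} (h : HasFDerivAt f f' x) (hc : f =ᶠ[nhds x] fun _ => c) : f' = 0 :=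
  h.unique ((hasFDerivAt_const c x).congr_of_eventuallyEq hc)

/-- The slices `{t} × K` of a smooth coordinate system are immersed. -/
theorem exists_hasFDerivAt_slice_injective {E K : Type*} [NormedAddCommGroup E] [NormedSpace ℝ E]
    [NormedAddCommGroup K] [NormedSpace ℝ K] (Ψ : OpenPartialHomeomorph E (ℝ × K)) {t : ℝ} {k : K}
    (h : (t, k) ∈ Ψ.target) (h1 : ContDiffOn ℝ ∞ Ψ Ψ.source)
    (h2 : ContDiffOn ℝ ∞ Ψ.symm Ψ.target) :
    ∃ S : K →L[ℝ] E, HasFDerivAt (fun k => Ψ.symm (t, k)) S k ∧ Function.Injective S := by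
  have htg : Ψ.target ∈ nhds (t, k) := Ψ.open_target.mem_nhds h
  have hS := ((h2.contDiffAt htg).differentiableAt (by simp)).hasFDerivAt
  have hL := ((h1.contDiffAt (Ψ.open_source.mem_nhds (Ψ.map_target h))).differentiableAt
    (by simp)).hasFDerivAt
  have hι : HasFDerivAt (fun k : K => (t, k)) (ContinuousLinearMap.inr ℝ ℝ K) k :=
    hasFDerivAt_prodMk_right t k
  have hSι := HasFDerivAt.comp (g := Ψ.symm) (f := fun k : K => (t, k)) k hS hι
  have hcomp := HasFDerivAt.comp (g := Ψ) (f := fun k : K => Ψ.symm (t, k)) k hL hSι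
  have hev : (Ψ ∘ fun k : K => Ψ.symm (t, k)) =ᶠ[nhds k] fun k => (t, k) := by
    have : ContinuousAt (fun k : K => (t, k)) k := by fun_prop
    filter_upwards [this.eventually htg] with k' hk'
    exact Ψ.right_inv hk'
  have hz := hcomp.unique (hι.congr_of_eventuallyEq hev)
  refine ⟨_, hSι, fun a b hab => ?_⟩
  have ha := DFunLike.congr_fun hz a
  have hb := DFunLike.congr_fun hz b
  simp only [ContinuousLinearMap.comp_apply, ContinuousLinearMap.inr_apply] at ha hb hab
  rw [hab, hb] at ha
  exact (congrArg Prod.snd ha).symm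

namespace OrientedHypersurface

open Set Topology

variable {n : ℕ} {M : Type*} [TopologicalSpace M] [ChartedSpace (EuclideanSpace ℝ (Fin n)) M]
  {F : OrientedHypersurface n M} {o : EuclideanSpace ℝ (Fin (n + 1))}

/-- By Sard's theorem, almost every height is a regular value of the height function. -/
theorem dense_isTransversalAt [IsManifold (𝓡 n) ∞ M] [SecondCountableTopology M]
    (F : OrientedHypersurface n M) :
    Dense {t | F.IsTransversalAt t} := by
  apply MeasureTheory.Measure.dense_of_ae (μ := MeasureTheory.volume)
  obtain ⟨s, hs, hcov⟩ := TopologicalSpace.countable_cover_nhds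
    (fun x : M => extChartAt_source_mem_nhds (I := 𝓡 n) x)
  have hnull : MeasureTheory.volume (⋃ x ∈ s, (F.height ∘ (extChartAt (𝓡 n) x).symm) ''
      {u ∈ (extChartAt (𝓡 n) x).target | fderiv ℝ (F.height ∘ (extChartAt (𝓡 n) x).symm) u = 0})
        = 0 := by
    rw [MeasureTheory.measure_biUnion_null_iff hs]
    exact fun x _ => volume_image_fderiv_eq_zero (isOpen_extChartAt_target x)
      (contDiffOn_chart contMDiff_height x)
  refine MeasureTheory.measure_mono_null (fun t ht => ?_) hnull
  simp only [IsTransversalAt, mem_compl_iff, mem_ofPred_eq, not_forall, not_not] at ht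
  obtain ⟨y, hy, hy0⟩ := ht
  obtain ⟨x, hx, hyx⟩ := mem_iUnion₂.1 (hcov.symm ▸ mem_univ y)
  refine mem_iUnion₂.2 ⟨x, hx, extChartAt (𝓡 n) x y, ⟨(extChartAt (𝓡 n) x).map_source hyx, ?_⟩, ?_⟩
  · obtain ⟨B, hB⟩ := exists_mvfderiv_eq_fderiv_comp x hyx
    ext v
    have := hB ℝ F.height contMDiff_height (B.symm v)
    rw [hy0, B.apply_symm_apply] at this
    exact this.symm
  · rw [Function.comp_apply, (extChartAt (𝓡 n) x).left_inv hyx, hy]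

theorem inner_eq_cos_angle (ho : ‖o‖ = 1) (x : M) :
    inner ℝ o (F.toFun x).fst = Real.cos (InnerProductGeometry.angle o (F.toFun x).fst) := by
  rw [InnerProductGeometry.cos_angle, ho, show ‖(F.toFun x).fst‖ = 1 from F.mem_sphereProd x]
  simp

/-- Near a point where the height is regular, a rotational hypersurface is the graph of a smooth
profile: the level sets are connected in suitable coordinates, so that `⟨o, p⟩` is constant on those
of transversal height, hence by density on all of them. -/
theorem IsRotationalAbout.exists_hasProfileAt [IsManifold (𝓡 n) ∞ M]
    [SecondCountableTopology M] (hn : 2 ≤ n)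
    (ho : ‖o‖ = 1) (hF : F.IsRotationalAbout o) {x : M} (hx : ∃ v, (F.dF x v).snd ≠ 0) :
    ∃ g, F.HasProfileAt o g x := by
  set e := extChartAt (𝓡 n) x with he
  set w : EuclideanSpace ℝ (Fin n) → ℝ := F.height ∘ e.symm with hw
  have hwc : ContDiffOn ℝ ∞ w e.target := contDiffOn_chart contMDiff_height x
  have hex : e.symm (e x) = x := extChartAt_to_inv x
  have hw0 : fderiv ℝ w (e x) ≠ 0 := by
    obtain ⟨v, hv⟩ := hx
    intro h0
    apply hv
    rw [← mvfderiv_height_apply, mvfderiv_eq_fderiv_chart contMDiff_height]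
    change fderiv ℝ w (e x) v = 0
    rw [h0]
    rfl
  obtain ⟨K, hK, Ψ, hxΨ, hΨU, hΨx, hΨw, hΨd, hΨs⟩ := exists_smooth_straightening
    (isOpen_extChartAt_target x) hwc (mem_extChartAt_target x) hw0
  have hwx : w (e x) = F.height x := by rw [hw, Function.comp_apply, hex]
  rw [hwx] at hΨx
  set t₀ := F.height x with ht₀
  obtain ⟨ε, hε, hbox⟩ : ∃ ε > 0, ∀ t ∈ Metric.ball t₀ ε, ∀ k ∈ Metric.ball (0 : K) ε,
      (t, k) ∈ Ψ.target := by
    have h1 : Ψ.target ∈ 𝓝 (t₀, (0 : K)) := by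
      rw [← hΨx]; exact Ψ.open_target.mem_nhds (Ψ.map_source hxΨ)
    obtain ⟨ε, hε, hb⟩ := Metric.mem_nhds_iff.1 h1
    refine ⟨ε, hε, fun t ht k hk => hb ?_⟩
    rw [← ball_prod_same]
    exact ⟨ht, hk⟩
  let φ : ℝ × K → M := fun z => e.symm (Ψ.symm z)
  have hφh : ∀ z ∈ Ψ.target, F.height (φ z) = z.1 := by
    intro z hz
    have := hΨw _ (Ψ.map_target hz)
    rw [Ψ.right_inv hz] at this
    exact this.symm
  have hφc : ContinuousOn φ Ψ.target :=
    (continuousOn_extChartAt_symm x).comp Ψ.continuousOn_symm fun z hz => hΨU (Ψ.map_target hz)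
  let f : M → ℝ := fun y => inner ℝ o (F.toFun y).fst
  have hf : ContMDiff (𝓡 n) 𝓘(ℝ, ℝ) ∞ f := contMDiff_axisInner o
  have hA : ContDiffOn ℝ ∞ (f ∘ φ) Ψ.target :=
    (contDiffOn_chart hf x).comp hΨs fun z hz => hΨU (Ψ.map_target hz)
  -- `f` is constant on the slices of the box
  have hslice : ∀ t ∈ Metric.ball t₀ ε, ∀ k ∈ Metric.ball (0 : K) ε, f (φ (t, k)) = f (φ (t, 0)) := by
    have h0 : (0 : K) ∈ Metric.ball (0 : K) ε := Metric.mem_ball_self hε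
    have htr : ∀ t ∈ Metric.ball t₀ ε, F.IsTransversalAt t → ∀ k ∈ Metric.ball (0 : K) ε,
        f (φ (t, k)) = f (φ (t, 0)) := by
      intro t ht htt k hk
      obtain ⟨ρ, -, -, hρ⟩ := hF t htt (φ (t, 0)) (hφh _ (hbox t ht 0 h0))
      have hpre : IsPreconnected ((fun k : K => φ (t, k)) '' Metric.ball (0 : K) ε) :=
        (convex_ball _ _).isPreconnected.image _
          (hφc.comp (by fun_prop) fun k hk => hbox t ht k hk)
      have hsub := hpre.subset_connectedComponentIn (F := {z | F.height z = t})
        (mem_image_of_mem _ h0) (by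
          rintro _ ⟨k, hk, rfl⟩
          exact hφh _ (hbox t ht k hk))
      simp only [f]
      rw [inner_eq_cos_angle ho, inner_eq_cos_angle ho, hρ _ (hsub (mem_image_of_mem _ hk)),
        hρ _ (hsub (mem_image_of_mem _ h0))]
    -- the heights that are not transversal, by density
    intro t ht k hk
    have hcl : t ∈ closure (Metric.ball t₀ ε ∩ {t | F.IsTransversalAt t}) :=
      F.dense_isTransversalAt.open_subset_closure_inter Metric.isOpen_ball ht
    have : (𝓝[Metric.ball t₀ ε ∩ {t | F.IsTransversalAt t}] t).NeBot :=
      mem_closure_iff_nhdsWithin_neBot.1 hcl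
    have hcont : ∀ k ∈ Metric.ball (0 : K) ε, Filter.Tendsto (fun t => f (φ (t, k)))
        (𝓝[Metric.ball t₀ ε ∩ {t | F.IsTransversalAt t}] t) (𝓝 (f (φ (t, k)))) := by
      intro k hk
      have h1 : ContinuousAt (f ∘ φ) (t, k) :=
        hA.continuousOn.continuousAt (Ψ.open_target.mem_nhds (hbox t ht k hk))
      have h2 : ContinuousAt (fun t : ℝ => (t, k)) t := by fun_prop
      exact (ContinuousAt.comp (f := fun t : ℝ => (t, k)) h1 h2).continuousWithinAt
    refine tendsto_nhds_unique_of_eventuallyEq (hcont k hk) (hcont 0 h0) ?_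
    filter_upwards [self_mem_nhdsWithin] with t' ht'
    exact htr t' ht'.1 ht'.2 k hk
  have h0 : (0 : K) ∈ Metric.ball (0 : K) ε := Metric.mem_ball_self hε
  have hgc : ∀ t ∈ Metric.ball t₀ ε, ContDiffAt ℝ ∞ (fun t => f (φ (t, 0))) t := by
    intro t ht
    have h1 : ContDiffAt ℝ ∞ (f ∘ φ) (t, 0) :=
      hA.contDiffAt (Ψ.open_target.mem_nhds (hbox t ht 0 h0))
    exact h1.comp (f := fun t : ℝ => (t, (0 : K))) t (by fun_prop)
  have hxe : φ (t₀, 0) = x := by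
    simp only [φ]
    rw [← hΨx, Ψ.left_inv hxΨ, hex]
  refine ⟨fun t => f (φ (t, 0)), ⟨?_, ?_, hx, ?_⟩⟩
  · filter_upwards [Metric.ball_mem_nhds t₀ hε] with t ht using hgc t ht
  · have h1 : ∀ᶠ y in 𝓝 x, e y ∈ Ψ.source :=
      (continuousAt_extChartAt x).eventually (Ψ.open_source.mem_nhds hxΨ)
    have h2 : ∀ᶠ y in 𝓝 x, Ψ (e y) ∈ Metric.ball t₀ ε ×ˢ Metric.ball (0 : K) ε := by
      have hc : ContinuousAt (Ψ ∘ e) x :=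
        ContinuousAt.comp (Ψ.continuousAt hxΨ) (continuousAt_extChartAt x)
      refine hc.eventually ?_
      rw [Function.comp_apply, hΨx, ball_prod_same]
      exact Metric.ball_mem_nhds _ hε
    filter_upwards [h1, h2, extChartAt_source_mem_nhds (I := 𝓡 n) x] with y hy1 hy2 hy3
    have h3 := hslice _ hy2.1 _ hy2.2
    have h4 : φ ((Ψ (e y)).1, (Ψ (e y)).2) = y := by
      change e.symm (Ψ.symm (Ψ (e y))) = y
      rw [Ψ.left_inv hy1, e.left_inv hy3]
    rw [h4, hΨw _ hy1, hw, Function.comp_apply, e.left_inv hy3] at h3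
    exact h3
  · -- otherwise a slice, of dimension `n - 1 > 0`, is mapped to a single point of the axis
    change f (φ (t₀, 0)) ^ 2 < 1
    rw [hxe]
    have hle : ∀ y, f y ^ 2 ≤ 1 := fun y => by
      simp only [f]
      rw [inner_eq_cos_angle ho]
      exact Real.cos_sq_le_one _
    refine lt_of_le_of_ne (hle x) fun h1 => ?_
    have hpt : ∀ k ∈ Metric.ball (0 : K) ε, F.toFun (φ (t₀, k)) = F.toFun x := by
      have hps : ∀ y, f y = f x → (F.toFun y).fst = f x • o := by
        intro y hy
        have hy1 : ‖(F.toFun y).fst‖ = 1 := F.mem_sphereProd y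
        rw [← sub_eq_zero, ← norm_eq_zero, ← sq_eq_zero_iff, norm_sub_sq_real, hy1, inner_smul_right,
          real_inner_comm, norm_smul, ho]
        change 1 ^ 2 - 2 * (f x * f y) + _ = _
        rw [hy, mul_one, Real.norm_eq_abs, sq_abs]
        linarith
      intro k hk
      have ht := Metric.mem_ball_self (x := t₀) hε
      refine eucProd_ext ?_ ?_
      · rw [hps x rfl, hps]
        rw [hslice _ ht k hk, hxe]
      · exact hφh _ (hbox _ ht k hk)
    rw [finrank_euclideanSpace_fin] at hK
    have : Nontrivial K := Module.nontrivial_of_finrank_pos (R := ℝ) (by omega)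
    obtain ⟨k₀, hk₀⟩ := exists_ne (0 : K)
    have hsx : Ψ.symm (t₀, 0) = e x := by rw [← hΨx, Ψ.left_inv hxΨ]
    have hd := F.hasFDerivAt_dF x
    obtain ⟨S, hS, hSinj⟩ := exists_hasFDerivAt_slice_injective Ψ
      (hbox _ (Metric.mem_ball_self hε) 0 h0) hΨd hΨs
    have hcomp1 : HasFDerivAt (fun k : K => F.toFun (φ (t₀, k)))
        ((F.dF x).comp S) 0 := by
      rw [← he, ← hsx] at hd
      exact HasFDerivAt.comp (g := F.toFun ∘ e.symm) (f := fun k : K => Ψ.symm (t₀, k)) 0 hd hS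
    have hev : (fun k : K => F.toFun (φ (t₀, k))) =ᶠ[𝓝 0] fun _ => F.toFun x := by
      filter_upwards [Metric.ball_mem_nhds (0 : K) hε] with k hk using hpt k hk
    have hz1 : (F.dF x).comp S = 0 := eq_zero_of_hasFDerivAt_of_eventuallyEq_const hcomp1 hev
    refine hk₀ (hSinj ?_)
    rw [map_zero]
    apply F.injective_dF x
    rw [map_zero]
    exact DFunLike.congr_fun hz1 k₀

end OrientedHypersurface


/-! ### The profile equation and its first integral -/

section ProfileEquation

open Filter Topology

/-- The expression whose vanishing, where `g ≠ 0`, is the equation `H_r = 0` for the profile `g`, the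
cosine of the radius as a function of the height. Denominators are cleared. -/
noncomputable def profileOp (n r : ℕ) (g : ℝ → ℝ) (t : ℝ) : ℝ :=
  n * g t * (1 - g t ^ 2 + deriv g t ^ 2) - r * (g t - deriv (deriv g) t) * (1 - g t ^ 2)

/-- The first integral of the equation `H_r = 0`. Geometrically, this is
`(1 - ν²)^r sin^{2 (n - r)} ρ`, with `ν` the vertical component of the normal and `ρ` the radius. -/
noncomputable def profileEnergy (n r : ℕ) (g : ℝ → ℝ) (t : ℝ) : ℝ :=
  ((1 - g t ^ 2) / (1 - g t ^ 2 + deriv g t ^ 2)) ^ r * (1 - g t ^ 2) ^ (n - r)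

variable {n r : ℕ} {g : ℝ → ℝ} {t : ℝ}

theorem ContDiffAt.hasDerivAt_deriv (h : ContDiffAt ℝ ∞ g t) :
    HasDerivAt (deriv g) (deriv (deriv g) t) t := by
  have h2 : ContDiffAt ℝ 1 (deriv g) t :=
    (h.of_le (m := 2) (by norm_cast)).derivWithin (by norm_num)
  exact (h2.differentiableAt (by simp)).hasDerivAt

theorem ContDiffAt.continuousAt_deriv_deriv (h : ContDiffAt ℝ ∞ g t) :
    ContinuousAt (deriv (deriv g)) t := by
  have h2 : ContDiffAt ℝ 2 (deriv g) t :=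
    (h.of_le (m := 3) (by norm_cast)).derivWithin (by norm_num)
  have h3 : ContDiffAt ℝ 1 (deriv (deriv g)) t := h2.derivWithin (by norm_num)
  exact h3.continuousAt

/-- Where `g` has a simple zero, `H_r = 0` only gives `profileOp = 0` by continuity. -/
theorem profileOp_eq_zero (hg : ContDiffAt ℝ ∞ g t)
    (h : ∀ᶠ s in 𝓝 t, g s ^ (r - 1) * profileOp n r g s = 0) (hne : g t ≠ 0 ∨ deriv g t ≠ 0) :
    profileOp n r g t = 0 := by
  by_cases h0 : g t = 0
  · have hg' : deriv g t ≠ 0 := hne.resolve_left (not_not.2 h0)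
    have hd : HasDerivAt g (deriv g t) t := (hg.differentiableAt (by simp)).hasDerivAt
    have hev : ∀ᶠ s in 𝓝[≠] t, g s ≠ 0 := by
      simpa [h0] using hd.eventually_ne (c := 0) hg'
    have hz : ∀ᶠ s in 𝓝[≠] t, profileOp n r g s = 0 := by
      filter_upwards [hev, h.filter_mono nhdsWithin_le_nhds] with s h1 h2
      exact (mul_eq_zero.1 h2).resolve_left (pow_ne_zero _ h1)
    have hc : ContinuousAt (profileOp n r g) t := by
      have c1 := hg.continuousAt
      have c2 := hg.hasDerivAt_deriv.continuousAt
      have c3 := hg.continuousAt_deriv_deriv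
      unfold profileOp
      fun_prop
    exact tendsto_nhds_unique_of_eventuallyEq (hc.mono_left nhdsWithin_le_nhds)
      (tendsto_const_nhds (x := (0 : ℝ))) hz
  · exact (mul_eq_zero.1 h.self_of_nhds).resolve_left (pow_ne_zero _ h0)

/-- The derivative of `profileEnergy` is a multiple of `g' * profileOp n r g`. -/
theorem hasDerivAt_profileEnergy (hr : 1 ≤ r) (hrn : r ≤ n) (hg : ContDiffAt ℝ ∞ g t)
    (hlt : g t ^ 2 < 1) (h : ∀ᶠ s in 𝓝 t, g s ^ (r - 1) * profileOp n r g s = 0) :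
    HasDerivAt (profileEnergy n r g) 0 t := by
  have hP : deriv g t * profileOp n r g t = 0 := by
    by_cases h0 : deriv g t = 0
    · rw [h0, zero_mul]
    · rw [profileOp_eq_zero hg h (Or.inr h0), mul_zero]
  have hd : HasDerivAt g (deriv g t) t := (hg.differentiableAt (by simp)).hasDerivAt
  have hd2 := hg.hasDerivAt_deriv
  have hA : HasDerivAt (fun s => 1 - g s ^ 2) (-(2 * g t * deriv g t)) t := by
    have := (hd.pow 2).const_sub 1
    simpa using this
  have hB : HasDerivAt (fun s => 1 - g s ^ 2 + deriv g s ^ 2)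
      (-(2 * g t * deriv g t) + 2 * deriv g t * deriv (deriv g) t) t := by
    have := hA.fun_add (hd2.fun_pow 2)
    simpa using this
  have hA0 : 0 < 1 - g t ^ 2 := by linarith
  have hB0 : 0 < 1 - g t ^ 2 + deriv g t ^ 2 := by positivity
  have hE : profileEnergy n r g =
      fun s => (1 - g s ^ 2) ^ n / (1 - g s ^ 2 + deriv g s ^ 2) ^ r := by
    ext s
    rw [profileEnergy, div_pow, div_mul_eq_mul_div, ← pow_add, Nat.add_sub_cancel' hrn]
  rw [hE]
  refine ((hA.fun_pow n).fun_div (hB.fun_pow r) (pow_ne_zero _ hB0.ne')).congr_deriv ?_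
  obtain ⟨s, rfl⟩ : ∃ s, r = s + 1 := ⟨r - 1, by omega⟩
  obtain ⟨m, rfl⟩ : ∃ m, n = m + 1 := ⟨n - 1, by omega⟩
  rw [div_eq_zero_iff]
  left
  unfold profileOp at hP
  rw [Nat.add_sub_cancel, Nat.add_sub_cancel]
  push_cast at hP ⊢
  linear_combination -2 * (1 - g t ^ 2) ^ m * (1 - g t ^ 2 + deriv g t ^ 2) ^ s * hP

end ProfileEquation

namespace OrientedHypersurface

open Set Topology

variable {n : ℕ} {M : Type*} [TopologicalSpace M] [ChartedSpace (EuclideanSpace ℝ (Fin n)) M]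
  {F : OrientedHypersurface n M} {o : EuclideanSpace ℝ (Fin (n + 1))} {g : ℝ → ℝ} {x : M} {r : ℕ}

theorem continuous_height : Continuous F.height := contMDiff_height.continuous

/-- The height is regular at a point unless the normal is vertical. -/
theorem dF_snd_ne_zero_iff [IsManifold (𝓡 n) ∞ M] (x : M) :
    (∃ v, (F.dF x v).snd ≠ 0) ↔ (F.normal x).snd ^ 2 ≠ 1 := by
  have hNN : inner ℝ (F.normal x) (F.normal x) = 1 := by
    rw [real_inner_self_eq_norm_sq, F.norm_normal]; norm_num
  constructor
  · rintro ⟨v, hv⟩ h1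
    have h2 := F.norm_normal x
    have h3 : ‖(F.normal x).fst‖ ^ 2 + (F.normal x).snd ^ 2 = 1 := by
      have := WithLp.prod_norm_sq_eq_of_L2 (F.normal x)
      rw [h2, Real.norm_eq_abs, sq_abs] at this
      linarith
    have h4 : (F.normal x).fst = 0 := by
      rw [← norm_eq_zero, ← sq_eq_zero_iff]; linarith
    have h5 := F.inner_normal_dF x v
    rw [WithLp.prod_inner_apply] at h5
    simp only [WithLp.ofLp_fst, WithLp.ofLp_snd, h4, inner_zero_left, RCLike.inner_apply,
      conj_trivial, zero_add] at h5
    rcases mul_eq_zero.1 h5 with h6 | h6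
    · exact hv h6
    · rw [h6] at h1; norm_num at h1
  · intro h1
    obtain ⟨τ, hτ⟩ := F.exists_dF_eq x
      ((WithLp.toLp 2 ((0 : EuclideanSpace ℝ (Fin (n + 1))), (1 : ℝ)) : EucProd n)
        - (F.normal x).snd • F.normal x)
      (by
        rw [inner_sub_right, inner_smul_right, hNN, WithLp.prod_inner_apply]
        simp)
      (by simp [inner_smul_right, F.inner_normal_fst])
    refine ⟨τ, fun h0 => h1 ?_⟩
    rw [hτ] at h0
    simp only [WithLp.sub_snd, WithLp.toLp_snd, WithLp.smul_snd, smul_eq_mul] at h0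
    linarith

theorem HasProfileAt.eventually [IsManifold (𝓡 n) ∞ M] (h : F.HasProfileAt o g x) :
    ∀ᶠ y in 𝓝 x, F.HasProfileAt o g y := by
  have hh : ContinuousAt F.height x := continuous_height.continuousAt
  have h1 := hh.eventually h.eventually_contDiffAt.eventually_nhds
  have h3 : ∀ᶠ y in 𝓝 x, ∃ v, (F.dF y v).snd ≠ 0 := by
    simp only [dF_snd_ne_zero_iff]
    have hc : Continuous fun y => (F.normal y).snd ^ 2 :=
      ((WithLp.sndL 2 ℝ _ _).continuous.comp F.contMDiff_normal.continuous).pow 2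
    exact hc.continuousAt.eventually_ne ((dF_snd_ne_zero_iff x).1 h.exists_snd_ne)
  have h4 : ∀ᶠ y in 𝓝 x, g (F.height y) ^ 2 < 1 :=
    ((h.contDiffAt.continuousAt.comp hh).pow 2).eventually_lt_const h.sq_lt_one
  filter_upwards [h1, h.eventually_eq.eventually_nhds, h3, h4] with y a b c d
  exact ⟨a, b, c, d⟩

/-- The height is an open map at its regular points. -/
theorem eventually_of_eventually_height [IsManifold (𝓡 n) ∞ M] (hx : ∃ v, (F.dF x v).snd ≠ 0)
    {p : ℝ → Prop} (h : ∀ᶠ y in 𝓝 x, p (F.height y)) : ∀ᶠ t in 𝓝 (F.height x), p t := by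
  set e := extChartAt (𝓡 n) x
  have hex : e.symm (e x) = x := extChartAt_to_inv x
  have h1 : HasFDerivAt (F.height ∘ e.symm) ((WithLp.sndL 2 ℝ _ _).comp (F.dF x)) (e x) :=
    hasFDerivAt_clm_chart (WithLp.sndL 2 ℝ _ _) x
  have hs : HasStrictFDerivAt (F.height ∘ e.symm) ((WithLp.sndL 2 ℝ _ _).comp (F.dF x)) (e x) :=
    ((contDiffOn_chart contMDiff_height x).contDiffAt ((isOpen_extChartAt_target x).mem_nhds
      (mem_extChartAt_target x))).hasStrictFDerivAt' h1 (by simp)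
  have hsurj : LinearMap.range ((WithLp.sndL 2 ℝ _ _).comp (F.dF x)).toLinearMap = ⊤ := by
    obtain ⟨v, hv⟩ := hx
    rw [LinearMap.range_eq_top]
    exact LinearMap.surjective (fun h0 => hv (LinearMap.congr_fun h0 v))
  have hm := hs.map_nhds_eq_of_surj hsurj
  rw [Function.comp_apply, hex] at hm
  rw [← hm, Filter.eventually_map]
  have := continuousAt_extChartAt_symm (I := 𝓡 n) x
  unfold ContinuousAt at this
  rw [extChartAt_to_inv] at this
  exact this.eventually h

/-- The equation `H_r = 0` along the profile. -/
theorem HasProfileAt.eventually_profileOp [IsManifold (𝓡 n) ∞ M] (ho : ‖o‖ = 1)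
    (h : F.HasProfileAt o g x) (hr : 1 ≤ r) (hrn : r ≤ n) (hF : F.IsMinimal r) :
    ∀ᶠ t in 𝓝 (F.height x), g t ^ (r - 1) * profileOp n r g t = 0 := by
  apply eventually_of_eventually_height h.exists_snd_ne
  filter_upwards [h.eventually] with y hy
  exact (hy.meanCurvature_eq_zero_iff ho hr hrn).1 (hF y)

/-- The function `(1 - ν²)^r (1 - ⟨o, p⟩²)^(n - r)`, where `ν` is the vertical component of the unit
normal. -/
noncomputable def energy (F : OrientedHypersurface n M) (o : EuclideanSpace ℝ (Fin (n + 1)))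
    (r : ℕ) (x : M) : ℝ :=
  (1 - (F.normal x).snd ^ 2) ^ r * (1 - (inner ℝ o (F.toFun x).fst) ^ 2) ^ (n - r)

theorem contMDiff_energy : ContMDiff (𝓡 n) 𝓘(ℝ, ℝ) ∞ (F.energy o r) := by
  have hΦ : ContDiff ℝ ∞ fun z : ℝ × ℝ => (1 - z.1 ^ 2) ^ r * (1 - z.2 ^ 2) ^ (n - r) := by fun_prop
  exact hΦ.comp_contMDiff
    (((WithLp.sndL 2 ℝ _ _).contMDiff.comp F.contMDiff_normal).prodMk_space (contMDiff_axisInner o))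

/-- The relation between the slope of the profile and the vertical component of the normal. -/
theorem HasProfileAt.one_sub_sq_normal [IsManifold (𝓡 n) ∞ M] (ho : ‖o‖ = 1)
    (h : F.HasProfileAt o g x) :
    (1 - (F.normal x).snd ^ 2) * (1 - g (F.height x) ^ 2 + deriv g (F.height x) ^ 2) =
      1 - g (F.height x) ^ 2 := by
  obtain ⟨c, hc, hcN, -⟩ := h.tangentProj_dN ho
  have : c ^ 2 * (F.normal x).snd ^ 2 = deriv g (F.height x) ^ 2 := by rw [← mul_pow, hcN]; ring
  rw [← hc]
  linarith

theorem HasProfileAt.energy_eq [IsManifold (𝓡 n) ∞ M] (ho : ‖o‖ = 1) (h : F.HasProfileAt o g x) :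
    F.energy o r x = profileEnergy n r g (F.height x) := by
  have h1 := h.one_sub_sq_normal ho
  have hlt := h.sq_lt_one
  have hB : 0 < 1 - g (F.height x) ^ 2 + deriv g (F.height x) ^ 2 := by
    have := sq_nonneg (deriv g (F.height x)); linarith
  have hf : inner ℝ o (F.toFun x).fst = g (F.height x) := h.eventually_eq.self_of_nhds
  have h2 : (1 - g (F.height x) ^ 2) / (1 - g (F.height x) ^ 2 + deriv g (F.height x) ^ 2) =
      1 - (F.normal x).snd ^ 2 := by rw [div_eq_iff hB.ne', h1]
  rw [energy, profileEnergy, hf, h2]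

theorem sq_normal_snd_le_one (x : M) : (F.normal x).snd ^ 2 ≤ 1 := by
  have := WithLp.prod_norm_sq_eq_of_L2 (F.normal x)
  rw [F.norm_normal, Real.norm_eq_abs, sq_abs] at this
  have := sq_nonneg ‖(F.normal x).fst‖
  linarith

theorem sq_axisInner_le_one (ho : ‖o‖ = 1) (x : M) : (inner ℝ o (F.toFun x).fst) ^ 2 ≤ 1 := by
  rw [inner_eq_cos_angle ho]
  exact Real.cos_sq_le_one _

/-- The first integral is a global constant: it is so along each local profile, and at the points
with horizontal tangent space the nonnegative function `energy` attains its minimum `0`. -/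
theorem energy_const [IsManifold (𝓡 n) ∞ M] [SecondCountableTopology M] [PreconnectedSpace M]
    (hn : 2 ≤ n) (hr : 1 ≤ r) (hrn : r ≤ n) (ho : ‖o‖ = 1) (hrot : F.IsRotationalAbout o)
    (hF : F.IsMinimal r) (x y : M) : F.energy o r x = F.energy o r y := by
  refine eq_of_mvfderiv_eq_zero contMDiff_energy (fun x => ?_) x y
  rw [mvfderiv_eq_fderiv_chart contMDiff_energy]
  set e := extChartAt (𝓡 n) x with he
  have hex : e.symm (e x) = x := extChartAt_to_inv x
  have hcont : Filter.Tendsto e.symm (𝓝 (e x)) (𝓝 x) := by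
    have := continuousAt_extChartAt_symm (I := 𝓡 n) x
    unfold ContinuousAt at this
    rwa [extChartAt_to_inv] at this
  by_cases hx : ∃ v, (F.dF x v).snd ≠ 0
  · obtain ⟨g, hg⟩ := hrot.exists_hasProfileAt hn ho hx
    have hE := hasDerivAt_profileEnergy hr hrn hg.contDiffAt hg.sq_lt_one
      (hg.eventually_profileOp ho hr hrn hF)
    have hh : HasFDerivAt (fun u => F.height (e.symm u)) ((WithLp.sndL 2 ℝ _ _).comp (F.dF x))
      (e x) := hasFDerivAt_clm_chart (WithLp.sndL 2 ℝ _ _) x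
    rw [← hex] at hE
    have hcomp := hE.comp_hasFDerivAt (f := fun u => F.height (e.symm u)) _ hh
    rw [zero_smul] at hcomp
    refine (hcomp.congr_of_eventuallyEq ?_).fderiv
    filter_upwards [hcont.eventually hg.eventually] with u hu
    exact hu.energy_eq ho
  · rw [dF_snd_ne_zero_iff, not_not] at hx
    refine IsLocalMin.fderiv_eq_zero (Filter.Eventually.of_forall fun u => ?_)
    rw [Function.comp_apply, hex, energy, hx, sub_self, zero_pow (by omega), zero_mul]
    exact mul_nonneg (pow_nonneg (sub_nonneg.2 (sq_normal_snd_le_one _)) _)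
      (pow_nonneg (sub_nonneg.2 (sq_axisInner_le_one ho _)) _)

end OrientedHypersurface


/-! ### Lifting paths to complete hypersurfaces -/

section LocalInverse

open Filter Topology

/-- Local inversion of an immersion `f` into the zero set of a submersion `Φ` of complementary
dimension. -/
theorem exists_local_inverse_of_immersion {E V W : Type*} [NormedAddCommGroup E] [NormedSpace ℝ E]
    [FiniteDimensional ℝ E] [NormedAddCommGroup V] [NormedSpace ℝ V] [FiniteDimensional ℝ V]
    [NormedAddCommGroup W] [NormedSpace ℝ W] [FiniteDimensional ℝ W] {f : E → V} {f' : E →L[ℝ] V}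
    {u : E} {Φ : V → W} {Φ' : V →L[ℝ] W} (hf : ContDiffAt ℝ ∞ f u) (hf' : HasFDerivAt f f' u)
    (hinj : Function.Injective f') (hΦ : HasStrictFDerivAt Φ Φ' (f u))
    (hsurj : Function.Surjective Φ')
    (hdim : Module.finrank ℝ V = Module.finrank ℝ E + Module.finrank ℝ W)
    (hzero : ∀ᶠ v in 𝓝 u, Φ (f v) = 0) :
    ∃ σ : V → E, ContDiffAt ℝ ∞ σ (f u) ∧ σ (f u) = u ∧ (∀ᶠ v in 𝓝 u, σ (f v) = v) ∧
      ∀ᶠ w in 𝓝 (f u), Φ w = 0 → f (σ w) = w := by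
  have : CompleteSpace E := FiniteDimensional.complete ℝ E
  have : CompleteSpace V := FiniteDimensional.complete ℝ V
  obtain ⟨Λ₀, hΛ₀⟩ := LinearMap.exists_leftInverse_of_injective f'.toLinearMap
    (LinearMap.ker_eq_bot.2 hinj)
  set Λ : V →L[ℝ] E := LinearMap.toContinuousLinearMap Λ₀ with hΛdef
  have hΛ : ∀ v, Λ (f' v) = v := fun v => LinearMap.congr_fun hΛ₀ v
  have hG : HasFDerivAt (fun v => Λ (f v)) ((ContinuousLinearEquiv.refl ℝ E : E ≃L[ℝ] E) : E →L[ℝ] E) u := by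
    have h1 : HasFDerivAt (fun v => Λ (f v)) (Λ.comp f') u := Λ.hasFDerivAt.comp u hf'
    refine h1.congr_fderiv ?_
    ext v
    exact hΛ v
  have hGc : ContDiffAt ℝ ∞ (fun v => Λ (f v)) u := Λ.contDiff.contDiffAt.comp u hf
  have h1 : (1 : WithTop ℕ∞) ≤ ∞ := by norm_cast
  have hGs := hGc.hasStrictFDerivAt' hG (by simp)
  set τ := hGc.localInverse hG (by simp)
  have hτc : ContDiffAt ℝ ∞ τ (Λ (f u)) := hGc.to_localInverse hG (by simp)
  have hτ0 : τ (Λ (f u)) = u := hGs.localInverse_apply_image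
  have hτr : ∀ᶠ y in 𝓝 (Λ (f u)), Λ (f (τ y)) = y := hGs.eventually_right_inverse
  have hτl : ∀ᶠ v in 𝓝 u, τ (Λ (f v)) = v := hGs.eventually_left_inverse
  have hσ : ContDiffAt ℝ ∞ (fun w => τ (Λ w)) (f u) :=
    ContDiffAt.comp (f u) hτc Λ.contDiff.contDiffAt
  refine ⟨fun w => τ (Λ w), hσ, hτ0, hτl, ?_⟩
  -- `(Λ, Φ)` is a local coordinate system of `V` at `f u`
  have hΦf : ∀ v, Φ' (f' v) = 0 := by
    have h2 : HasFDerivAt (fun v => Φ (f v)) (Φ'.comp f') u := hΦ.hasFDerivAt.comp u hf'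
    have h3 := (h2.congr_of_eventuallyEq (f₁ := fun _ => (0 : W)) (by
      filter_upwards [hzero] with v hv using hv.symm)).unique (hasFDerivAt_const _ _)
    exact fun v => DFunLike.congr_fun h3 v
  have hker : ∀ w, Φ' w = 0 → ∃ v, f' v = w := by
    have hle : LinearMap.range f'.toLinearMap ≤ LinearMap.ker Φ'.toLinearMap := by
      rintro _ ⟨v, rfl⟩
      exact hΦf v
    have a1 := LinearMap.finrank_range_of_inj (f := f'.toLinearMap) hinj
    have a2 := LinearMap.finrank_range_add_finrank_ker Φ'.toLinearMap
    rw [LinearMap.range_eq_top.2 hsurj, finrank_top] at a2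
    have := Submodule.eq_of_le_of_finrank_eq hle (by omega)
    intro w hw
    have hw' : w ∈ LinearMap.ker Φ'.toLinearMap := hw
    rw [← this] at hw'
    exact hw'
  have hinj2 : Function.Injective (Λ.prod Φ').toLinearMap := by
    rw [← LinearMap.ker_eq_bot, LinearMap.ker_eq_bot']
    intro w hw
    have ha : Λ w = 0 := congrArg Prod.fst hw
    have hb : Φ' w = 0 := congrArg Prod.snd hw
    obtain ⟨v, rfl⟩ := hker w hb
    rw [hΛ] at ha
    rw [ha, map_zero]
  let B : V ≃L[ℝ] (E × W) := (LinearEquiv.ofInjectiveOfFinrankEq (Λ.prod Φ').toLinearMap hinj2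
    (by rw [Module.finrank_prod, hdim])).toContinuousLinearEquiv
  have hB : HasStrictFDerivAt (fun w => (Λ w, Φ w)) (B : V →L[ℝ] E × W) (f u) := by
    refine (Λ.hasStrictFDerivAt.prodMk hΦ).congr_fderiv ?_
    ext w <;> rfl
  have hinjOn := hB.toOpenPartialHomeomorph.injOn
  have hsrc : (hB.toOpenPartialHomeomorph).source ∈ 𝓝 (f u) :=
    (hB.toOpenPartialHomeomorph).open_source.mem_nhds hB.mem_toOpenPartialHomeomorph_source
  have hσt : Tendsto (fun w => τ (Λ w)) (𝓝 (f u)) (𝓝 u) := by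
    have := hσ.continuousAt.tendsto
    rwa [hτ0] at this
  have hfσ : Tendsto (fun w => f (τ (Λ w))) (𝓝 (f u)) (𝓝 (f u)) := hf.continuousAt.tendsto.comp hσt
  filter_upwards [hsrc, hfσ hsrc, (Λ.continuous.tendsto (f u)).eventually hτr, hσt.eventually hzero]
    with w b1 b2 b3 b4 b5
  refine hinjOn b2 b1 ?_
  exact Prod.ext b3 (b4.trans b5.symm)

end LocalInverse

section PathLength

open Set Filter Topology MeasureTheory

variable {n : ℕ} {M : Type*} [TopologicalSpace M] [ChartedSpace (EuclideanSpace ℝ (Fin n)) M]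
  {W : Type*} [NormedAddCommGroup W] [NormedSpace ℝ W]

theorem hasDerivAt_comp_of_mdifferentiableAt {g : M → W} {c : ℝ → M} {t : ℝ}
    (hg : MDifferentiableAt (𝓡 n) 𝓘(ℝ, W) g (c t)) (hc : MDifferentiableAt 𝓘(ℝ, ℝ) (𝓡 n) c t) :
    HasDerivAt (g ∘ c) (mvfderiv (𝓡 n) g (c t) (mfderiv 𝓘(ℝ, ℝ) (𝓡 n) c t (1 : ℝ))) t := by
  have h2 := hg.comp t hc
  have h3 := mfderiv_comp t hg hc
  rw [mfderiv_eq_fderiv] at h3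
  have h4 := (mdifferentiableAt_iff_differentiableAt.1 h2).hasFDerivAt.hasDerivAt
  rw [h3] at h4
  exact h4

theorem edist_le_lintegral_enorm_mvfderiv [CompleteSpace W] {g : M → W} {c : ℝ → M}
    (hg : ContMDiff (𝓡 n) 𝓘(ℝ, W) ∞ g) (hc : ContMDiffOn 𝓘(ℝ, ℝ) (𝓡 n) 1 c (Icc 0 1)) :
    edist (g (c 0)) (g (c 1)) ≤
      ∫⁻ t in Ioo (0 : ℝ) 1, ‖mvfderiv (𝓡 n) g (c t) (mfderiv 𝓘(ℝ, ℝ) (𝓡 n) c t (1 : ℝ))‖ₑ := by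
  have hd : ContMDiffOn 𝓘(ℝ, ℝ) 𝓘(ℝ, W) 1 (g ∘ c) (Icc 0 1) :=
    (hg.of_le (by norm_cast)).comp_contMDiffOn hc
  rw [contMDiffOn_iff_contDiffOn] at hd
  have h := enorm_sub_le_lintegral_deriv_of_contDiffOn_Icc hd zero_le_one
  rw [edist_comm, edist_eq_enorm_sub]
  refine h.trans_eq ?_
  rw [← restrict_Ioo_eq_restrict_Icc]
  refine setLIntegral_congr_fun measurableSet_Ioo fun t ht => ?_
  have := hasDerivAt_comp_of_mdifferentiableAt ((hg (c t)).mdifferentiableAt (by simp))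
    ((hc.contMDiffAt (Icc_mem_nhds ht.1 ht.2)).mdifferentiableAt (by simp))
  change ‖deriv (g ∘ c) t‖ₑ = _
  rw [this.deriv]

end PathLength

namespace OrientedHypersurface

open Set Filter Topology MeasureTheory

variable {n : ℕ} {M : Type*} [TopologicalSpace M] [ChartedSpace (EuclideanSpace ℝ (Fin n)) M]
  {F : OrientedHypersurface n M}

theorem enormSMulClass_tangentSpace (F : OrientedHypersurface n M) (z : M) :
    letI : ENorm (TangentSpace (𝓡 n) z) := ⟨fun v => ‖mvfderiv (𝓡 n) F.toFun z v‖ₑ⟩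
    ENormSMulClass ℝ (TangentSpace (𝓡 n) z) :=
  letI : ENorm (TangentSpace (𝓡 n) z) := ⟨fun v => ‖mvfderiv (𝓡 n) F.toFun z v‖ₑ⟩
  ⟨fun r v => by
    change ‖mvfderiv (𝓡 n) F.toFun z (r • v)‖ₑ = ‖r‖ₑ * ‖mvfderiv (𝓡 n) F.toFun z v‖ₑ
    rw [map_smul, enorm_smul]⟩

theorem inducedEDist_self (x : M) : F.inducedEDist x x = 0 := by
  let : ∀ z : M, ENorm (TangentSpace (𝓡 n) z) :=
    fun z => ⟨fun v => ‖mvfderiv (𝓡 n) F.toFun z v‖ₑ⟩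
  have := F.enormSMulClass_tangentSpace
  exact Manifold.riemannianEDist_self

theorem inducedEDist_comm (x y : M) : F.inducedEDist x y = F.inducedEDist y x := by
  let : ∀ z : M, ENorm (TangentSpace (𝓡 n) z) :=
    fun z => ⟨fun v => ‖mvfderiv (𝓡 n) F.toFun z v‖ₑ⟩
  have := F.enormSMulClass_tangentSpace
  exact Manifold.riemannianEDist_comm

theorem inducedEDist_triangle (x y z : M) :
    F.inducedEDist x z ≤ F.inducedEDist x y + F.inducedEDist y z := by
  let : ∀ z : M, ENorm (TangentSpace (𝓡 n) z) :=
    fun z => ⟨fun v => ‖mvfderiv (𝓡 n) F.toFun z v‖ₑ⟩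
  have := F.enormSMulClass_tangentSpace
  exact Manifold.riemannianEDist_triangle

/-- The induced distance of the endpoints of a path `c`, bounded by the speed of its image `γ`. -/
theorem inducedEDist_le {c : ℝ → M} {γ : ℝ → EucProd n} {a b C : ℝ} (hab : a ≤ b)
    (hc : ContMDiffOn 𝓘(ℝ, ℝ) (𝓡 n) 1 c (Icc a b)) (hγ : ∀ t ∈ Ioo a b, F.toFun (c t) = γ t)
    (hC : ∀ t ∈ Ioo a b, ‖deriv γ t‖ ≤ C) :
    F.inducedEDist (c a) (c b) ≤ ENNReal.ofReal (C * (b - a)) := by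
  let : ∀ z : M, ENorm (TangentSpace (𝓡 n) z) :=
    fun z => ⟨fun v => ‖mvfderiv (𝓡 n) F.toFun z v‖ₑ⟩
  have := F.enormSMulClass_tangentSpace
  refine (Manifold.riemannianEDist_le_pathELength hc rfl rfl hab).trans ?_
  rw [Manifold.pathELength_eq_lintegral_mfderiv_Ioo]
  have hle : ∫⁻ t in Ioo a b, ‖mfderiv 𝓘(ℝ, ℝ) (𝓡 n) c t 1‖ₑ ≤
      ∫⁻ _ in Ioo a b, ENNReal.ofReal C := by
    refine setLIntegral_mono measurable_const fun t ht => ?_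
    have h1 : MDifferentiableAt 𝓘(ℝ, ℝ) (𝓡 n) c t :=
      (hc.contMDiffAt (Icc_mem_nhds ht.1 ht.2)).mdifferentiableAt (by simp)
    have h2 := (hasDerivAt_comp_of_mdifferentiableAt (g := F.toFun)
      ((F.contMDiff_toFun (c t)).mdifferentiableAt (by simp)) h1).deriv
    have h3 : F.toFun ∘ c =ᶠ[𝓝 t] γ := by
      filter_upwards [Ioo_mem_nhds ht.1 ht.2] with s hs using hγ s hs
    rw [h3.deriv_eq] at h2
    have h4 : ‖deriv γ t‖ₑ ≤ ENNReal.ofReal C := by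
      rw [← ofReal_norm]
      exact ENNReal.ofReal_le_ofReal (hC t ht)
    rw [h2] at h4
    exact h4
  refine hle.trans ?_
  rw [setLIntegral_const, Real.volume_Ioo]
  rcases hab.eq_or_lt with rfl | hlt
  · simp
  · rw [← ENNReal.ofReal_mul']
    linarith

/-- Chords are shorter than paths. -/
theorem edist_le_inducedEDist (x y : M) : edist (F.toFun x) (F.toFun y) ≤ F.inducedEDist x y := by
  let : ∀ z : M, ENorm (TangentSpace (𝓡 n) z) :=
    fun z => ⟨fun v => ‖mvfderiv (𝓡 n) F.toFun z v‖ₑ⟩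
  refine le_of_forall_gt fun r hr => ?_
  obtain ⟨c, rfl, rfl, hc, hlt⟩ := Manifold.exists_lt_of_riemannianEDist_lt hr
  refine lt_of_le_of_lt ?_ hlt
  rw [Manifold.pathELength_eq_lintegral_mfderiv_Ioo]
  exact edist_le_lintegral_enorm_mvfderiv F.contMDiff_toFun hc

theorem isComplete_of_isClosedEmbedding (hF : Topology.IsClosedEmbedding F.toFun) :
    F.IsComplete := by
  intro u hu
  have hc : CauchySeq (F.toFun ∘ u) := by
    rw [EMetric.cauchySeq_iff]
    intro ε hε
    obtain ⟨K, hK⟩ := hu ε hε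
    exact ⟨K, fun k hk l hl => (edist_le_inducedEDist _ _).trans_lt (hK k hk l hl)⟩
  obtain ⟨y, hy⟩ := cauchySeq_tendsto_of_complete hc
  obtain ⟨x, rfl⟩ := hF.isClosed_range.mem_of_tendsto hy
    (Eventually.of_forall fun k => mem_range_self (u k))
  exact ⟨x, hF.isInducing.tendsto_nhds_iff.2 hy⟩

/-- For each point `y` of `S`, the set `S` is contained in the zero set of a map to the plane that is a
submersion at `y`. This is all that is needed of the fact that a model is a hypersurface of
`𝕊ⁿ × ℝ`. -/
def IsLocallyZeroSet (S : Set (EucProd n)) : Prop :=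
  ∀ y ∈ S, ∃ (Φ : EucProd n → ℝ × ℝ) (Φ' : EucProd n →L[ℝ] ℝ × ℝ), HasStrictFDerivAt Φ Φ' y ∧
    Function.Surjective Φ' ∧ ∀ z ∈ S, Φ z = 0

/-- Paths in `S` can be lifted to a hypersurface contained in `S`, locally, and with a uniform time
of existence: every lift of a point of the path close to `γ t₀`, starting close to `x₀`, extends to the
same time `t₁ > t₀`. The length of the extension is bounded by the speed of the path. -/
theorem exists_local_lift [IsManifold (𝓡 n) ∞ M] {S : Set (EucProd n)} (hS : IsLocallyZeroSet S)
    (hFS : range F.toFun ⊆ S) {γ : ℝ → EucProd n} (hγ : ContDiff ℝ 1 γ) {C : ℝ}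
    (hγS : ∀ t ∈ Ico (0 : ℝ) 1, γ t ∈ S)
    (hC : ∀ t ∈ Ico (0 : ℝ) 1, ‖deriv γ t‖ ≤ C) {t₀ : ℝ} (ht₀ : t₀ ∈ Ico (0 : ℝ) 1) {x₀ : M}
    (hx₀ : F.toFun x₀ = γ t₀) :
    ∃ t₁, t₀ < t₁ ∧ t₁ < 1 ∧ ∀ᶠ p : ℝ × M in 𝓝 (t₀, x₀), p.1 ∈ Icc 0 t₀ → F.toFun p.2 = γ p.1 →
      ∃ y, F.toFun y = γ t₁ ∧ F.inducedEDist p.2 y ≤ ENNReal.ofReal (C * (t₁ - p.1)) := by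
  obtain ⟨Φ, Φ', hΦ, hsurj, hΦS⟩ := hS (γ t₀) (hγS t₀ ht₀)
  set e := extChartAt (𝓡 n) x₀ with he
  have hex : e.symm (e x₀) = x₀ := extChartAt_to_inv x₀
  have hval : (F.toFun ∘ e.symm) (e x₀) = γ t₀ := by rw [Function.comp_apply, hex, hx₀]
  rw [← hval] at hΦ
  obtain ⟨σ, hσ, hσ0, hσl, hσr⟩ := exists_local_inverse_of_immersion
    ((contDiffOn_chart F.contMDiff_toFun x₀).contDiffAt ((isOpen_extChartAt_target x₀).mem_nhds
      (mem_extChartAt_target x₀))) (F.hasFDerivAt_dF x₀) (F.injective_dF x₀) hΦ hsurj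
    (by rw [finrank_eucProd]; simp) (Eventually.of_forall fun v => hΦS _ (hFS ⟨_, rfl⟩))
  rw [hval] at hσ hσ0 hσr
  have hγt : Tendsto γ (𝓝 t₀) (𝓝 (γ t₀)) := hγ.continuous.tendsto t₀
  -- the lift is `e.symm ∘ σ ∘ γ`
  have hσc : ∀ᶠ t in 𝓝 t₀, ContDiffAt ℝ 1 σ (γ t) :=
    hγt.eventually ((hσ.of_le (m := 1) (by norm_cast)).eventually (by simp))
  have htgt : ∀ᶠ t in 𝓝 t₀, σ (γ t) ∈ e.target := by
    have h1 : Tendsto (fun t => σ (γ t)) (𝓝 t₀) (𝓝 (e x₀)) := by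
      have := hσ.continuousAt.tendsto.comp hγt
      rwa [hσ0] at this
    exact h1.eventually ((isOpen_extChartAt_target x₀).mem_nhds (mem_extChartAt_target x₀))
  obtain ⟨δ, hδ, hball⟩ := Metric.eventually_nhds_iff.1 ((hσc.and htgt).and (hγt.eventually hσr))
  obtain ⟨t₁, h01, h12⟩ := exists_between (lt_min (lt_add_of_pos_right t₀ hδ) ht₀.2)
  refine ⟨t₁, h01, h12.trans_le (min_le_right _ _), ?_⟩
  have hex' : ContinuousAt e x₀ := continuousAt_extChartAt x₀
  have ev1 : ∀ᶠ p : ℝ × M in 𝓝 (t₀, x₀), dist p.1 t₀ < δ :=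
    (continuousAt_fst (p := (t₀, x₀))).tendsto.eventually (Metric.eventually_nhds_iff.2 ⟨δ, hδ, fun _ h => h⟩)
  have ev2 : ∀ᶠ p : ℝ × M in 𝓝 (t₀, x₀), p.2 ∈ e.source ∧
      σ ((F.toFun ∘ e.symm) (e p.2)) = e p.2 :=
    (continuousAt_snd (p := (t₀, x₀))).tendsto.eventually
      (Filter.Eventually.and (extChartAt_source_mem_nhds (I := 𝓡 n) x₀) (hex'.eventually hσl))
  filter_upwards [ev1, ev2] with p hp1 hp2 hp3 hp4
  obtain ⟨s, x⟩ := p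
  simp only at hp1 hp2 hp3 hp4
  have hIcc : ∀ t ∈ Icc s t₁, dist t t₀ < δ ∧ t ∈ Ico (0 : ℝ) 1 := by
    intro t ht
    have h3 := h12.trans_le (min_le_left _ _)
    have h4 := h12.trans_le (min_le_right _ _)
    rw [Real.dist_eq, abs_lt] at hp1 ⊢
    refine ⟨⟨?_, ?_⟩, ?_, ?_⟩ <;> linarith [ht.1, ht.2, hp3.1]
  have hst : s ≤ t₁ := hp3.2.trans h01.le
  have hlift : ∀ t ∈ Icc s t₁, F.toFun (e.symm (σ (γ t))) = γ t := fun t ht =>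
    (hball (hIcc t ht).1).2 (hΦS _ (hγS t (hIcc t ht).2))
  have hstart : e.symm (σ (γ s)) = x := by
    have := hp2.2
    rw [Function.comp_apply, e.left_inv hp2.1, hp4] at this
    rw [this, e.left_inv hp2.1]
  have hsm : ContMDiffOn 𝓘(ℝ, ℝ) (𝓡 n) 1 (fun t => e.symm (σ (γ t))) (Icc s t₁) := by
    have h1 : ContDiffOn ℝ 1 (fun t => σ (γ t)) (Icc s t₁) := fun t ht =>
      ((hball (hIcc t ht).1).1.1.comp t hγ.contDiffAt).contDiffWithinAt
    have : IsManifold (𝓡 n) 1 M := IsManifold.of_le (n := ∞) (by norm_cast)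
    exact (contMDiffOn_extChartAt_symm x₀).comp h1.contMDiffOn fun t ht =>
      (hball (hIcc t ht).1).1.2
  refine ⟨e.symm (σ (γ t₁)), hlift t₁ ⟨hst, le_rfl⟩, ?_⟩
  have := inducedEDist_le (F := F) hst hsm (fun t ht => hlift t (Ioo_subset_Icc_self ht))
    (fun t ht => hC t (hIcc t (Ioo_subset_Icc_self ht)).2)
  rwa [hstart] at this

/-- Paths in `S` can be lifted to a complete hypersurface contained in `S`. The path may leave `S`
at its endpoint. The proof extends lifts step by step, each time at least half as far as possible; the
lifts converge by completeness, and if their limit were not over `γ 1`, then `exists_local_lift` would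
give extensions which are too long. -/
theorem IsComplete.mem_range_of_path [IsManifold (𝓡 n) ∞ M] (hF : F.IsComplete)
    {S : Set (EucProd n)} (hS : IsLocallyZeroSet S) (hFS : range F.toFun ⊆ S) {γ : ℝ → EucProd n}
    (hγ : ContDiff ℝ 1 γ) (hγS : ∀ t ∈ Ico (0 : ℝ) 1, γ t ∈ S) (h0 : γ 0 ∈ range F.toFun) :
    γ 1 ∈ range F.toFun := by
  obtain ⟨C₀, hC₀⟩ := isCompact_Icc.exists_bound_of_continuousOn (s := Icc (0 : ℝ) 1)
    (hγ.continuous_deriv le_rfl).continuousOn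
  set C := max C₀ 0
  have hCpos : 0 ≤ C := le_max_right _ _
  have hC : ∀ t ∈ Ico (0 : ℝ) 1, ‖deriv γ t‖ ≤ C := fun t ht =>
    (hC₀ t (Ico_subset_Icc_self ht)).trans (le_max_left _ _)
  -- the times that can be reached from the lift `x` of `γ t`
  let X := {p : ℝ × M // p.1 ∈ Ico (0 : ℝ) 1 ∧ F.toFun p.2 = γ p.1}
  let Rel : X → X → Prop := fun p q => p.1.1 ≤ q.1.1 ∧
    F.inducedEDist p.1.2 q.1.2 ≤ ENNReal.ofReal (C * (q.1.1 - p.1.1))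
  let T : X → Set ℝ := fun p => {t | ∃ q, Rel p q ∧ q.1.1 = t}
  have hrefl : ∀ p, Rel p p := fun p => ⟨le_rfl, by rw [inducedEDist_self]; exact zero_le⟩
  have htrans : ∀ p q s, Rel p q → Rel q s → Rel p s := fun p q s h1 h2 => by
    refine ⟨h1.1.trans h2.1, (inducedEDist_triangle _ q.1.2 _).trans
      ((add_le_add h1.2 h2.2).trans_eq ?_)⟩
    rw [← ENNReal.ofReal_add (mul_nonneg hCpos (sub_nonneg.2 h1.1))
      (mul_nonneg hCpos (sub_nonneg.2 h2.1))]
    ring_nf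
  have hbdd : ∀ p, BddAbove (T p) := fun p => ⟨1, by
    rintro _ ⟨q, -, rfl⟩
    exact q.2.1.2.le⟩
  -- a step covers at least half of the time that remains reachable
  have hstep : ∀ p : X, ∃ q : X, Rel p q ∧ (p.1.1 + sSup (T p)) / 2 ≤ q.1.1 := by
    intro p
    rcases lt_or_ge p.1.1 (sSup (T p)) with h | h
    · obtain ⟨_, ⟨q, hq, rfl⟩, hlt⟩ := exists_lt_of_lt_csSup (b := (p.1.1 + sSup (T p)) / 2)
        (⟨_, p, hrefl p, rfl⟩ : (T p).Nonempty) (by linarith)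
      exact ⟨q, hq, hlt.le⟩
    · exact ⟨p, hrefl p, by linarith⟩
  choose next hnext using hstep
  obtain ⟨x₀, hx₀⟩ := h0
  let p : ℕ → X := fun k => next^[k] ⟨(0, x₀), ⟨le_rfl, one_pos⟩, hx₀⟩
  have hp : ∀ k, p (k + 1) = next (p k) := fun k => Function.iterate_succ_apply' _ _ _
  have hRel : ∀ k l, k ≤ l → Rel (p k) (p l) := by
    intro k l hkl
    induction l, hkl using Nat.le_induction with
    | base => exact hrefl _
    | succ l _ ih => exact htrans _ _ _ ih (by rw [hp]; exact (hnext _).1)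
  have hmono : Monotone fun k => (p k).1.1 := fun k l hkl => (hRel k l hkl).1
  have hbdd' : BddAbove (range fun k => (p k).1.1) := ⟨1, by
    rintro _ ⟨k, rfl⟩
    exact (p k).2.1.2.le⟩
  have hlim := tendsto_atTop_ciSup hmono hbdd'
  set t₀ := ⨆ k, (p k).1.1
  have hle : ∀ k, (p k).1.1 ≤ t₀ := fun k => le_ciSup hbdd' k
  obtain ⟨x, hx⟩ := hF (fun k => (p k).1.2) (by
    intro ε hε
    have h1 : Tendsto (fun k => ENNReal.ofReal (C * (t₀ - (p k).1.1))) atTop (𝓝 0) := by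
      have : Tendsto (fun k => C * (t₀ - (p k).1.1)) atTop (𝓝 0) := by
        simpa using (hlim.const_sub t₀).const_mul C
      simpa using ENNReal.tendsto_ofReal this
    obtain ⟨K, hK⟩ := (h1.eventually (gt_mem_nhds hε)).exists
    have key : ∀ k ≥ K, ∀ l ≥ k, F.inducedEDist (p k).1.2 (p l).1.2 < ε := by
      intro k hk l hl
      refine ((hRel k l hl).2.trans (ENNReal.ofReal_le_ofReal ?_)).trans_lt hK
      exact mul_le_mul_of_nonneg_left (sub_le_sub (hle l) (hmono hk)) hCpos
    refine ⟨K, fun k hk l hl => ?_⟩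
    rcases le_total k l with h | h
    · exact key k hk l h
    · rw [inducedEDist_comm]
      exact key l hl k h)
  have hFx : F.toFun x = γ t₀ := by
    refine tendsto_nhds_unique (continuous_toFun.continuousAt.tendsto.comp hx) ?_
    refine ((hγ.continuous.tendsto t₀).comp hlim).congr fun k => ?_
    exact (p k).2.2.symm
  have ht₀ : 0 ≤ t₀ := (p 0).2.1.1.trans (hle 0)
  have ht₁ : t₀ ≤ 1 := ciSup_le fun k => (p k).2.1.2.le
  rcases ht₁.eq_or_lt with h | h
  · exact ⟨x, by rw [hFx, h]⟩
  · exfalso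
    obtain ⟨t₁, h01, h11, hev⟩ := exists_local_lift hS hFS hγ hγS hC ⟨ht₀, h⟩ hFx
    have hev2 := (hlim.prodMk_nhds hx).eventually hev
    have hlt : ∀ᶠ k in atTop, t₀ - (t₁ - t₀) < (p k).1.1 :=
      hlim.eventually (lt_mem_nhds (by linarith))
    obtain ⟨k, hk1, hk2⟩ := (hev2.and hlt).exists
    obtain ⟨y, hy1, hy2⟩ := hk1 ⟨(p k).2.1.1, hle k⟩ (p k).2.2
    have hmem : t₁ ∈ T (p k) :=
      ⟨⟨(t₁, y), ⟨ht₀.trans h01.le, h11⟩, hy1⟩, ⟨(hle k).trans h01.le, hy2⟩, rfl⟩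
    have h2 := le_csSup (hbdd (p k)) hmem
    have h3 := (hnext (p k)).2
    rw [← hp] at h3
    linarith [hle (k + 1)]

end OrientedHypersurface


/-! ### Unduloids -/

section PeriodicFlow

open Set Filter Topology

/-- The flow line through `0` of an even, `π`-periodic positive vector field on the line. It is the
inverse of the travel time `x ↦ ∫₀ˣ dy / Ω y`. -/
theorem exists_flow_of_even_periodic {Ω : ℝ → ℝ} (hΩ : ContDiff ℝ ∞ Ω) (hpos : ∀ x, 0 < Ω x)
    (heven : ∀ x, Ω (-x) = Ω x) (hper : ∀ x, Ω (x + Real.pi) = Ω x) :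
    ∃ (φ : ℝ → ℝ) (l : ℝ), ContDiff ℝ ∞ φ ∧ 0 < l ∧ (∀ t, HasDerivAt φ (Ω (φ t)) t) ∧ φ 0 = 0 ∧
      (∀ t, φ (-t) = -φ t) ∧ (∀ t, φ (t + l) = φ t + Real.pi) ∧ StrictMono φ ∧
      Function.Surjective φ := by
  set T : ℝ → ℝ := fun x => ∫ y in (0 : ℝ)..x, (Ω y)⁻¹ with hT
  have hc : ContDiff ℝ ∞ fun y => (Ω y)⁻¹ := hΩ.inv fun x => (hpos x).ne'
  have hd : ∀ x, HasDerivAt T (Ω x)⁻¹ x := fun x =>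
    intervalIntegral.integral_hasDerivAt_right (hc.continuous.intervalIntegrable _ _)
      (hc.continuous.stronglyMeasurableAtFilter _ _) hc.continuous.continuousAt
  have hT0 : T 0 = 0 := intervalIntegral.integral_same
  have hTc : ContDiff ℝ ∞ T := by
    rw [contDiff_infty_iff_deriv]
    refine ⟨fun x => (hd x).differentiableAt, ?_⟩
    rwa [show deriv T = fun y => (Ω y)⁻¹ from funext fun x => (hd x).deriv]
  have hmono : StrictMono T := strictMono_of_deriv_pos fun x => by
    rw [(hd x).deriv]
    exact inv_pos.2 (hpos x)
  have hodd : ∀ x, T (-x) = -T x := by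
    have h1 : ∀ x, HasDerivAt (fun x => T (-x) + T x) 0 x := fun x => by
      have h2 := ((hd (-x)).scomp x (hasDerivAt_neg x)).fun_add (hd x)
      rw [heven] at h2
      simpa using h2
    intro x
    have h3 := is_const_of_deriv_eq_zero (fun x => (h1 x).differentiableAt)
      (fun x => (h1 x).deriv) x 0
    simp only [neg_zero, hT0, add_zero] at h3
    linarith
  have hadd : ∀ x, T (x + Real.pi) = T x + T Real.pi := by
    have h1 : ∀ x, HasDerivAt (fun x => T (x + Real.pi) - T x) 0 x := fun x => by
      have h2 := ((hd (x + Real.pi)).comp_add_const x Real.pi).fun_sub (hd x)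
      rwa [hper, sub_self] at h2
    intro x
    have h3 := is_const_of_deriv_eq_zero (fun x => (h1 x).differentiableAt)
      (fun x => (h1 x).deriv) x 0
    simp only [zero_add, hT0, sub_zero] at h3
    linarith
  have hl : 0 < T Real.pi := by
    rw [← hT0]
    exact hmono Real.pi_pos
  have hmul : ∀ k : ℕ, T (k * Real.pi) = k * T Real.pi := fun k => by
    induction k with
    | zero => simpa using hT0
    | succ k ih =>
      rw [Nat.cast_succ, add_mul, one_mul, hadd, ih]
      ring
  have hsurj : Function.Surjective T := fun y => by
    obtain ⟨k, hk⟩ := exists_nat_ge (|y| / T Real.pi)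
    rw [div_le_iff₀ hl, abs_le] at hk
    refine mem_range_of_exists_le_of_exists_ge hTc.continuous ⟨-(k * Real.pi), ?_⟩
      ⟨k * Real.pi, ?_⟩
    · rw [hodd, hmul]
      exact hk.1
    · rw [hmul]
      exact hk.2
  let e := (hmono.orderIsoOfSurjective T hsurj).toHomeomorph
  have he : ∀ x, e x = T x := fun x => rfl
  have hes : ContDiff ℝ ∞ e.symm := e.contDiff_symm_deriv (fun x => (inv_pos.2 (hpos x)).ne') hd hTc
  refine ⟨e.symm, T Real.pi, hes, hl, fun t => ?_, ?_, fun t => ?_, fun t => ?_,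
    (hmono.orderIsoOfSurjective T hsurj).symm.strictMono, e.symm.surjective⟩
  · have := (hd (e.symm t)).of_local_left_inverse e.symm.continuous.continuousAt
      (inv_pos.2 (hpos _)).ne' (Eventually.of_forall fun y => e.apply_symm_apply y)
    rwa [inv_inv] at this
  · rw [e.symm_apply_eq, he, hT0]
  · rw [e.symm_apply_eq, he, hodd, ← he, e.apply_symm_apply]
  · rw [e.symm_apply_eq, he, hadd, ← he (e.symm t), e.apply_symm_apply]

end PeriodicFlow

section Unduloid

open Set Filter Topology Finset

/-- `(x ^ k - y ^ k) / (x - y)` -/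
noncomputable def powDivDiff (k : ℕ) (x y : ℝ) : ℝ := ∑ i ∈ Finset.range k, x ^ i * y ^ (k - 1 - i)

theorem powDivDiff_mul (k : ℕ) (x y : ℝ) : powDivDiff k x y * (x - y) = x ^ k - y ^ k :=
  (Commute.all x y).geom_sum₂_mul k

theorem powDivDiff_pos {k : ℕ} (hk : 0 < k) {x y : ℝ} (hx : 0 < x) (hy : 0 < y) :
    0 < powDivDiff k x y :=
  Finset.sum_pos (fun i _ => by positivity) ⟨0, by simpa using hk⟩

/-- `(1 - g²)^{1/r}` -/
noncomputable def sinPow (r : ℕ) (g : ℝ) : ℝ := (1 - g ^ 2) ^ ((r : ℝ)⁻¹)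

theorem sinPow_pos (r : ℕ) {g : ℝ} (hg : g ^ 2 < 1) : 0 < sinPow r g :=
  Real.rpow_pos_of_pos (by linarith) _

theorem sinPow_pow {r : ℕ} (hr : 1 ≤ r) {g : ℝ} (hg : g ^ 2 < 1) : sinPow r g ^ r = 1 - g ^ 2 :=
  Real.rpow_inv_natCast_pow (by linarith) (by omega)

theorem contDiffAt_sinPow (r : ℕ) {g : ℝ} (hg : g ^ 2 < 1) : ContDiffAt ℝ ∞ (sinPow r) g := by
  unfold sinPow
  have : ContDiffAt ℝ ∞ (fun g : ℝ => 1 - g ^ 2) g := by fun_prop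
  exact this.rpow_const_of_ne (by linarith)

/-- The squared angular velocity of the unduloid with amplitude `g₀`: writing its profile as
`g = g₀ cos φ`, the first integral reads `φ'² = unduloidSpeedSq n r g₀ g`. The factor
`sinPow r g - sinPow r g₀`, which vanishes at the turning points `g = ± g₀`, has been cancelled with the
help of `powDivDiff`, so that this is smooth and positive also there. -/
noncomputable def unduloidSpeedSq (n r : ℕ) (g₀ g : ℝ) : ℝ :=
  (1 - g ^ 2) * powDivDiff (n - r) (sinPow r g) (sinPow r g₀) /
    (sinPow r g₀ ^ (n - r) * powDivDiff r (sinPow r g) (sinPow r g₀))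

variable {n r : ℕ} {g₀ g : ℝ}

theorem unduloidSpeedSq_pos (hr : 1 ≤ r) (hrn : r < n) (hg₀ : g₀ ^ 2 < 1) (hg : g ^ 2 < 1) :
    0 < unduloidSpeedSq n r g₀ g := by
  have h1 := sinPow_pos r hg
  have h2 := sinPow_pos r hg₀
  have h3 := powDivDiff_pos (k := n - r) (by omega) h1 h2
  have h4 := powDivDiff_pos (k := r) (by omega) h1 h2
  have h5 : 0 < 1 - g ^ 2 := by linarith
  unfold unduloidSpeedSq
  positivity

theorem contDiffAt_unduloidSpeedSq (hr : 1 ≤ r) (hg₀ : g₀ ^ 2 < 1) (hg : g ^ 2 < 1) :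
    ContDiffAt ℝ ∞ (unduloidSpeedSq n r g₀) g := by
  have h1 := sinPow_pos r hg
  have h2 := sinPow_pos r hg₀
  have h4 := powDivDiff_pos (k := r) (by omega) h1 h2
  have hs := contDiffAt_sinPow r hg
  have hq : ∀ k, ContDiffAt ℝ ∞ (fun g => powDivDiff k (sinPow r g) (sinPow r g₀)) g := fun k => by
    unfold powDivDiff
    exact ContDiffAt.sum fun i _ => (hs.pow i).mul contDiffAt_const
  unfold unduloidSpeedSq
  refine ContDiffAt.div ?_ (contDiffAt_const.mul (hq r)) (by positivity)
  exact ContDiffAt.mul (by fun_prop) (hq _)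

/-- With `g'² = (g₀² - g²) φ'²`, the first integral in the form
`g'² = (1 - g²)^{n/r} / (1 - g₀²)^{(n-r)/r} - (1 - g²)`. -/
theorem sub_sq_mul_unduloidSpeedSq (hr : 1 ≤ r) (hg₀ : g₀ ^ 2 < 1) (hg : g ^ 2 < 1) :
    1 - g ^ 2 + (g₀ ^ 2 - g ^ 2) * unduloidSpeedSq n r g₀ g =
      (1 - g ^ 2) * (sinPow r g / sinPow r g₀) ^ (n - r) := by
  have h1 := sinPow_pos r hg
  have h2 := sinPow_pos r hg₀
  have h4 := powDivDiff_pos (k := r) (by omega) h1 h2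
  have e1 := powDivDiff_mul (n - r) (sinPow r g) (sinPow r g₀)
  have e2 := powDivDiff_mul r (sinPow r g) (sinPow r g₀)
  rw [sinPow_pow hr hg, sinPow_pow hr hg₀] at e2
  have e3 : g₀ ^ 2 - g ^ 2 = powDivDiff r (sinPow r g) (sinPow r g₀) * (sinPow r g - sinPow r g₀) := by
    linarith
  rw [e3, unduloidSpeedSq, div_pow]
  field_simp
  rw [mul_comm (sinPow r g - sinPow r g₀), e1]
  ring

theorem mul_sinPow_div_pow (hr : 1 ≤ r) (hrn : r ≤ n) (hg₀ : g₀ ^ 2 < 1) (hg : g ^ 2 < 1) :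
    (1 - g₀ ^ 2) ^ (n - r) * ((1 - g ^ 2) * (sinPow r g / sinPow r g₀) ^ (n - r)) ^ r =
      (1 - g ^ 2) ^ n := by
  rw [mul_pow, ← pow_mul, mul_comm (n - r) r, pow_mul, div_pow, sinPow_pow hr hg₀, sinPow_pow hr hg,
    div_pow]
  have : (1 - g₀ ^ 2) ^ (n - r) ≠ 0 := pow_ne_zero _ (by linarith)
  field_simp
  rw [← pow_add, Nat.add_sub_cancel' hrn]

/-- Where `g' ≠ 0`, constancy of the first integral is equivalent to the equation `H_r = 0`. -/
theorem profileOp_eq_zero_of_firstIntegral {g : ℝ → ℝ} {t K : ℝ} (hr : 1 ≤ r) (hrn : r < n)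
    (hg : ContDiffAt ℝ ∞ g t) (hlt : g t ^ 2 < 1) (hne : deriv g t ≠ 0)
    (h : ∀ᶠ s in 𝓝 t, (1 - g s ^ 2) ^ n = K * (1 - g s ^ 2 + deriv g s ^ 2) ^ r) :
    profileOp n r g t = 0 := by
  have hd : HasDerivAt g (deriv g t) t := (hg.differentiableAt (by simp)).hasDerivAt
  have hd2 := hg.hasDerivAt_deriv
  have hA : HasDerivAt (fun s => 1 - g s ^ 2) (-(2 * g t * deriv g t)) t := by
    have := (hd.pow 2).const_sub 1
    simpa using this
  have hB : HasDerivAt (fun s => 1 - g s ^ 2 + deriv g s ^ 2)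
      (-(2 * g t * deriv g t) + 2 * deriv g t * deriv (deriv g) t) t := by
    have := hA.fun_add (hd2.fun_pow 2)
    simpa using this
  have hA0 : 0 < 1 - g t ^ 2 := by linarith
  have hB0 : 0 < 1 - g t ^ 2 + deriv g t ^ 2 := by positivity
  have h0 := h.self_of_nhds
  have h1 := ((hA.fun_pow n).congr_of_eventuallyEq
    (f₁ := fun s => K * (1 - g s ^ 2 + deriv g s ^ 2) ^ r)
    (by filter_upwards [h] with s hs using hs.symm)).unique ((hB.fun_pow r).const_mul K)
  obtain ⟨s, rfl⟩ : ∃ s, r = s + 1 := ⟨r - 1, by omega⟩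
  obtain ⟨m, rfl⟩ : ∃ m, n = m + 1 := ⟨n - 1, by omega⟩
  simp only [Nat.add_sub_cancel] at h1
  have hK : K ≠ 0 := by
    rintro rfl
    rw [zero_mul] at h0
    exact (pow_pos hA0 _).ne' h0
  unfold profileOp
  push_cast at h1 ⊢
  refine (mul_eq_zero.1 (?_ : deriv g t * (2 * (K * (1 - g t ^ 2 + deriv g t ^ 2) ^ s)) * _ = 0)
    ).resolve_left (by positivity)
  rw [pow_succ, pow_succ] at h0
  linear_combination -(1 - g t ^ 2) * h1 - 2 * g t * deriv g t * (m + 1) * h0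

/-- The profile curves of the Delaunay-type hypersurfaces, in terms of the cosine `g` of the radius.
The last property says that they exhaust the corresponding level set of the first integral. -/
theorem exists_unduloid (hr : 1 ≤ r) (hrn : r < n) (hg₀ : 0 < g₀) (hg₁ : g₀ < 1) :
    ∃ (g : ℝ → ℝ) (l : ℝ), ContDiff ℝ ∞ g ∧ 0 < l ∧ g 0 = g₀ ∧ (∀ t, g (-t) = g t) ∧
      (∀ t, g (t + l) = -g t) ∧ (∀ t ∈ Ioo 0 l, deriv g t < 0) ∧ (∀ t, g t ^ 2 ≤ g₀ ^ 2) ∧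
      (∀ t, profileOp n r g t = 0) ∧ ∀ x y, x ^ 2 < 1 →
        ((1 - x ^ 2) / (1 - x ^ 2 + y ^ 2)) ^ r * (1 - x ^ 2) ^ (n - r) = (1 - g₀ ^ 2) ^ (n - r) →
        ∃ t, g t = x ∧ deriv g t = y := by
  have hsq : g₀ ^ 2 < 1 := by nlinarith
  have hcos : ∀ φ, (g₀ * Real.cos φ) ^ 2 ≤ g₀ ^ 2 := fun φ => by
    rw [mul_pow]
    exact mul_le_of_le_one_right (sq_nonneg _) (Real.cos_sq_le_one φ)
  have hlt : ∀ φ, (g₀ * Real.cos φ) ^ 2 < 1 := fun φ => (hcos φ).trans_lt hsq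
  set Ω : ℝ → ℝ := fun φ => √(unduloidSpeedSq n r g₀ (g₀ * Real.cos φ)) with hΩ
  have hpos2 : ∀ φ, 0 < unduloidSpeedSq n r g₀ (g₀ * Real.cos φ) := fun φ =>
    unduloidSpeedSq_pos hr hrn hsq (hlt φ)
  have hpos : ∀ φ, 0 < Ω φ := fun φ => Real.sqrt_pos.2 (hpos2 φ)
  have hΩsq : ∀ φ, Ω φ ^ 2 = unduloidSpeedSq n r g₀ (g₀ * Real.cos φ) := fun φ =>
    Real.sq_sqrt (hpos2 φ).le
  have hΩc : ContDiff ℝ ∞ Ω := contDiff_iff_contDiffAt.2 fun φ => by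
    have h1 : ContDiffAt ℝ ∞ (fun φ => g₀ * Real.cos φ) φ := by fun_prop
    have h2 : ContDiffAt ℝ ∞ (fun φ => unduloidSpeedSq n r g₀ (g₀ * Real.cos φ)) φ :=
      ContDiffAt.comp (g := unduloidSpeedSq n r g₀) φ (contDiffAt_unduloidSpeedSq hr hsq (hlt φ)) h1
    exact h2.sqrt (hpos2 φ).ne'
  have hneg : ∀ x, unduloidSpeedSq n r g₀ (-x) = unduloidSpeedSq n r g₀ x := fun x => by
    simp only [unduloidSpeedSq, sinPow, neg_sq]
  obtain ⟨φ, l, hφc, hl, hφd, hφ0, hφodd, hφadd, hφmono, hφsurj⟩ :=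
    exists_flow_of_even_periodic hΩc hpos (fun x => by simp only [hΩ, Real.cos_neg])
      (fun x => by simp only [hΩ, Real.cos_add_pi, mul_neg, hneg])
  set g : ℝ → ℝ := fun t => g₀ * Real.cos (φ t) with hg
  have hgc : ContDiff ℝ ∞ g := contDiff_const.mul hφc.cos
  have hgd : ∀ t, deriv g t = -(g₀ * Real.sin (φ t) * Ω (φ t)) := fun t => by
    rw [((hφd t).cos.const_mul g₀).deriv]
    ring
  have hgd2 : ∀ t, deriv g t ^ 2 = (g₀ ^ 2 - g t ^ 2) * unduloidSpeedSq n r g₀ (g t) := fun t => by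
    rw [hgd, neg_sq, mul_pow, mul_pow, hΩsq, Real.sin_sq]
    simp only [hg]
    ring
  have hint : ∀ t, (1 - g t ^ 2) ^ n =
      (1 - g₀ ^ 2) ^ (n - r) * (1 - g t ^ 2 + deriv g t ^ 2) ^ r := fun t => by
    have hgt : g t ^ 2 < 1 := hlt (φ t)
    rw [hgd2, sub_sq_mul_unduloidSpeedSq hr hsq hgt, mul_sinPow_div_pow hr hrn.le hsq hgt]
  have hop : ∀ t, deriv g t ≠ 0 → profileOp n r g t = 0 := fun t ht =>
    profileOp_eq_zero_of_firstIntegral hr hrn hgc.contDiffAt (hlt (φ t)) ht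
      (Eventually.of_forall hint)
  refine ⟨g, l, hgc, hl, by simp [hg, hφ0], fun t => by simp [hg, hφodd],
    fun t => by simp [hg, hφadd, Real.cos_add_pi], fun t ht => ?_, fun t => hcos _, fun t => ?_,
    fun x y hx hxy => ?_⟩
  · have hφl : φ l = Real.pi := by simpa [hφ0] using hφadd 0
    have h1 := hφmono ht.1
    have h2 := hφmono ht.2
    rw [hφ0] at h1
    rw [hφl] at h2
    have h3 := Real.sin_pos_of_pos_of_lt_pi h1 h2
    rw [hgd]
    have := mul_pos (mul_pos hg₀ h3) (hpos (φ t))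
    linarith
  · by_cases ht : deriv g t = 0
    · have hsin : Real.sin (φ t) = 0 := by
        rw [hgd, neg_eq_zero, mul_eq_zero, mul_eq_zero] at ht
        exact (ht.resolve_right (hpos _).ne').resolve_left hg₀.ne'
      have hcos : Real.cos (φ t) ≠ 0 := fun h0 => by
        have := Real.sin_sq_add_cos_sq (φ t)
        rw [hsin, h0] at this
        norm_num at this
      have hev : ∀ᶠ s in 𝓝[≠] t, Real.sin (φ s) ≠ 0 := by
        have := (hφd t).sin.eventually_ne (c := 0) (mul_ne_zero hcos (hpos _).ne')
        simpa [hsin] using this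
      have hz : ∀ᶠ s in 𝓝[≠] t, profileOp n r g s = 0 := by
        filter_upwards [hev] with s hs
        refine hop s ?_
        rw [hgd]
        exact neg_ne_zero.2 (mul_ne_zero (mul_ne_zero hg₀.ne' hs) (hpos _).ne')
      have hc : ContinuousAt (profileOp n r g) t := by
        have c1 := hgc.continuous.continuousAt (x := t)
        have c2 := hgc.contDiffAt.hasDerivAt_deriv.continuousAt (x := t)
        have c3 := hgc.contDiffAt.continuousAt_deriv_deriv (t := t)
        unfold profileOp
        fun_prop
      -- the turning points are isolated
      exact tendsto_nhds_unique_of_eventuallyEq (hc.mono_left nhdsWithin_le_nhds)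
        (tendsto_const_nhds (x := (0 : ℝ))) hz
    · exact hop t ht
  · have h1 := sinPow_pos r hx
    have h2 := sinPow_pos r hsq
    have hx0 : 0 < 1 - x ^ 2 := by linarith
    have hB : 0 < 1 - x ^ 2 + y ^ 2 := by positivity
    replace hxy : 1 - x ^ 2 + y ^ 2 = (1 - x ^ 2) * (sinPow r x / sinPow r g₀) ^ (n - r) := by
      refine (pow_left_inj₀ hB.le (by positivity) (by omega : r ≠ 0)).1 ?_
      have hK : (1 - g₀ ^ 2) ^ (n - r) ≠ 0 := pow_ne_zero _ (by linarith)
      refine mul_left_cancel₀ hK ?_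
      rw [mul_sinPow_div_pow hr hrn.le hsq hx, ← hxy, div_pow, div_mul_eq_mul_div, ← pow_add,
        Nat.add_sub_cancel' hrn.le, div_mul_cancel₀ _ (pow_ne_zero _ hB.ne')]
    -- beyond the amplitude `g₀` the first integral is smaller
    have h3 : x ^ 2 ≤ g₀ ^ 2 := by
      by_contra! hlt'
      have h4 : sinPow r x ^ r < sinPow r g₀ ^ r := by
        rw [sinPow_pow hr hx, sinPow_pow hr hsq]
        linarith
      have h5 : sinPow r x / sinPow r g₀ < 1 := by
        rw [div_lt_one h2]
        exact lt_of_pow_lt_pow_left₀ r h2.le h4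
      have h6 : (sinPow r x / sinPow r g₀) ^ (n - r) < 1 :=
        pow_lt_one₀ (by positivity) h5 (by omega)
      nlinarith [sq_nonneg y]
    have h4 := abs_le_of_sq_le_sq' h3 hg₀.le
    have hψ : g₀ * Real.cos (Real.arccos (x / g₀)) = x := by
      rw [Real.cos_arccos (by rw [le_div_iff₀ hg₀]; linarith) (by rw [div_le_one hg₀]; linarith),
        mul_div_cancel₀ _ hg₀.ne']
    set ψ := Real.arccos (x / g₀)
    have hy : y ^ 2 = (g₀ * Real.sin ψ * Ω ψ) ^ 2 := by
      have h5 := sub_sq_mul_unduloidSpeedSq (n := n) hr hsq hx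
      rw [mul_pow, mul_pow, hΩsq, Real.sin_sq, hψ]
      rw [← hψ] at h5 hxy ⊢
      linear_combination hxy - h5
    rcases sq_eq_sq_iff_eq_or_eq_neg.1 hy with h5 | h5
    · obtain ⟨t, ht⟩ := hφsurj (-ψ)
      refine ⟨t, by simp only [hg, ht, Real.cos_neg, hψ], ?_⟩
      rw [hgd, ht, h5, Real.sin_neg]
      simp only [hΩ, Real.cos_neg]
      ring
    · obtain ⟨t, ht⟩ := hφsurj ψ
      exact ⟨t, by simp only [hg, ht, hψ], by rw [hgd, ht, h5]⟩

/-- The unduloid with neck radius `a`, where `g = cos R` is the solution with amplitude `cos a`. The last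
property says that it passes through all points `(g, g')` with the same first integral. -/
theorem exists_isUnduloidProfile {a : ℝ} (hr : 1 ≤ r) (hrn : r < n) (ha : 0 < a)
    (ha' : a < Real.pi / 2) :
    ∃ R : ℝ → ℝ, IsUnduloidProfile a R ∧ ContDiff ℝ ∞ R ∧ (∀ t, R t ∈ Ioo 0 Real.pi) ∧
      (∀ t, profileOp n r (fun t => Real.cos (R t)) t = 0) ∧ ∀ x y, x ^ 2 < 1 →
        ((1 - x ^ 2) / (1 - x ^ 2 + y ^ 2)) ^ r * (1 - x ^ 2) ^ (n - r) =
          (Real.sin a ^ 2) ^ (n - r) →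
        ∃ t, Real.cos (R t) = x ∧ deriv (fun t => Real.cos (R t)) t = y := by
  have hg₀ : 0 < Real.cos a := Real.cos_pos_of_mem_Ioo ⟨by linarith, ha'⟩
  have hg₁ : Real.cos a < 1 := by
    have := Real.cos_lt_cos_of_nonneg_of_le_pi_div_two le_rfl ha'.le ha
    rwa [Real.cos_zero] at this
  obtain ⟨g, l, hgc, hl, hg0, hgeven, hgadd, hgd, hgle, hgop, hgph⟩ :=
    exists_unduloid hr hrn hg₀ hg₁
  have hb : ∀ t, -Real.cos a ≤ g t ∧ g t ≤ Real.cos a := fun t =>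
    abs_le_of_sq_le_sq' (hgle t) hg₀.le
  have hcos : ∀ t, Real.cos (Real.arccos (g t)) = g t := fun t =>
    Real.cos_arccos (by linarith [(hb t).1]) (by linarith [(hb t).2])
  have hfun : (fun t => Real.cos (Real.arccos (g t))) = g := funext hcos
  have hne : ∀ t, g t ≠ -1 ∧ g t ≠ 1 := fun t =>
    ⟨fun h => by linarith [(hb t).1], fun h => by linarith [(hb t).2]⟩
  have hRc : ContDiff ℝ ∞ fun t => Real.arccos (g t) := contDiff_iff_contDiffAt.2 fun t =>
    ContDiffAt.comp (g := Real.arccos) t (Real.contDiffAt_arccos (hne t).1 (hne t).2)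
      hgc.contDiffAt
  have hga : Real.arccos (Real.cos a) = a := Real.arccos_cos ha.le (by linarith)
  refine ⟨fun t => Real.arccos (g t), ⟨Real.pi - a, l, ha, by linarith, by linarith, hl, hRc,
    by simp only [hg0, hga], ?_, fun t => by simp only [hgeven], fun t => ?_, fun t ht => ?_⟩, hRc,
    fun t => ⟨Real.arccos_pos.2 (by linarith [(hb t).2]), ?_⟩, ?_, ?_⟩
  · have := hgadd 0
    rw [zero_add] at this
    simp only [this, Real.arccos_neg, hg0, hga]
  · simp only [two_mul, ← add_assoc, hgadd, neg_neg]
  · have h1 : HasDerivAt g (deriv g t) t :=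
      (hgc.contDiffAt.differentiableAt (by simp)).hasDerivAt
    have h2 := (Real.hasDerivAt_arccos (x := g t) (hne t).1 (hne t).2).comp t h1
    have h3 : deriv (fun t => Real.arccos (g t)) t = -(1 / √(1 - g t ^ 2)) * deriv g t := h2.deriv
    rw [h3]
    have h4 : 0 < 1 - g t ^ 2 := by nlinarith [hgle t]
    have h5 : 0 < 1 / √(1 - g t ^ 2) := by positivity
    nlinarith [hgd t ht]
  · refine lt_of_le_of_ne (Real.arccos_le_pi _) fun h => ?_
    rw [Real.arccos_eq_pi] at h
    linarith [(hb t).1]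
  · rwa [hfun]
  · intro x y hx hxy
    obtain ⟨t, ht⟩ := hgph x y hx (by rw [hxy, Real.sin_sq])
    refine ⟨t, ?_⟩
    rw [hfun]
    simpa only [hcos] using ht

end Unduloid


/-! ### The model hypersurfaces -/

section Models

open Set Topology TopologicalSpace

variable {n : ℕ} {W : Type*} [NormedAddCommGroup W] [NormedSpace ℝ W]

theorem contMDiff_restrict_opens {U : Opens (EuclideanSpace ℝ (Fin n))}
    {Φ : EuclideanSpace ℝ (Fin n) → W} (hΦ : ∀ x ∈ U, ContDiffAt ℝ ∞ Φ x) :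
    ContMDiff (𝓡 n) 𝓘(ℝ, W) ∞ fun y : U => Φ y := fun y =>
  ContMDiffAt.comp y (hΦ y y.2).contMDiffAt contMDiff_subtype_val.contMDiffAt

theorem mvfderiv_restrict_opens {U : Opens (EuclideanSpace ℝ (Fin n))}
    {Φ : EuclideanSpace ℝ (Fin n) → W} (hΦ : ∀ x ∈ U, ContDiffAt ℝ ∞ Φ x) (x : U) :
    mvfderiv (𝓡 n) (fun y : U => Φ y) x = fderiv ℝ Φ x := by
  rw [mvfderiv_eq_fderiv_chart (contMDiff_restrict_opens hΦ)]
  have h1 : (extChartAt (𝓡 n) x) x = x := rfl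
  have hc : ∀ z : U, (extChartAt (𝓡 n) x) z = z := fun _ => rfl
  have h2 : (fun y : U => Φ y) ∘ (extChartAt (𝓡 n) x).symm =ᶠ[𝓝 (extChartAt (𝓡 n) x x)] Φ := by
    filter_upwards [(isOpen_extChartAt_target x).mem_nhds (mem_extChartAt_target (I := 𝓡 n) x)] with y hy
    have := (extChartAt (𝓡 n) x).right_inv hy
    rw [hc] at this
    rw [Function.comp_apply, this]
  rw [h2.fderiv_eq, h1]

/-- `ℝⁿ` without the origin, as a manifold. -/
abbrev puncturedSpace (n : ℕ) : Opens (EuclideanSpace ℝ (Fin n)) :=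
  ⟨{0}ᶜ, isOpen_compl_singleton⟩

theorem connectedSpace_puncturedSpace (hn : 2 ≤ n) : ConnectedSpace (puncturedSpace n) := by
  have h := isConnected_compl_singleton_of_one_lt_rank (E := EuclideanSpace ℝ (Fin n)) (by
    rw [← Module.finrank_eq_rank, finrank_euclideanSpace_fin]
    exact_mod_cast hn) 0
  exact isConnected_iff_connectedSpace.1 h

/-- An isometry of `ℝⁿ` onto the hyperplane orthogonal to `o`. -/
theorem exists_linearIsometry_orthogonal {o : EuclideanSpace ℝ (Fin (n + 1))} (ho : ‖o‖ = 1) :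
    ∃ J : EuclideanSpace ℝ (Fin n) →ₗᵢ[ℝ] EuclideanSpace ℝ (Fin (n + 1)),
      (∀ v, inner ℝ o (J v) = 0) ∧ ∀ w, inner ℝ o w = 0 → ∃ v, J v = w := by
  have : Fact (Module.finrank ℝ (EuclideanSpace ℝ (Fin (n + 1))) = n + 1) :=
    ⟨finrank_euclideanSpace_fin⟩
  have ho' : o ≠ 0 := by
    rintro rfl
    simp at ho
  let b := (OrthonormalBasis.fromOrthogonalSpanSingleton (𝕜 := ℝ) n ho').repr
  refine ⟨(Submodule.subtypeₗᵢ _).comp b.symm.toLinearIsometry, fun v => ?_, fun w hw => ?_⟩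
  · exact Submodule.mem_orthogonal_singleton_iff_inner_right.1 (b.symm v).2
  · refine ⟨b ⟨w, Submodule.mem_orthogonal_singleton_iff_inner_right.2 hw⟩, ?_⟩
    simp

theorem mem_rotationalSet_iff {o : EuclideanSpace ℝ (Fin (n + 1))} (ho : ‖o‖ = 1) {R : ℝ → ℝ}
    (hR : ∀ t, R t ∈ Icc 0 Real.pi) {y : EucProd n} :
    y ∈ rotationalSet o R ↔ ‖y.fst‖ = 1 ∧ inner ℝ o y.fst = Real.cos (R y.snd) := by
  refine and_congr_right fun hy => ?_
  have hy' : ‖y.fst‖ = 1 := hy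
  have h1 : inner ℝ o y.fst = Real.cos (InnerProductGeometry.angle o y.fst) := by
    rw [InnerProductGeometry.cos_angle, ho, hy', mul_one, div_one]
  rw [h1]
  exact ⟨fun h => by rw [h], fun h => Real.injOn_cos
    ⟨InnerProductGeometry.angle_nonneg _ _, InnerProductGeometry.angle_le_pi _ _⟩ (hR _) h⟩

theorem isClosed_rotationalSet {o : EuclideanSpace ℝ (Fin (n + 1))} (ho : ‖o‖ = 1) {R : ℝ → ℝ}
    (hRc : Continuous R) (hR : ∀ t, R t ∈ Icc 0 Real.pi) : IsClosed (rotationalSet o R) := by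
  have h : rotationalSet o R = {y | ‖(WithLp.fstL 2 ℝ _ _ y)‖ = 1} ∩
      {y | inner ℝ o (WithLp.fstL 2 ℝ _ _ y) = Real.cos (R (WithLp.sndL 2 ℝ _ _ y))} := by
    ext y
    exact mem_rotationalSet_iff ho hR
  rw [h]
  refine (isClosed_eq ?_ ?_).inter (isClosed_eq ?_ ?_) <;> fun_prop

section RotationalParametrization

variable (o : EuclideanSpace ℝ (Fin (n + 1)))
  (J : EuclideanSpace ℝ (Fin n) →ₗᵢ[ℝ] EuclideanSpace ℝ (Fin (n + 1))) (R : ℝ → ℝ)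

/-- The parametrization of the rotational hypersurface with profile `R` by the punctured space: the
logarithm of the norm is the height, and the direction is the longitude. -/
noncomputable def rotationalMap (x : EuclideanSpace ℝ (Fin n)) : EucProd n :=
  WithLp.toLp 2 (Real.cos (R (Real.log ‖x‖)) • o + (Real.sin (R (Real.log ‖x‖)) * ‖x‖⁻¹) • J x,
    Real.log ‖x‖)

/-- A smooth left inverse of `rotationalMap`. -/
noncomputable def rotationalInv (y : EucProd n) : EuclideanSpace ℝ (Fin n) :=
  (Real.exp y.snd / Real.sin (R y.snd)) • J.toContinuousLinearMap.adjoint y.fst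

variable {o J R}

theorem contDiffAt_rotationalMap (hR : ContDiff ℝ ∞ R) {x : EuclideanSpace ℝ (Fin n)} (hx : x ≠ 0) :
    ContDiffAt ℝ ∞ (rotationalMap o J R) x := by
  have h1 : ContDiffAt ℝ ∞ (fun x : EuclideanSpace ℝ (Fin n) => ‖x‖) x := contDiffAt_norm ℝ hx
  have h2 : ContDiffAt ℝ ∞ (fun x : EuclideanSpace ℝ (Fin n) => Real.log ‖x‖) x :=
    h1.log (norm_ne_zero_iff.2 hx)
  have h3 : ContDiffAt ℝ ∞ (fun x : EuclideanSpace ℝ (Fin n) => R (Real.log ‖x‖)) x :=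
    hR.contDiffAt.comp x h2
  have h4 := h1.inv (norm_ne_zero_iff.2 hx)
  have h5 : ContDiffAt ℝ ∞ (fun x => J x) x := J.contDiff.contDiffAt
  have h6 := ((h3.cos.smul (contDiffAt_const (c := o))).add ((h3.sin.mul h4).smul h5)).prodMk h2
  exact (WithLp.prodContinuousLinearEquiv 2 ℝ
    (EuclideanSpace ℝ (Fin (n + 1))) ℝ).symm.contDiff.contDiffAt.comp x h6

theorem contDiff_rotationalInv (hR : ContDiff ℝ ∞ R) (hR0 : ∀ t, R t ∈ Ioo 0 Real.pi) :
    ContDiff ℝ ∞ (rotationalInv J R) := by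
  have h1 : ContDiff ℝ ∞ fun y : EucProd n => y.snd :=
    (WithLp.sndL 2 ℝ (EuclideanSpace ℝ (Fin (n + 1))) ℝ).contDiff
  have h2 : ContDiff ℝ ∞ fun y : EucProd n => y.fst :=
    (WithLp.fstL 2 ℝ (EuclideanSpace ℝ (Fin (n + 1))) ℝ).contDiff
  have h3 := (hR.comp h1).sin
  exact (h1.exp.div h3 fun y => (Real.sin_pos_of_mem_Ioo (hR0 _)).ne').smul
    ((J.toContinuousLinearMap.adjoint).contDiff.comp h2)

theorem rotationalInv_rotationalMap (hJ : ∀ v, inner ℝ o (J v) = 0)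
    (hR0 : ∀ t, R t ∈ Ioo 0 Real.pi) {x : EuclideanSpace ℝ (Fin n)} (hx : x ≠ 0) :
    rotationalInv J R (rotationalMap o J R x) = x := by
  have hn : 0 < ‖x‖ := norm_pos_iff.2 hx
  have h1 : J.toContinuousLinearMap.adjoint o = 0 := by
    refine ext_inner_right ℝ fun v => ?_
    rw [ContinuousLinearMap.adjoint_inner_left, inner_zero_left]
    exact hJ v
  have h2 : J.toContinuousLinearMap.adjoint (J x) = x := by
    refine ext_inner_right ℝ fun v => ?_
    rw [ContinuousLinearMap.adjoint_inner_left]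
    exact J.inner_map_map x v
  have hs := (Real.sin_pos_of_mem_Ioo (hR0 (Real.log ‖x‖))).ne'
  simp only [rotationalInv, rotationalMap, WithLp.toLp_fst, WithLp.toLp_snd, map_add, map_smul, h1,
    h2, smul_zero, zero_add, Real.exp_log hn, smul_smul]
  rw [show ‖x‖ / Real.sin (R (Real.log ‖x‖)) * (Real.sin (R (Real.log ‖x‖)) * ‖x‖⁻¹) = 1 by
    field_simp, one_smul]

theorem inner_rotationalMap (ho : ‖o‖ = 1) (hJ : ∀ v, inner ℝ o (J v) = 0)
    (x : EuclideanSpace ℝ (Fin n)) :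
    inner ℝ o (rotationalMap o J R x).fst = Real.cos (R (Real.log ‖x‖)) := by
  simp [rotationalMap, inner_add_right, inner_smul_right, hJ, ho]

theorem norm_rotationalMap (ho : ‖o‖ = 1) (hJ : ∀ v, inner ℝ o (J v) = 0)
    {x : EuclideanSpace ℝ (Fin n)} (hx : x ≠ 0) : ‖(rotationalMap o J R x).fst‖ = 1 := by
  have hn : ‖x‖ ≠ 0 := norm_ne_zero_iff.2 hx
  have h : ‖(rotationalMap o J R x).fst‖ ^ 2 = 1 := by
    rw [rotationalMap, WithLp.toLp_fst, norm_add_sq_real, inner_smul_left, inner_smul_right, hJ,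
      norm_smul, norm_smul, J.norm_map, ho, Real.norm_eq_abs, Real.norm_eq_abs, mul_pow, mul_pow,
      sq_abs, sq_abs, mul_pow, inv_pow, mul_assoc (_ ^ 2), inv_mul_cancel₀ (pow_ne_zero 2 hn)]
    simp
  exact (pow_eq_one_iff_of_nonneg (norm_nonneg _) two_ne_zero).1 h

theorem image_rotationalMap (ho : ‖o‖ = 1) (hJ : ∀ v, inner ℝ o (J v) = 0)
    (hJ' : ∀ w, inner ℝ o w = 0 → ∃ v, J v = w) (hR0 : ∀ t, R t ∈ Ioo 0 Real.pi) :
    rotationalMap o J R '' {0}ᶜ = rotationalSet o R := by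
  have hR1 : ∀ t, R t ∈ Icc 0 Real.pi := fun t => Ioo_subset_Icc_self (hR0 t)
  ext y
  rw [mem_rotationalSet_iff ho hR1]
  constructor
  · rintro ⟨x, hx, rfl⟩
    exact ⟨norm_rotationalMap ho hJ hx, inner_rotationalMap ho hJ x⟩
  · rintro ⟨h1, h2⟩
    have hs := Real.sin_pos_of_mem_Ioo (hR0 y.snd)
    obtain ⟨v, hv⟩ := hJ' (y.fst - Real.cos (R y.snd) • o)
      (by rw [inner_sub_right, inner_smul_right, h2]; simp [ho])
    have hvn : ‖v‖ = Real.sin (R y.snd) := by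
      have h3 : ‖v‖ ^ 2 = Real.sin (R y.snd) ^ 2 := by
        rw [← J.norm_map, hv, norm_sub_sq_real, inner_smul_right, real_inner_comm, h2, norm_smul, h1,
          ho, Real.norm_eq_abs, mul_one, sq_abs, Real.sin_sq]
        ring
      exact (pow_left_inj₀ (norm_nonneg _) hs.le two_ne_zero).1 h3
    have hxn : ‖(Real.exp y.snd / Real.sin (R y.snd)) • v‖ = Real.exp y.snd := by
      rw [norm_smul, hvn, Real.norm_eq_abs, abs_of_pos (by positivity), div_mul_cancel₀ _ hs.ne']
    refine ⟨(Real.exp y.snd / Real.sin (R y.snd)) • v, ?_, ?_⟩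
    · rw [mem_compl_iff, mem_singleton_iff, ← norm_eq_zero, hxn]
      exact (Real.exp_pos _).ne'
    · have he := (Real.exp_pos y.snd).ne'
      refine eucProd_ext ?_ ?_
      · simp only [rotationalMap, WithLp.toLp_fst, hxn, Real.log_exp, map_smul, hv, smul_smul]
        rw [show Real.sin (R y.snd) * (Real.exp y.snd)⁻¹ * (Real.exp y.snd / Real.sin (R y.snd)) = 1
          by field_simp, one_smul]
        abel
      · simp only [rotationalMap, WithLp.toLp_snd, hxn, Real.log_exp]

/-- The unit normal field along `rotationalMap`: the normalized `profileVec` of `g = cos ∘ R`. -/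
noncomputable def rotationalNormal (o : EuclideanSpace ℝ (Fin (n + 1)))
    (J : EuclideanSpace ℝ (Fin n) →ₗᵢ[ℝ] EuclideanSpace ℝ (Fin (n + 1))) (R : ℝ → ℝ)
    (x : EuclideanSpace ℝ (Fin n)) : EucProd n :=
  (√(1 - Real.cos (R (Real.log ‖x‖)) ^ 2 +
    deriv (fun t => Real.cos (R t)) (Real.log ‖x‖) ^ 2))⁻¹ •
    profileVec o (rotationalMap o J R x) (deriv (fun t => Real.cos (R t)) (Real.log ‖x‖))

theorem one_sub_cos_sq_add_pos (hR0 : ∀ t, R t ∈ Ioo 0 Real.pi) (t s : ℝ) :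
    0 < 1 - Real.cos (R t) ^ 2 + s ^ 2 := by
  have := Real.sin_pos_of_mem_Ioo (hR0 t)
  rw [← Real.sin_sq]
  positivity

theorem contDiffAt_rotationalNormal (hR : ContDiff ℝ ∞ R) (hR0 : ∀ t, R t ∈ Ioo 0 Real.pi)
    {x : EuclideanSpace ℝ (Fin n)} (hx : x ≠ 0) : ContDiffAt ℝ ∞ (rotationalNormal o J R) x := by
  have h1 : ContDiffAt ℝ ∞ (fun x : EuclideanSpace ℝ (Fin n) => ‖x‖) x := contDiffAt_norm ℝ hx
  have h2 : ContDiffAt ℝ ∞ (fun x : EuclideanSpace ℝ (Fin n) => Real.log ‖x‖) x :=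
    h1.log (norm_ne_zero_iff.2 hx)
  have hg : ContDiff ℝ ∞ fun t => Real.cos (R t) := hR.cos
  have hg' : ContDiff ℝ ∞ (deriv fun t => Real.cos (R t)) := (contDiff_infty_iff_deriv.1 hg).2
  have h3 : ContDiffAt ℝ ∞
      (fun x : EuclideanSpace ℝ (Fin n) => Real.cos (R (Real.log ‖x‖))) x :=
    ContDiffAt.comp (g := fun t => Real.cos (R t)) x hg.contDiffAt h2
  have h4 : ContDiffAt ℝ ∞ (fun x : EuclideanSpace ℝ (Fin n) =>
      deriv (fun t => Real.cos (R t)) (Real.log ‖x‖)) x :=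
    ContDiffAt.comp (g := deriv fun t => Real.cos (R t)) x hg'.contDiffAt h2
  have hB := one_sub_cos_sq_add_pos hR0 (Real.log ‖x‖)
    (deriv (fun t => Real.cos (R t)) (Real.log ‖x‖))
  have h5 := (((contDiffAt_const (c := (1 : ℝ))).sub (h3.pow 2)).add (h4.pow 2)).sqrt hB.ne'
  have h6 : ContDiffAt ℝ ∞ (fun x => (rotationalMap o J R x).fst) x :=
    (WithLp.fstL 2 ℝ (EuclideanSpace ℝ (Fin (n + 1))) ℝ).contDiff.contDiffAt.comp x
      (contDiffAt_rotationalMap hR hx)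
  have h7 : ContDiffAt ℝ ∞ (fun x => (inner ℝ o (rotationalMap o J R x).fst : ℝ)) x :=
    contDiffAt_const.inner ℝ h6
  have h8 : ContDiffAt ℝ ∞ (fun x => profileVec o (rotationalMap o J R x)
      (deriv (fun t => Real.cos (R t)) (Real.log ‖x‖))) x :=
    (WithLp.prodContinuousLinearEquiv 2 ℝ
      (EuclideanSpace ℝ (Fin (n + 1))) ℝ).symm.contDiff.contDiffAt.comp x ((contDiffAt_const.sub (h7.smul h6)).prodMk h4.neg)
  exact (h5.inv (Real.sqrt_pos.2 hB).ne').smul h8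

theorem inner_fderiv_rotationalMap (ho : ‖o‖ = 1) (hJ : ∀ v, inner ℝ o (J v) = 0)
    (hR : ContDiff ℝ ∞ R) {x : EuclideanSpace ℝ (Fin n)} (hx : x ≠ 0)
    (v : EuclideanSpace ℝ (Fin n)) :
    inner ℝ (rotationalMap o J R x).fst (fderiv ℝ (rotationalMap o J R) x v).fst = 0 ∧
      inner ℝ o (fderiv ℝ (rotationalMap o J R) x v).fst =
        deriv (fun t => Real.cos (R t)) (Real.log ‖x‖) *
          (fderiv ℝ (rotationalMap o J R) x v).snd := by
  have hd := ((contDiffAt_rotationalMap (o := o) (J := J) hR hx).differentiableAt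
    (by simp)).hasFDerivAt
  set D := fderiv ℝ (rotationalMap o J R) x
  have h1 : HasFDerivAt (fun x => (rotationalMap o J R x).fst)
      ((WithLp.fstL 2 ℝ (EuclideanSpace ℝ (Fin (n + 1))) ℝ).comp D) x :=
    (WithLp.fstL 2 ℝ (EuclideanSpace ℝ (Fin (n + 1))) ℝ).hasFDerivAt.comp x hd
  have h2 : HasFDerivAt (fun x => (rotationalMap o J R x).snd)
      ((WithLp.sndL 2 ℝ (EuclideanSpace ℝ (Fin (n + 1))) ℝ).comp D) x :=
    (WithLp.sndL 2 ℝ (EuclideanSpace ℝ (Fin (n + 1))) ℝ).hasFDerivAt.comp x hd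
  have hne : ∀ᶠ y in 𝓝 x, y ≠ 0 := eventually_ne_nhds hx
  constructor
  · have h3 := h1.inner ℝ h1
    have h4 : (fun y => (inner ℝ (rotationalMap o J R y).fst (rotationalMap o J R y).fst : ℝ))
        =ᶠ[𝓝 x] fun _ => 1 := by
      filter_upwards [hne] with y hy
      rw [real_inner_self_eq_norm_sq, norm_rotationalMap ho hJ hy, one_pow]
    have h5 := DFunLike.congr_fun (h3.unique ((hasFDerivAt_const (1 : ℝ) x).congr_of_eventuallyEq h4)) v
    simp [real_inner_comm] at h5
    linarith
  · have hg : HasDerivAt (fun t => Real.cos (R t)) (deriv (fun t => Real.cos (R t))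
        (Real.log ‖x‖)) ((rotationalMap o J R x).snd) :=
      (hR.cos.differentiable (by simp) _).hasDerivAt
    have h3 := hg.comp_hasFDerivAt (f := fun x => (rotationalMap o J R x).snd) x h2
    have h4 : HasFDerivAt (fun y => (inner ℝ o (rotationalMap o J R y).fst : ℝ))
        ((innerSL ℝ o).comp ((WithLp.fstL 2 ℝ (EuclideanSpace ℝ (Fin (n + 1))) ℝ).comp D)) x :=
      (innerSL ℝ o).hasFDerivAt.comp x h1
    have h5 : (fun y => (inner ℝ o (rotationalMap o J R y).fst : ℝ)) =
        (fun t => Real.cos (R t)) ∘ fun x => (rotationalMap o J R x).snd := by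
      ext y
      exact inner_rotationalMap ho hJ y
    rw [h5] at h4
    exact DFunLike.congr_fun (h4.unique h3) v

theorem injective_fderiv_rotationalMap (hJ : ∀ v, inner ℝ o (J v) = 0)
    (hR : ContDiff ℝ ∞ R) (hR0 : ∀ t, R t ∈ Ioo 0 Real.pi) {x : EuclideanSpace ℝ (Fin n)}
    (hx : x ≠ 0) : Function.Injective (fderiv ℝ (rotationalMap o J R) x) := by
  have hd := ((contDiffAt_rotationalMap (o := o) (J := J) hR hx).differentiableAt
    (by simp)).hasFDerivAt
  have hi := ((contDiff_rotationalInv (J := J) hR hR0).differentiable (by simp)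
    (rotationalMap o J R x)).hasFDerivAt
  have h1 := hi.comp x hd
  have h2 : rotationalInv J R ∘ rotationalMap o J R =ᶠ[𝓝 x] id := by
    filter_upwards [eventually_ne_nhds hx] with y hy using rotationalInv_rotationalMap hJ hR0 hy
  have h3 := h1.unique ((hasFDerivAt_id x).congr_of_eventuallyEq h2)
  intro v w hvw
  have hv := DFunLike.congr_fun h3 v
  have hw := DFunLike.congr_fun h3 w
  simp only [ContinuousLinearMap.comp_apply, ContinuousLinearMap.id_apply] at hv hw
  rw [← hv, ← hw, hvw]

theorem inner_rotationalMap_rotationalNormal (ho : ‖o‖ = 1) (hJ : ∀ v, inner ℝ o (J v) = 0)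
    {x : EuclideanSpace ℝ (Fin n)} (hx : x ≠ 0) :
    inner ℝ (rotationalMap o J R x).fst (rotationalNormal o J R x).fst = 0 := by
  have h1 := norm_rotationalMap (R := R) ho hJ hx
  have h2 : ∀ s, (profileVec o (rotationalMap o J R x) s).fst = o -
    (inner ℝ o (rotationalMap o J R x).fst : ℝ) • (rotationalMap o J R x).fst := fun _ => rfl
  rw [rotationalNormal, WithLp.smul_fst, inner_smul_right, h2, inner_sub_right, inner_smul_right,
    real_inner_self_eq_norm_sq, h1, real_inner_comm]
  ring

theorem inner_rotationalNormal_fderiv (ho : ‖o‖ = 1) (hJ : ∀ v, inner ℝ o (J v) = 0)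
    (hR : ContDiff ℝ ∞ R) {x : EuclideanSpace ℝ (Fin n)} (hx : x ≠ 0)
    (v : EuclideanSpace ℝ (Fin n)) :
    inner ℝ (rotationalNormal o J R x) (fderiv ℝ (rotationalMap o J R) x v) = 0 := by
  obtain ⟨h1, h2⟩ := inner_fderiv_rotationalMap ho hJ hR hx v
  rw [rotationalNormal, inner_smul_left, inner_profileVec, h1, h2]
  ring

/-- The rotational hypersurface with profile `R`. -/
noncomputable def rotationalHypersurface (ho : ‖o‖ = 1) (hJ : ∀ v, inner ℝ o (J v) = 0)
    (hR : ContDiff ℝ ∞ R) (hR0 : ∀ t, R t ∈ Ioo 0 Real.pi) :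
    OrientedHypersurface n (puncturedSpace n) where
  toFun x := rotationalMap o J R x
  normal x := rotationalNormal o J R x
  contMDiff_toFun := contMDiff_restrict_opens fun _ hx => contDiffAt_rotationalMap hR hx
  mem_sphereProd x := norm_rotationalMap ho hJ x.2
  injective_mvfderiv x := by
    rw [mvfderiv_restrict_opens fun _ hx => contDiffAt_rotationalMap hR hx]
    exact injective_fderiv_rotationalMap hJ hR hR0 x.2
  contMDiff_normal := contMDiff_restrict_opens fun _ hx => contDiffAt_rotationalNormal hR hR0 hx
  norm_normal x := by
    have hB := one_sub_cos_sq_add_pos hR0 (Real.log ‖(x : EuclideanSpace ℝ (Fin n))‖)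
      (deriv (fun t => Real.cos (R t)) (Real.log ‖(x : EuclideanSpace ℝ (Fin n))‖))
    have h1 := norm_sq_profileVec ho (norm_rotationalMap (R := R) ho hJ x.2)
      (deriv (fun t => Real.cos (R t)) (Real.log ‖(x : EuclideanSpace ℝ (Fin n))‖))
    rw [inner_rotationalMap ho hJ, real_inner_self_eq_norm_sq] at h1
    rw [rotationalNormal, ← h1, Real.sqrt_sq (norm_nonneg _), norm_smul, norm_inv, norm_norm,
      inv_mul_cancel₀]
    intro h0
    rw [h0] at h1
    norm_num at h1
    linarith
  inner_normal_fst x := inner_rotationalMap_rotationalNormal ho hJ x.2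
  inner_normal_mvfderiv x v := by
    rw [mvfderiv_restrict_opens fun _ hx => contDiffAt_rotationalMap hR hx]
    exact inner_rotationalNormal_fderiv ho hJ hR x.2 v

theorem rotationalHypersurface_hasProfileAt (ho : ‖o‖ = 1) (hJ : ∀ v, inner ℝ o (J v) = 0)
    (hR : ContDiff ℝ ∞ R) (hR0 : ∀ t, R t ∈ Ioo 0 Real.pi) (x : puncturedSpace n) :
    (rotationalHypersurface ho hJ hR hR0).HasProfileAt o (fun t => Real.cos (R t)) x where
  eventually_contDiffAt := Filter.Eventually.of_forall fun _ => hR.cos.contDiffAt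
  eventually_eq := Filter.Eventually.of_forall fun y => inner_rotationalMap ho hJ (y : EuclideanSpace ℝ (Fin n))
  exists_snd_ne := by
    rw [OrientedHypersurface.dF_snd_ne_zero_iff]
    set g' := deriv (fun t => Real.cos (R t)) (Real.log ‖(x : EuclideanSpace ℝ (Fin n))‖) with hg'
    have hB := one_sub_cos_sq_add_pos hR0 (Real.log ‖(x : EuclideanSpace ℝ (Fin n))‖) g'
    have hA := one_sub_cos_sq_add_pos hR0 (Real.log ‖(x : EuclideanSpace ℝ (Fin n))‖) 0
    change (rotationalNormal o J R x).snd ^ 2 ≠ 1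
    rw [rotationalNormal, WithLp.smul_snd, profileVec, WithLp.toLp_snd, smul_eq_mul, ← hg', mul_pow,
      inv_pow, Real.sq_sqrt hB.le, neg_sq]
    intro h
    rw [inv_mul_eq_one₀ hB.ne'] at h
    linarith
  sq_lt_one := by
    have hA := one_sub_cos_sq_add_pos hR0
      ((rotationalHypersurface ho hJ hR hR0).height x) 0
    linarith

theorem isClosedEmbedding_rotationalMap (ho : ‖o‖ = 1) (hJ : ∀ v, inner ℝ o (J v) = 0)
    (hJ' : ∀ w, inner ℝ o w = 0 → ∃ v, J v = w)
    (hR : ContDiff ℝ ∞ R) (hR0 : ∀ t, R t ∈ Ioo 0 Real.pi) :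
    range (rotationalHypersurface ho hJ hR hR0).toFun = rotationalSet o R ∧
      IsClosedEmbedding (rotationalHypersurface ho hJ hR hR0).toFun := by
  have hr : range (rotationalHypersurface ho hJ hR hR0).toFun = rotationalSet o R := by
    rw [← image_rotationalMap ho hJ hJ' hR0, image_eq_range]
    rfl
  refine ⟨hr, ?_, ?_⟩
  · refine IsEmbedding.of_comp (g := rotationalInv J R)
      (rotationalHypersurface ho hJ hR hR0).contMDiff_toFun.continuous
      (contDiff_rotationalInv hR hR0).continuous ?_
    have : rotationalInv J R ∘ (rotationalHypersurface ho hJ hR hR0).toFun = Subtype.val :=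
      funext fun x => rotationalInv_rotationalMap hJ hR0 x.2
    rw [this]
    exact IsEmbedding.subtypeVal
  · rw [hr]
    exact isClosed_rotationalSet ho hR.continuous fun t => Ioo_subset_Icc_self (hR0 t)

end RotationalParametrization

theorem isCompleteRotationalMinimal_rotationalSet {o : EuclideanSpace ℝ (Fin (n + 1))} {r : ℕ}
    (hn : 2 ≤ n) (hr : 1 ≤ r) (hrn : r ≤ n) (ho : ‖o‖ = 1) {R : ℝ → ℝ} (hR : ContDiff ℝ ∞ R)
    (hR0 : ∀ t, R t ∈ Ioo 0 Real.pi) (hop : ∀ t, profileOp n r (fun t => Real.cos (R t)) t = 0) :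
    IsCompleteRotationalMinimal n r o (rotationalSet o R) := by
  obtain ⟨J, hJ, hJ'⟩ := exists_linearIsometry_orthogonal ho
  obtain ⟨h1, h2⟩ := isClosedEmbedding_rotationalMap ho hJ hJ' hR hR0
  refine ⟨puncturedSpace n, inferInstance, inferInstance, rotationalHypersurface ho hJ hR hR0,
    inferInstance, inferInstance, inferInstance, connectedSpace_puncturedSpace hn, h2, h1,
    OrientedHypersurface.isComplete_of_isClosedEmbedding h2, ?_, fun x => ?_⟩
  · intro t _ x hx
    refine ⟨R t, (hR0 t).1, (hR0 t).2, fun y hy => ?_⟩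
    have hy' : y ∈ {z | (rotationalHypersurface ho hJ hR hR0).height z = t} :=
      connectedComponentIn_subset _ _ hy
    have h3 : (rotationalHypersurface ho hJ hR hR0).toFun y ∈ rotationalSet o R :=
      h1 ▸ mem_range_self y
    rw [h3.2, ← Set.mem_ofPred_eq.mp hy']
    rfl
  · rw [(rotationalHypersurface_hasProfileAt ho hJ hR hR0 x).meanCurvature_eq_zero_iff ho hr hrn]
    exact mul_eq_zero_of_right _ (hop _)

/-- The punctured space is the annulus, by polar coordinates. -/
theorem isAnnulus_rotationalSet {o : EuclideanSpace ℝ (Fin (n + 1))} (ho : ‖o‖ = 1) {R : ℝ → ℝ}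
    (hR : ContDiff ℝ ∞ R) (hR0 : ∀ t, R t ∈ Ioo 0 Real.pi) : IsAnnulus n (rotationalSet o R) := by
  obtain ⟨J, hJ, hJ'⟩ := exists_linearIsometry_orthogonal ho
  obtain ⟨h1, h2⟩ := isClosedEmbedding_rotationalMap ho hJ hJ' hR hR0
  rw [← h1]
  exact ⟨h2.isEmbedding.toHomeomorph.symm.trans
    ((homeomorphUnitSphereProd (EuclideanSpace ℝ (Fin n))).trans
      ((Homeomorph.refl _).prodCongr Real.expOrderIso.toHomeomorph.symm))⟩

theorem mvfderiv_clm_comp {M V : Type*} [TopologicalSpace M]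
    [ChartedSpace (EuclideanSpace ℝ (Fin n)) M] [IsManifold (𝓡 n) ∞ M] [NormedAddCommGroup V]
    [NormedSpace ℝ V] {g : M → W} (hg : ContMDiff (𝓡 n) 𝓘(ℝ, W) ∞ g) (L : W →L[ℝ] V) (x : M)
    (v : EuclideanSpace ℝ (Fin n)) :
    mvfderiv (𝓡 n) (fun y => L (g y)) x v = L (mvfderiv (𝓡 n) g x v) := by
  have h := HasFDerivAt.comp (g := L) (f := g ∘ (extChartAt (𝓡 n) x).symm) _ L.hasFDerivAt
    (OrientedHypersurface.hasFDerivAt_of_contMDiff hg x)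
  have h2 : ContMDiff (𝓡 n) 𝓘(ℝ, V) ∞ fun y => L (g y) := L.contMDiff.comp hg
  rw [mvfderiv_eq_fderiv_chart h2]
  change fderiv ℝ (L ∘ g ∘ (extChartAt (𝓡 n) x).symm) _ v = _
  rw [h.fderiv]
  rfl

theorem mvfderiv_const_apply {M : Type*} [TopologicalSpace M]
    [ChartedSpace (EuclideanSpace ℝ (Fin n)) M] (c : W) (x : M) (v : EuclideanSpace ℝ (Fin n)) :
    mvfderiv (𝓡 n) (fun _ : M => c) x v = 0 := by
  rw [mvfderiv_eq_fderiv_chart contMDiff_const]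
  change fderiv ℝ (fun _ => c) _ v = 0
  simp

section Horizontal

/-- Gives the unit sphere its structure of an `n`-dimensional manifold. -/
instance fact_finrank_euclideanSpace :
    Fact (Module.finrank ℝ (EuclideanSpace ℝ (Fin (n + 1))) = n + 1) :=
  ⟨finrank_euclideanSpace_fin⟩

/-- The inclusion of the horizontal hyperplane at height `t`. -/
noncomputable def horizontalMap (n : ℕ) (t : ℝ)
    (x : Metric.sphere (0 : EuclideanSpace ℝ (Fin (n + 1))) 1) : EucProd n :=
  WithLp.toLp 2 ((x : EuclideanSpace ℝ (Fin (n + 1))), t)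

theorem contMDiff_horizontalMap (n : ℕ) (t : ℝ) :
    ContMDiff (𝓡 n) 𝓘(ℝ, EucProd n) ∞ (horizontalMap n t) := by
  have h : ContDiff ℝ ∞ fun w : EuclideanSpace ℝ (Fin (n + 1)) =>
      (WithLp.toLp 2 (w, t) : EucProd n) :=
    (WithLp.prodContinuousLinearEquiv 2 ℝ (EuclideanSpace ℝ (Fin (n + 1))) ℝ).symm.contDiff.comp
      (contDiff_id.prodMk contDiff_const)
  exact h.contMDiff.comp contMDiff_coe_sphere

theorem mvfderiv_horizontalMap_fst (t : ℝ)
    (x : Metric.sphere (0 : EuclideanSpace ℝ (Fin (n + 1))) 1) (v : EuclideanSpace ℝ (Fin n)) :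
    WithLp.fstL 2 ℝ (EuclideanSpace ℝ (Fin (n + 1))) ℝ (mvfderiv (𝓡 n) (horizontalMap n t) x v) =
      mvfderiv (𝓡 n) ((↑) : Metric.sphere (0 : EuclideanSpace ℝ (Fin (n + 1))) 1 →
        EuclideanSpace ℝ (Fin (n + 1))) x v :=
  (mvfderiv_clm_comp (contMDiff_horizontalMap n t) (WithLp.fstL 2 ℝ _ _) x v).symm

theorem mvfderiv_horizontalMap_snd (t : ℝ)
    (x : Metric.sphere (0 : EuclideanSpace ℝ (Fin (n + 1))) 1) (v : EuclideanSpace ℝ (Fin n)) :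
    WithLp.sndL 2 ℝ (EuclideanSpace ℝ (Fin (n + 1))) ℝ (mvfderiv (𝓡 n) (horizontalMap n t) x v) =
      0 := by
  rw [← mvfderiv_clm_comp (contMDiff_horizontalMap n t)]
  have : (fun y => WithLp.sndL 2 ℝ (EuclideanSpace ℝ (Fin (n + 1))) ℝ (horizontalMap n t y)) =
    fun _ => t := rfl
  rw [this]
  exact mvfderiv_const_apply t x v

/-- The horizontal hyperplane at height `t`. -/
noncomputable def horizontalHypersurface (n : ℕ) (t : ℝ) :
    OrientedHypersurface n (Metric.sphere (0 : EuclideanSpace ℝ (Fin (n + 1))) 1) where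
  toFun := horizontalMap n t
  normal _ := WithLp.toLp 2 (0, 1)
  contMDiff_toFun := contMDiff_horizontalMap n t
  mem_sphereProd x := mem_sphere_zero_iff_norm.1 x.2
  injective_mvfderiv x v w hvw := by
    refine injective_mvfderiv_subtypeVal_sphere x ?_
    have h := congrArg (WithLp.fstL 2 ℝ (EuclideanSpace ℝ (Fin (n + 1))) ℝ) hvw
    exact (mvfderiv_horizontalMap_fst t x v).symm.trans (h.trans (mvfderiv_horizontalMap_fst t x w))
  contMDiff_normal := contMDiff_const
  norm_normal x := by
    rw [← sq_eq_sq₀ (norm_nonneg _) zero_le_one, WithLp.prod_norm_sq_eq_of_L2]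
    simp
  inner_normal_fst x := inner_zero_right _
  inner_normal_mvfderiv x v := by
    have h := mvfderiv_horizontalMap_snd t x v
    rw [WithLp.prod_inner_apply]
    have h' : (mvfderiv (𝓡 n) (horizontalMap n t) x v).snd = 0 := h
    simp [h']

theorem isCompleteRotationalMinimal_horizontalHyperplane {r : ℕ} (hn : 2 ≤ n) (hr : 1 ≤ r)
    (o : EuclideanSpace ℝ (Fin (n + 1))) (t : ℝ) :
    IsCompleteRotationalMinimal n r o (horizontalHyperplane n t) := by
  set F := horizontalHypersurface n t with hFdef
  have hrange : range F.toFun = horizontalHyperplane n t := by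
    ext y
    constructor
    · rintro ⟨x, rfl⟩
      exact ⟨F.mem_sphereProd x, rfl⟩
    · rintro ⟨h1, h2⟩
      exact ⟨⟨y.fst, mem_sphere_zero_iff_norm.2 h1⟩, eucProd_ext rfl h2.symm⟩
  have hclosed : IsClosed (horizontalHyperplane n t) := by
    have h : horizontalHyperplane n t = {y | ‖(WithLp.fstL 2 ℝ _ _ y)‖ = 1} ∩
        {y | WithLp.sndL 2 ℝ _ _ y = t} := rfl
    rw [h]
    refine (isClosed_eq ?_ ?_).inter (isClosed_eq ?_ ?_) <;> fun_prop
  have hemb : IsClosedEmbedding F.toFun := by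
    refine ⟨IsEmbedding.of_comp (g := WithLp.fstL 2 ℝ (EuclideanSpace ℝ (Fin (n + 1))) ℝ)
      F.contMDiff_toFun.continuous (WithLp.fstL 2 ℝ _ _).continuous IsEmbedding.subtypeVal, ?_⟩
    rw [hrange]
    exact hclosed
  refine ⟨_, inferInstance, inferInstance, F, inferInstance, inferInstance, inferInstance, ?_, hemb,
    hrange, OrientedHypersurface.isComplete_of_isClosedEmbedding hemb, ?_, fun x => ?_⟩
  · refine isConnected_iff_connectedSpace.1 (isConnected_sphere ?_ 0 zero_le_one)
    rw [← Module.finrank_eq_rank, finrank_euclideanSpace_fin]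
    exact_mod_cast (by omega : 1 < n + 1)
  · -- there are no transversal sections
    intro t' ht' x hx
    refine absurd ?_ (ht' x hx)
    exact ContinuousLinearMap.ext fun v => (OrientedHypersurface.mvfderiv_height_apply (F := F) x
      v).trans (mvfderiv_horizontalMap_snd t x v)
  · have hN : ∀ v, F.dN x v = 0 := fun v => mvfderiv_const_apply _ x v
    have hA : F.shapeOperator x = 0 := LinearMap.ext fun v =>
      OrientedHypersurface.shapeOperator_eq (F := F) (by rw [hN]; simp)
    rw [OrientedHypersurface.meanCurvature, OrientedHypersurface.principalCurvatures, hA,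
      LinearMap.charpoly_zero, Polynomial.roots_pow, Polynomial.roots_X, finrank_euclideanSpace_fin,
      Multiset.nsmul_singleton, esymm_replicate, zero_pow (by omega), mul_zero]

end Horizontal

end Models


/-! ### Complete hypersurfaces contained in the models -/

section Filling

open Set Topology

/-- Two unit vectors can be joined by an arc of a great circle. -/
theorem exists_great_circle_path {m : ℕ} (hm : 2 ≤ m) {u v : EuclideanSpace ℝ (Fin m)}
    (hu : ‖u‖ = 1) (hv : ‖v‖ = 1) :
    ∃ c : ℝ → EuclideanSpace ℝ (Fin m), ContDiff ℝ ∞ c ∧ (∀ t, ‖c t‖ = 1) ∧ c 0 = u ∧ c 1 = v := by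
  obtain ⟨w, hw1, hw2, hw3⟩ : ∃ w : EuclideanSpace ℝ (Fin m), ‖w‖ = 1 ∧ inner ℝ u w = 0 ∧
      v = Real.cos (InnerProductGeometry.angle u v) • u +
        Real.sin (InnerProductGeometry.angle u v) • w := by
    set θ := InnerProductGeometry.angle u v
    have hcos : Real.cos θ = inner ℝ u v := by
      rw [InnerProductGeometry.cos_angle, hu, hv, mul_one, div_one]
    have hsin : 0 ≤ Real.sin θ := InnerProductGeometry.sin_angle_nonneg u v
    set w₀ := v - Real.cos θ • u with hw₀
    have horth : inner ℝ u w₀ = 0 := by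
      rw [hw₀, inner_sub_right, inner_smul_right, hcos, real_inner_self_eq_norm_sq, hu]
      ring
    have hnorm : ‖w₀‖ = Real.sin θ := by
      refine (pow_left_inj₀ (norm_nonneg _) hsin two_ne_zero).1 ?_
      rw [hw₀, norm_sub_sq_real, inner_smul_right, real_inner_comm, ← hcos, norm_smul, hu, hv,
        mul_one, Real.norm_eq_abs, sq_abs, Real.sin_sq]
      ring
    by_cases h0 : Real.sin θ = 0
    · -- any unit vector orthogonal to `u` will do
      obtain ⟨w, hw, hwu⟩ : ∃ w : EuclideanSpace ℝ (Fin m), w ≠ 0 ∧ inner ℝ u w = 0 := by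
        have hfr := Submodule.finrank_add_finrank_orthogonal (ℝ ∙ u)
        rw [finrank_euclideanSpace_fin] at hfr
        have h1 : Module.finrank ℝ (ℝ ∙ u) ≤ 1 :=
          (finrank_span_singleton (K := ℝ) (v := u) (by rintro rfl; simp at hu)).le
        have h2 : (ℝ ∙ u)ᗮ ≠ ⊥ := fun h => by
          rw [h, finrank_bot] at hfr
          omega
        obtain ⟨w, hw, hw0⟩ := Submodule.exists_mem_ne_zero_of_ne_bot h2
        exact ⟨w, hw0, Submodule.mem_orthogonal_singleton_iff_inner_right.1 hw⟩
      refine ⟨‖w‖⁻¹ • w, ?_, ?_, ?_⟩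
      · rw [norm_smul, norm_inv, norm_norm, inv_mul_cancel₀ (norm_ne_zero_iff.2 hw)]
      · rw [inner_smul_right, hwu, mul_zero]
      · rw [h0, zero_smul, add_zero]
        rw [h0, norm_eq_zero] at hnorm
        exact sub_eq_zero.1 hnorm
    · refine ⟨(Real.sin θ)⁻¹ • w₀, ?_, ?_, ?_⟩
      · rw [norm_smul, norm_inv, Real.norm_eq_abs, abs_of_nonneg hsin, hnorm, inv_mul_cancel₀ h0]
      · rw [inner_smul_right, horth, mul_zero]
      · rw [smul_inv_smul₀ h0, hw₀]
        abel
  refine ⟨fun t => Real.cos (InnerProductGeometry.angle u v * t) • u +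
    Real.sin (InnerProductGeometry.angle u v * t) • w, by fun_prop, fun t => ?_, by simp, ?_⟩
  · refine (pow_eq_one_iff_of_nonneg (norm_nonneg _) two_ne_zero).1 ?_
    rw [norm_add_sq_real, inner_smul_left, inner_smul_right, hw2, norm_smul, norm_smul, hu, hw1,
      Real.norm_eq_abs, Real.norm_eq_abs, mul_one, mul_one, sq_abs, sq_abs]
    simp
  · simp only [mul_one]
    exact hw3.symm

variable {n : ℕ}

/-- The condition `g² < 1` keeps away from the axis, where the rotational hypersurface may be
singular. -/
theorem isLocallyZeroSet_of_inner_eq {o : EuclideanSpace ℝ (Fin (n + 1))} (ho : ‖o‖ = 1)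
    {g : ℝ → ℝ} (hg : ContDiff ℝ ∞ g) :
    OrientedHypersurface.IsLocallyZeroSet
      {y : EucProd n | ‖y.fst‖ = 1 ∧ inner ℝ o y.fst = g y.snd ∧ g y.snd ^ 2 < 1} := by
  rintro y ⟨hy1, hy2, hy3⟩
  let P := WithLp.fstL 2 ℝ (EuclideanSpace ℝ (Fin (n + 1))) ℝ
  let T := WithLp.sndL 2 ℝ (EuclideanSpace ℝ (Fin (n + 1))) ℝ
  have hd : HasStrictDerivAt g (deriv g y.snd) (T y) :=
    hg.contDiffAt.hasStrictDerivAt (by simp)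
  have h1 : HasStrictFDerivAt (fun z : EucProd n => (inner ℝ (P z) (P z) : ℝ) - 1) _ y :=
    ((P.hasStrictFDerivAt).inner ℝ P.hasStrictFDerivAt).sub_const 1
  have h2 : HasStrictFDerivAt (fun z : EucProd n => (innerSL ℝ o) (P z) - g (T z)) _ y :=
    (((innerSL ℝ o).comp P).hasStrictFDerivAt).fun_sub
      (hd.comp_hasStrictFDerivAt y T.hasStrictFDerivAt)
  refine ⟨fun z => (inner ℝ (P z) (P z) - 1, (innerSL ℝ o) (P z) - g (T z)), _, h1.prodMk h2, ?_, ?_⟩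
  · rintro ⟨a, b⟩
    have hD : 1 - g y.snd ^ 2 ≠ 0 := by linarith
    -- `p` and `o` are linearly independent
    refine ⟨WithLp.toLp 2 (((a / 2 - b * g y.snd) / (1 - g y.snd ^ 2)) • y.fst +
      ((b - a / 2 * g y.snd) / (1 - g y.snd ^ 2)) • o, 0), ?_⟩
    have e3 : inner ℝ y.fst o = g y.snd := by rw [real_inner_comm, hy2]
    refine Prod.ext ?_ ?_
    · simp [P, T, inner_add_left, inner_add_right, inner_smul_left, inner_smul_right, e3, hy1, hy2, ho]
      field_simp
      ring
    · simp [P, T, inner_add_left, inner_add_right, inner_smul_left, inner_smul_right, e3, hy1, hy2, ho]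
      field_simp
      ring
  · rintro z ⟨hz1, hz2, -⟩
    refine Prod.ext ?_ ?_
    · change inner ℝ z.fst z.fst - 1 = (0 : ℝ)
      rw [real_inner_self_eq_norm_sq, hz1]
      norm_num
    · exact sub_eq_zero.2 hz2

theorem isLocallyZeroSet_horizontalHyperplane (t : ℝ) :
    OrientedHypersurface.IsLocallyZeroSet (horizontalHyperplane n t) := by
  rintro y ⟨hy1, hy2⟩
  have hy1 : ‖y.fst‖ = 1 := hy1
  let P := WithLp.fstL 2 ℝ (EuclideanSpace ℝ (Fin (n + 1))) ℝ
  let T := WithLp.sndL 2 ℝ (EuclideanSpace ℝ (Fin (n + 1))) ℝ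
  have h1 : HasStrictFDerivAt (fun z : EucProd n => (inner ℝ (P z) (P z) : ℝ) - 1) _ y :=
    ((P.hasStrictFDerivAt).inner ℝ P.hasStrictFDerivAt).sub_const 1
  have h2 : HasStrictFDerivAt (fun z : EucProd n => T z - t) T y :=
    T.hasStrictFDerivAt.sub_const t
  refine ⟨fun z => (inner ℝ (P z) (P z) - 1, T z - t), _, h1.prodMk h2, ?_, ?_⟩
  · rintro ⟨a, b⟩
    refine ⟨WithLp.toLp 2 ((a / 2) • y.fst, b), ?_⟩
    refine Prod.ext ?_ ?_
    · simp [P, inner_smul_left, inner_smul_right, hy1]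
    · simp [T]
  · rintro z ⟨hz1, hz2⟩
    have hz1 : ‖z.fst‖ = 1 := hz1
    refine Prod.ext ?_ ?_
    · change inner ℝ z.fst z.fst - 1 = (0 : ℝ)
      rw [real_inner_self_eq_norm_sq, hz1]
      norm_num
    · exact sub_eq_zero.2 hz2

end Filling

namespace OrientedHypersurface

open Set Topology Filter

variable {n : ℕ} {M : Type*} [TopologicalSpace M] [ChartedSpace (EuclideanSpace ℝ (Fin n)) M]
  [IsManifold (𝓡 n) ∞ M] [Nonempty M] {F : OrientedHypersurface n M}
  {o : EuclideanSpace ℝ (Fin (n + 1))}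

/-- A complete hypersurface contained in a horizontal hyperplane is the whole hyperplane. -/
theorem IsComplete.range_eq_horizontalHyperplane (hn : 1 ≤ n) (hF : F.IsComplete) {t : ℝ}
    (h : range F.toFun ⊆ horizontalHyperplane n t) : range F.toFun = horizontalHyperplane n t := by
  refine h.antisymm fun y hy => ?_
  obtain ⟨x⟩ := ‹Nonempty M›
  obtain ⟨hx1, hx2⟩ := h ⟨x, rfl⟩
  obtain ⟨c, hc, hc1, hc0, hc2⟩ := exists_great_circle_path (by omega : 2 ≤ n + 1) hx1 hy.1
  have hγ : ContDiff ℝ 1 fun s => (WithLp.toLp 2 (c s, t) : EucProd n) :=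
    ((WithLp.prodContinuousLinearEquiv 2 ℝ (EuclideanSpace ℝ (Fin (n + 1))) ℝ).symm.contDiff.comp
      (hc.prodMk contDiff_const)).of_le (by norm_cast)
  have := hF.mem_range_of_path (isLocallyZeroSet_horizontalHyperplane t) h hγ
    (fun s _ => ⟨hc1 s, rfl⟩) ⟨x, eucProd_ext hc0.symm hx2⟩
  rwa [show (WithLp.toLp 2 (c 1, t) : EucProd n) = y from eucProd_ext hc2 hy.2.symm] at this

/-- A complete hypersurface contained in a rotational hypersurface is the whole hypersurface. -/
theorem IsComplete.range_eq_rotationalSet (hn : 2 ≤ n) (hF : F.IsComplete) (ho : ‖o‖ = 1) {R : ℝ → ℝ}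
    (hR : ContDiff ℝ ∞ R) (hR0 : ∀ t, R t ∈ Ioo 0 Real.pi)
    (h : ∀ x, inner ℝ o (F.toFun x).fst = Real.cos (R (F.height x))) :
    range F.toFun = rotationalSet o R := by
  have hR1 : ∀ t, R t ∈ Icc 0 Real.pi := fun t => Ioo_subset_Icc_self (hR0 t)
  have hsub : range F.toFun ⊆ rotationalSet o R := by
    rintro _ ⟨x, rfl⟩
    exact (mem_rotationalSet_iff ho hR1).2 ⟨F.mem_sphereProd x, h x⟩
  have hset : rotationalSet o R = {y : EucProd n | ‖y.fst‖ = 1 ∧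
      inner ℝ o y.fst = (fun t => Real.cos (R t)) y.snd ∧ (fun t => Real.cos (R t)) y.snd ^ 2 < 1} := by
    ext y
    rw [mem_rotationalSet_iff ho hR1]
    refine ⟨fun h => ⟨h.1, h.2, ?_⟩, fun h => ⟨h.1, h.2.1⟩⟩
    have := one_sub_cos_sq_add_pos hR0 y.snd 0
    simp only
    linarith
  have hloc : IsLocallyZeroSet (rotationalSet o R) := by
    rw [hset]
    exact isLocallyZeroSet_of_inner_eq ho hR.cos
  refine hsub.antisymm fun y hy => ?_
  obtain ⟨J, hJ, hJ'⟩ := exists_linearIsometry_orthogonal ho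
  have himg := image_rotationalMap (R := R) ho hJ hJ' hR0
  obtain ⟨x⟩ := ‹Nonempty M›
  have hx := hsub ⟨x, rfl⟩
  rw [← himg] at hx hy
  obtain ⟨a, ha, hax⟩ := hx
  obtain ⟨b, hb, rfl⟩ := hy
  have ha' : ‖a‖ ≠ 0 := norm_ne_zero_iff.2 ha
  have hb' : ‖b‖ ≠ 0 := norm_ne_zero_iff.2 hb
  obtain ⟨c, hc, hc1, hc0, hc2⟩ := exists_great_circle_path hn (u := ‖a‖⁻¹ • a) (v := ‖b‖⁻¹ • b)
    (by rw [norm_smul, norm_inv, norm_norm, inv_mul_cancel₀ ha'])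
    (by rw [norm_smul, norm_inv, norm_norm, inv_mul_cancel₀ hb'])
  -- the path in polar coordinates
  let η : ℝ → EuclideanSpace ℝ (Fin n) := fun s =>
    Real.exp ((1 - s) * Real.log ‖a‖ + s * Real.log ‖b‖) • c s
  have hη : ∀ s, η s ≠ 0 := fun s => by
    rw [← norm_ne_zero_iff, norm_smul, hc1, mul_one, Real.norm_eq_abs, Real.abs_exp]
    exact (Real.exp_pos _).ne'
  have hηc : ContDiff ℝ ∞ η := by fun_prop
  have hη0 : η 0 = a := by
    simp only [η, sub_zero, one_mul, zero_mul, add_zero, hc0]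
    rw [Real.exp_log (norm_pos_iff.2 ha), smul_inv_smul₀ ha']
  have hη1 : η 1 = b := by
    simp only [η, sub_self, one_mul, zero_mul, zero_add, hc2]
    rw [Real.exp_log (norm_pos_iff.2 hb), smul_inv_smul₀ hb']
  have hγ : ContDiff ℝ 1 fun s => rotationalMap o J R (η s) := contDiff_iff_contDiffAt.2 fun s =>
    (ContDiffAt.comp (g := rotationalMap o J R) s (contDiffAt_rotationalMap hR (hη s))
      hηc.contDiffAt).of_le (by norm_cast)
  have := hF.mem_range_of_path hloc hsub hγ
    (fun s _ => himg ▸ mem_image_of_mem _ (hη s)) ⟨x, by rw [hη0, hax]⟩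
  rwa [hη1] at this

end OrientedHypersurface


/-! ### Unique continuation of profiles -/

section ProfileUniqueness

open Filter Topology

variable {n r : ℕ}

/-- The equation `profileOp = 0`, as a first order system for `(g, g')`. -/
noncomputable def profileField (n r : ℕ) (z : ℝ × ℝ) : ℝ × ℝ :=
  (z.2, z.1 - n / r * (z.1 * (1 - z.1 ^ 2 + z.2 ^ 2) / (1 - z.1 ^ 2)))

theorem hasDerivAt_prodMk_deriv {g : ℝ → ℝ} {t : ℝ} (hr : 1 ≤ r) (hg : ContDiffAt ℝ ∞ g t)
    (hlt : g t ^ 2 < 1) (hop : profileOp n r g t = 0) :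
    HasDerivAt (fun s => (g s, deriv g s)) (profileField n r (g t, deriv g t)) t := by
  have h1 : HasDerivAt g (deriv g t) t := (hg.differentiableAt (by simp)).hasDerivAt
  have hr' : (r : ℝ) ≠ 0 := by exact_mod_cast (by omega : r ≠ 0)
  have hA : 1 - g t ^ 2 ≠ 0 := by linarith
  have h2 : deriv (deriv g) t =
      g t - n / r * (g t * (1 - g t ^ 2 + deriv g t ^ 2) / (1 - g t ^ 2)) := by
    unfold profileOp at hop
    field_simp
    linarith
  have h3 := h1.prodMk hg.hasDerivAt_deriv
  rw [h2] at h3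
  exact h3

/-- A profile is determined by its value and its slope at a point. -/
theorem eventuallyEq_of_profileOp_eq_zero {g G : ℝ → ℝ} {t : ℝ} (hr : 1 ≤ r)
    (hg : ∀ᶠ s in 𝓝 t, ContDiffAt ℝ ∞ g s) (hG : ∀ᶠ s in 𝓝 t, ContDiffAt ℝ ∞ G s)
    (hgo : ∀ᶠ s in 𝓝 t, profileOp n r g s = 0) (hGo : ∀ᶠ s in 𝓝 t, profileOp n r G s = 0)
    (hlt : g t ^ 2 < 1) (h0 : g t = G t) (h1 : deriv g t = deriv G t) : g =ᶠ[𝓝 t] G := by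
  have hc : ContDiffAt ℝ 1 (profileField n r) (g t, deriv g t) := by
    have hA : 1 - g t ^ 2 ≠ 0 := by linarith
    unfold profileField
    refine contDiffAt_snd.prodMk (contDiffAt_fst.sub (contDiffAt_const.mul (ContDiffAt.div ?_ ?_ hA)))
    · fun_prop
    · fun_prop
  obtain ⟨K, S, hS, hK⟩ := hc.exists_lipschitzOnWith
  have key : ∀ u : ℝ → ℝ, (∀ᶠ s in 𝓝 t, ContDiffAt ℝ ∞ u s) → (∀ᶠ s in 𝓝 t, profileOp n r u s = 0) →
      u t = g t → deriv u t = deriv g t → ∀ᶠ s in 𝓝 t,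
        HasDerivAt (fun s => (u s, deriv u s)) (profileField n r (u s, deriv u s)) s ∧
          (u s, deriv u s) ∈ S := by
    intro u hu huo e0 e1
    have hut := hu.self_of_nhds
    have c1 : ContinuousAt (fun s => (u s, deriv u s)) t :=
      hut.continuousAt.prodMk hut.hasDerivAt_deriv.continuousAt
    have c2 : ∀ᶠ s in 𝓝 t, (u s, deriv u s) ∈ S := by
      refine c1.eventually_mem ?_
      simp only [e0, e1]
      exact hS
    have c3 : ∀ᶠ s in 𝓝 t, u s ^ 2 < 1 :=
      (hut.continuousAt.pow 2).eventually_lt_const (by rwa [Pi.pow_apply, e0])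
    filter_upwards [hu, huo, c2, c3] with s a1 a2 a3 a4
    exact ⟨hasDerivAt_prodMk_deriv hr a1 a4 a2, a3⟩
  have := ODE_solution_unique_of_eventually (v := fun _ => profileField n r) (s := fun _ => S)
    (Eventually.of_forall fun _ => hK) (key g hg hgo rfl rfl) (key G hG hGo h0.symm h1.symm)
    (by rw [h0, h1])
  filter_upwards [this] with s hs using congrArg Prod.fst hs

end ProfileUniqueness

namespace OrientedHypersurface

open Set Topology Filter

variable {n : ℕ} {M : Type*} [TopologicalSpace M] [ChartedSpace (EuclideanSpace ℝ (Fin n)) M]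
  {F : OrientedHypersurface n M} {o : EuclideanSpace ℝ (Fin (n + 1))} {r : ℕ} {g G : ℝ → ℝ} {x : M}

theorem HasProfileAt.congr (h : F.HasProfileAt o g x) (hG : ContDiff ℝ ∞ G)
    (he : g =ᶠ[𝓝 (F.height x)] G) : F.HasProfileAt o G x where
  eventually_contDiffAt := Eventually.of_forall fun _ => hG.contDiffAt
  eventually_eq := by
    filter_upwards [h.eventually_eq, continuous_height.continuousAt.eventually he] with y a b
    rw [a, b]
  exists_snd_ne := h.exists_snd_ne
  sq_lt_one := by
    rw [← he.self_of_nhds]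
    exact h.sq_lt_one

theorem HasProfileAt.eq_and_deriv_eq [IsManifold (𝓡 n) ∞ M] (h : F.HasProfileAt o g x)
    (h' : F.HasProfileAt o G x) :
    g (F.height x) = G (F.height x) ∧ deriv g (F.height x) = deriv G (F.height x) := by
  refine ⟨h.eventually_eq.self_of_nhds.symm.trans h'.eventually_eq.self_of_nhds, ?_⟩
  obtain ⟨v, hv⟩ := h.exists_snd_ne
  have h1 := inner_dF_of_eventually_eq (h.contDiffAt.differentiableAt (by simp)) h.eventually_eq v
  have h2 := inner_dF_of_eventually_eq (h'.contDiffAt.differentiableAt (by simp)) h'.eventually_eq v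
  exact mul_right_cancel₀ hv (h1.symm.trans h2)

/-- Unique continuation: a solution of the profile equation that is tangent to a local profile is a
global profile. -/
theorem hasProfileAt_of_tangent [IsManifold (𝓡 n) ∞ M] [PreconnectedSpace M] (hr : 1 ≤ r)
    (hrn : r ≤ n) (ho : ‖o‖ = 1) (hF : F.IsMinimal r)
    (hprof : ∀ x, ∃ g, F.HasProfileAt o g x)
    (hne : ∀ x g, F.HasProfileAt o g x → g (F.height x) ≠ 0 ∨ deriv g (F.height x) ≠ 0)
    (hG : ContDiff ℝ ∞ G) (hop : ∀ t, profileOp n r G t = 0) (hg : F.HasProfileAt o g x)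
    (h0 : g (F.height x) = G (F.height x)) (h1 : deriv g (F.height x) = deriv G (F.height x))
    (y : M) : F.HasProfileAt o G y := by
  have key : ∀ (x : M) (g : ℝ → ℝ), F.HasProfileAt o g x → g (F.height x) = G (F.height x) →
      deriv g (F.height x) = deriv G (F.height x) → F.HasProfileAt o G x := by
    intro x g hg h0 h1
    refine hg.congr hG (eventuallyEq_of_profileOp_eq_zero (n := n) hr hg.eventually_contDiffAt
      (Eventually.of_forall fun _ => hG.contDiffAt) ?_ (Eventually.of_forall hop) hg.sq_lt_one h0 h1)
    have e1 := (hg.eventually_profileOp ho hr hrn hF).eventually_nhds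
    have e2 : ∀ᶠ t in 𝓝 (F.height x), g t ≠ 0 ∨ deriv g t ≠ 0 := by
      rcases hne x g hg with h | h
      · filter_upwards [hg.contDiffAt.continuousAt.eventually_ne h] with t ht using Or.inl ht
      · filter_upwards [hg.contDiffAt.hasDerivAt_deriv.continuousAt.eventually_ne h] with t ht
          using Or.inr ht
    filter_upwards [e1, e2, hg.eventually_contDiffAt] with t a b c
    exact profileOp_eq_zero c a b
  have hopen : IsOpen {x | F.HasProfileAt o G x} := isOpen_iff_mem_nhds.2 fun x hx => hx.eventually
  have hclosed : IsClosed {x | F.HasProfileAt o G x} := by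
    refine isClosed_iff_frequently.2 fun x hx => ?_
    obtain ⟨g, hg⟩ := hprof x
    have hfr := hx.and_eventually hg.eventually
    have hh : ContinuousAt F.height x := continuous_height.continuousAt
    refine key x g hg ?_ ?_
    · by_contra hcon
      have hc : ∀ᶠ y in 𝓝 x, g (F.height y) - G (F.height y) ≠ 0 :=
        ((hg.contDiffAt.continuousAt.comp hh).sub
          (hG.continuous.continuousAt.comp hh)).eventually_ne (sub_ne_zero.2 hcon)
      obtain ⟨y, ⟨hy1, hy2⟩, hy3⟩ := (hfr.and_eventually hc).exists
      exact hy3 (sub_eq_zero.2 (hy2.eq_and_deriv_eq hy1).1)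
    · by_contra hcon
      have hc : ∀ᶠ y in 𝓝 x, deriv g (F.height y) - deriv G (F.height y) ≠ 0 :=
        ((ContinuousAt.comp (f := F.height) hg.contDiffAt.hasDerivAt_deriv.continuousAt hh).sub
          (ContinuousAt.comp (f := F.height) hG.contDiffAt.hasDerivAt_deriv.continuousAt
            hh)).eventually_ne (sub_ne_zero.2 hcon)
      obtain ⟨y, ⟨hy1, hy2⟩, hy3⟩ := (hfr.and_eventually hc).exists
      exact hy3 (sub_eq_zero.2 (hy2.eq_and_deriv_eq hy1).2)
  have huniv := IsClopen.eq_univ ⟨hclosed, hopen⟩ ⟨x, key x g hg h0 h1⟩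
  have hy : y ∈ {x | F.HasProfileAt o G x} := huniv ▸ mem_univ y
  exact hy

theorem HasProfileAt.energy_pos [IsManifold (𝓡 n) ∞ M] (ho : ‖o‖ = 1) (h : F.HasProfileAt o g x) :
    0 < F.energy o r x := by
  rw [h.energy_eq ho, profileEnergy]
  have := h.sq_lt_one
  have h1 : 0 < 1 - g (F.height x) ^ 2 := by linarith
  positivity

theorem energy_le_one (ho : ‖o‖ = 1) (x : M) : F.energy o r x ≤ 1 := by
  have h1 := sq_normal_snd_le_one (F := F) x
  have h2 := sq_axisInner_le_one (F := F) ho x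
  refine mul_le_one₀ (pow_le_one₀ (by linarith) ?_) (pow_nonneg (by linarith) _)
    (pow_le_one₀ (by linarith) ?_)
  · linarith [sq_nonneg (F.normal x).snd]
  · linarith [sq_nonneg (inner ℝ o (F.toFun x).fst)]

/-- Without points where the height is regular, the height is constant. -/
theorem height_const_of_not_regular [IsManifold (𝓡 n) ∞ M] [PreconnectedSpace M]
    (h : ∀ x, ¬ ∃ v, (F.dF x v).snd ≠ 0) (x y : M) : F.height x = F.height y := by
  refine eq_of_mvfderiv_eq_zero contMDiff_height (fun z => ?_) x y
  refine ContinuousLinearMap.ext fun v => (mvfderiv_height_apply z v).trans ?_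
  by_contra hv
  exact h z ⟨v, hv⟩

/-- The slope of the profile, in terms of the normal. -/
theorem HasProfileAt.deriv_eq_zero_of_normal [IsManifold (𝓡 n) ∞ M] (ho : ‖o‖ = 1)
    (h : F.HasProfileAt o g x) (h0 : (F.normal x).snd = 0) : deriv g (F.height x) = 0 := by
  have := h.one_sub_sq_normal ho
  rw [h0] at this
  have h1 : deriv g (F.height x) ^ 2 = 0 := by linarith
  exact pow_eq_zero_iff two_ne_zero |>.1 h1

end OrientedHypersurface


/-! ### Classification -/

theorem profileOp_comp_add_const (n r : ℕ) (g : ℝ → ℝ) (τ t : ℝ) :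
    profileOp n r (fun s => g (s + τ)) t = profileOp n r g (t + τ) := by
  have h1 : deriv (fun s => g (s + τ)) = fun s => deriv g (s + τ) :=
    funext fun s => deriv_comp_add_const g τ s
  simp only [profileOp, h1, deriv_comp_add_const]

/-- For `r = n`, the solutions of the profile equation are the profiles of the cones over the
geodesic spheres, where the radius is an affine function of the height. -/
theorem profileOp_cos_affine (n : ℕ) (ψ s t₀ t : ℝ) :
    profileOp n n (fun t => Real.cos (ψ + s * (t - t₀))) t = 0 := by
  have h1 : ∀ t, HasDerivAt (fun t => ψ + s * (t - t₀)) s t := fun t => by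
    simpa using (((hasDerivAt_id t).sub_const t₀).const_mul s).const_add ψ
  have h2 : deriv (fun t => Real.cos (ψ + s * (t - t₀))) =
      fun t => -Real.sin (ψ + s * (t - t₀)) * s := funext fun t => (h1 t).cos.deriv
  have h3 : deriv (fun t => -Real.sin (ψ + s * (t - t₀)) * s) t =
      -(Real.cos (ψ + s * (t - t₀)) * s) * s := ((h1 t).sin.neg.mul_const s).deriv
  simp only [profileOp, h2, h3]
  have h4 := Real.sin_sq_add_cos_sq (ψ + s * (t - t₀))
  linear_combination (n * s ^ 2 * Real.cos (ψ + s * (t - t₀))) * h4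

theorem exists_sin_sq_pow_eq {k : ℕ} (hk : k ≠ 0) {Q : ℝ} (h0 : 0 < Q) (h1 : Q < 1) :
    ∃ a ∈ Set.Ioo 0 (Real.pi / 2), (Real.sin a ^ 2) ^ k = Q := by
  have hq0 : 0 < Q ^ ((k : ℝ)⁻¹) := Real.rpow_pos_of_pos h0 _
  have hq1 : Q ^ ((k : ℝ)⁻¹) < 1 := Real.rpow_lt_one h0.le h1 (by positivity)
  have hs0 : 0 < √(Q ^ ((k : ℝ)⁻¹)) := Real.sqrt_pos.2 hq0
  have hs1 : √(Q ^ ((k : ℝ)⁻¹)) < 1 := by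
    rw [Real.sqrt_lt' one_pos]
    simpa using hq1
  refine ⟨Real.arcsin √(Q ^ ((k : ℝ)⁻¹)), ⟨Real.arcsin_pos.2 hs0, ?_⟩, ?_⟩
  · exact Real.arcsin_lt_pi_div_two.2 hs1
  · rw [Real.sin_arcsin (by linarith) hs1.le, Real.sq_sqrt hq0.le, Real.rpow_inv_natCast_pow h0.le hk]

theorem eq_one_of_pow_mul_pow_eq_one {a b : ℝ} {k l : ℕ} (hk : k ≠ 0) (ha : 0 ≤ a) (ha1 : a ≤ 1)
    (hb : 0 ≤ b) (hb1 : b ≤ 1) (h : a ^ k * b ^ l = 1) : a = 1 := by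
  by_contra hne
  have h1 : a ^ k < 1 := pow_lt_one₀ ha (lt_of_le_of_ne ha1 hne) hk
  have h2 : b ^ l ≤ 1 := pow_le_one₀ hb hb1
  have h3 : a ^ k * b ^ l ≤ a ^ k := mul_le_of_le_one_right (pow_nonneg ha k) h2
  linarith

namespace OrientedHypersurface

open Set Topology Filter

variable {n : ℕ} {M : Type*} [TopologicalSpace M] [ChartedSpace (EuclideanSpace ℝ (Fin n)) M]
  {F : OrientedHypersurface n M} {o : EuclideanSpace ℝ (Fin (n + 1))} {r : ℕ} {g G : ℝ → ℝ} {x : M}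

/-- If the normal is horizontal, all profiles have slope `0` and the hypersurface is a cylinder. -/
theorem IsComplete.range_eq_cylinder [IsManifold (𝓡 n) ∞ M] [PreconnectedSpace M] (hn : 2 ≤ n)
    (ho : ‖o‖ = 1) (hc : F.IsComplete) (hprof : ∀ x, ∃ g, F.HasProfileAt o g x)
    (hslope : ∀ x, (F.normal x).snd = 0) (x : M) :
    Real.arccos (inner ℝ o (F.toFun x).fst) ∈ Ioo 0 Real.pi ∧
      range F.toFun = cylinder o (Real.arccos (inner ℝ o (F.toFun x).fst)) := by
  have : Nonempty M := ⟨x⟩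
  have hconst : ∀ y, inner ℝ o (F.toFun y).fst = inner ℝ o (F.toFun x).fst := fun y => by
    refine eq_of_mvfderiv_eq_zero (contMDiff_axisInner o) (fun z => ?_) y x
    refine ContinuousLinearMap.ext fun v => (mvfderiv_clm_comp F.contMDiff_toFun
      ((innerSL ℝ o).comp (WithLp.fstL 2 ℝ _ _)) z v).trans ?_
    obtain ⟨g, hg⟩ := hprof z
    refine (inner_dF_of_eventually_eq (hg.contDiffAt.differentiableAt (by simp)) hg.eventually_eq
      v).trans ?_
    rw [hg.deriv_eq_zero_of_normal ho (hslope z), zero_mul]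
    rfl
  obtain ⟨g, hg⟩ := hprof x
  have hlt := hg.sq_lt_one
  rw [← hg.eventually_eq.self_of_nhds] at hlt
  obtain ⟨h1, h2⟩ := abs_lt.1 ((sq_lt_one_iff_abs_lt_one _).1 hlt)
  have hmem : Real.arccos (inner ℝ o (F.toFun x).fst) ∈ Ioo 0 Real.pi := by
    refine ⟨Real.arccos_pos.2 h2, lt_of_le_of_ne (Real.arccos_le_pi _) fun h => ?_⟩
    rw [Real.arccos_eq_pi] at h
    linarith
  exact ⟨hmem, hc.range_eq_rotationalSet hn ho contDiff_const (fun _ => hmem) fun y => by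
    rw [Real.cos_arccos h1.le h2.le, hconst]⟩

/-- For `r = n`, a hypersurface whose meridians are not vertical cannot be complete: its meridians
reach the axis in finite time. -/
theorem IsComplete.deriv_eq_zero_of_eq [IsManifold (𝓡 n) ∞ M] [PreconnectedSpace M] (hn : 1 ≤ n)
    (ho : ‖o‖ = 1) (hc : F.IsComplete) (hF : F.IsMinimal n)
    (hprof : ∀ x, ∃ g, F.HasProfileAt o g x)
    (hne : ∀ x g, F.HasProfileAt o g x → g (F.height x) ≠ 0 ∨ deriv g (F.height x) ≠ 0)
    (hg : F.HasProfileAt o g x) : deriv g (F.height x) = 0 := by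
  by_contra hd
  set t₀ := F.height x
  obtain ⟨h1, h2⟩ := abs_lt.1 ((sq_lt_one_iff_abs_lt_one _).1 hg.sq_lt_one)
  set ψ := Real.arccos (g t₀)
  have hψ0 : 0 < ψ := Real.arccos_pos.2 h2
  have hψ1 : ψ < Real.pi := lt_of_le_of_ne (Real.arccos_le_pi _) fun h => by
    rw [Real.arccos_eq_pi] at h
    linarith
  have hcos : Real.cos ψ = g t₀ := Real.cos_arccos h1.le h2.le
  have hsin : 0 < Real.sin ψ := Real.sin_pos_of_pos_of_lt_pi hψ0 hψ1
  -- `cos (ψ + s (t - t₀))` is tangent to `g` at `t₀`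
  set s := -deriv g t₀ / Real.sin ψ with hs
  have hs0 : s ≠ 0 := div_ne_zero (neg_ne_zero.2 hd) hsin.ne'
  set G : ℝ → ℝ := fun t => Real.cos (ψ + s * (t - t₀)) with hGdef
  have hG : ContDiff ℝ ∞ G := by fun_prop
  have hG0 : G t₀ = g t₀ := by simp [hGdef, hcos]
  have hG1 : deriv G t₀ = deriv g t₀ := by
    have h1 : HasDerivAt (fun t => ψ + s * (t - t₀)) s t₀ := by
      simpa using (((hasDerivAt_id t₀).sub_const t₀).const_mul s).const_add ψ
    rw [h1.cos.deriv, sub_self, mul_zero, add_zero, hs]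
    field_simp
  have hall := hasProfileAt_of_tangent hn le_rfl ho hF hprof hne hG
    (profileOp_cos_affine n ψ s t₀) hg hG0.symm hG1.symm
  set S := {y : EucProd n | ‖y.fst‖ = 1 ∧ inner ℝ o y.fst = G y.snd ∧ G y.snd ^ 2 < 1}
  have hsub : range F.toFun ⊆ S := by
    rintro _ ⟨y, rfl⟩
    exact ⟨F.mem_sphereProd y, (hall y).eventually_eq.self_of_nhds, (hall y).sq_lt_one⟩
  -- the meridian through `F x`, up to the axis, which is reached at radius `π`
  have hf : inner ℝ o (F.toFun x).fst = Real.cos ψ := by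
    rw [hcos]
    exact hg.eventually_eq.self_of_nhds
  have hp : ‖(F.toFun x).fst‖ = 1 := F.mem_sphereProd x
  set u := (Real.sin ψ)⁻¹ • ((F.toFun x).fst - Real.cos ψ • o) with hu
  have hou : inner ℝ o u = 0 := by
    rw [hu, inner_smul_right, inner_sub_right, inner_smul_right, hf, real_inner_self_eq_norm_sq, ho]
    ring
  have hun : ‖u‖ = 1 := by
    have h3 : ‖(F.toFun x).fst - Real.cos ψ • o‖ = Real.sin ψ := by
      refine (pow_left_inj₀ (norm_nonneg _) hsin.le two_ne_zero).1 ?_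
      rw [norm_sub_sq_real, inner_smul_right, real_inner_comm, hf, norm_smul, hp, ho, mul_one,
        Real.norm_eq_abs, sq_abs, Real.sin_sq]
      ring
    rw [hu, norm_smul, h3, norm_inv, Real.norm_eq_abs, abs_of_pos hsin, inv_mul_cancel₀ hsin.ne']
  let α : ℝ → ℝ := fun τ => ψ + τ * (Real.pi - ψ)
  let γ : ℝ → EucProd n := fun τ =>
    WithLp.toLp 2 (Real.cos (α τ) • o + Real.sin (α τ) • u, t₀ + τ * (Real.pi - ψ) / s)
  have hγ : ContDiff ℝ 1 γ := by
    have h3 : ContDiff ℝ 1 fun τ => (Real.cos (α τ) • o + Real.sin (α τ) • u,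
        t₀ + τ * (Real.pi - ψ) / s) := by fun_prop
    exact (WithLp.prodContinuousLinearEquiv 2 ℝ (EuclideanSpace ℝ (Fin (n + 1))) ℝ).symm.contDiff.comp
      h3
  have hGγ : ∀ τ, G (γ τ).snd = Real.cos (α τ) := fun τ => by
    have : ψ + s * (t₀ + τ * (Real.pi - ψ) / s - t₀) = α τ := by
      simp only [α]
      field_simp
      ring
    change Real.cos (ψ + s * (t₀ + τ * (Real.pi - ψ) / s - t₀)) = _
    rw [this]
  have hinn : ∀ τ, inner ℝ o (γ τ).fst = Real.cos (α τ) := fun τ => by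
    change inner ℝ o (Real.cos (α τ) • o + Real.sin (α τ) • u) = _
    rw [inner_add_right, inner_smul_right, inner_smul_right, hou, real_inner_self_eq_norm_sq, ho]
    ring
  have hnorm : ∀ τ, ‖(γ τ).fst‖ = 1 := fun τ => by
    change ‖Real.cos (α τ) • o + Real.sin (α τ) • u‖ = _
    refine (pow_eq_one_iff_of_nonneg (norm_nonneg _) two_ne_zero).1 ?_
    rw [norm_add_sq_real, inner_smul_left, inner_smul_right, hou, norm_smul, norm_smul, ho, hun,
      Real.norm_eq_abs, Real.norm_eq_abs, mul_one, mul_one, sq_abs, sq_abs]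
    simp
  obtain ⟨y, hy⟩ := hc.mem_range_of_path (isLocallyZeroSet_of_inner_eq ho hG) hsub hγ
    (fun τ hτ => ⟨hnorm τ, by rw [hinn, hGγ], by
      have h4 : 0 < Real.sin (α τ) := by
        have h5 : 0 < Real.pi - ψ := by linarith
        refine Real.sin_pos_of_pos_of_lt_pi ?_ ?_
        · have := mul_nonneg hτ.1 h5.le
          simp only [α]
          linarith
        · have := mul_lt_mul_of_pos_right hτ.2 h5
          simp only [α]
          linarith
      rw [hGγ, Real.cos_sq']
      have := pow_pos h4 2
      linarith⟩)
    ⟨x, eucProd_ext (by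
      change _ = Real.cos (α 0) • o + Real.sin (α 0) • u
      simp only [α, zero_mul, add_zero]
      rw [hu, smul_inv_smul₀ hsin.ne']
      abel) (by
      change t₀ = t₀ + 0 * (Real.pi - ψ) / s
      simp)⟩
  have hlt : G (F.toFun y).snd ^ 2 < 1 := (hall y).sq_lt_one
  rw [hy, hGγ] at hlt
  -- at the end of the meridian `cos (α 1) = cos π = -1`
  simp [α] at hlt

/-- The complete rotational `r`-minimal hypersurfaces. Here `U a` stands for the unduloid with neck
radius `a`, of which only the properties provided by `exists_isUnduloidProfile` are used. -/
theorem IsComplete.classification [IsManifold (𝓡 n) ∞ M] [SecondCountableTopology M]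
    [ConnectedSpace M] (hn : 2 ≤ n) (hr : 1 ≤ r) (hrn : r ≤ n) (ho : ‖o‖ = 1) (hc : F.IsComplete)
    (hrot : F.IsRotationalAbout o) (hF : F.IsMinimal r) {U : ℝ → ℝ → ℝ}
    (hU : r < n → ∀ a ∈ Ioo 0 (Real.pi / 2), ContDiff ℝ ∞ (U a) ∧ (∀ t, U a t ∈ Ioo 0 Real.pi) ∧
      (∀ t, profileOp n r (fun t => Real.cos (U a t)) t = 0) ∧ ∀ x y, x ^ 2 < 1 →
        ((1 - x ^ 2) / (1 - x ^ 2 + y ^ 2)) ^ r * (1 - x ^ 2) ^ (n - r) =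
          (Real.sin a ^ 2) ^ (n - r) →
        ∃ t, Real.cos (U a t) = x ∧ deriv (fun t => Real.cos (U a t)) t = y) :
    (∃ t, range F.toFun = horizontalHyperplane n t) ∨
      (r = n ∧ ∃ a ∈ Ioo 0 Real.pi, range F.toFun = cylinder o a) ∨
      (r < n ∧ range F.toFun = cylinder o (Real.pi / 2)) ∨
      (r < n ∧ ∃ a ∈ Ioo 0 (Real.pi / 2), ∃ τ, range F.toFun = rotationalSet o fun t => U a (t + τ)) := by
  by_cases hreg : ∀ x, ¬ ∃ v, (F.dF x v).snd ≠ 0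
  · obtain ⟨x⟩ := (inferInstance : Nonempty M)
    refine Or.inl ⟨F.height x, hc.range_eq_horizontalHyperplane (by omega) ?_⟩
    rintro _ ⟨y, rfl⟩
    exact ⟨F.mem_sphereProd y, height_const_of_not_regular hreg y x⟩
  right
  push Not at hreg
  obtain ⟨x, hx⟩ := hreg
  obtain ⟨g, hg⟩ := hrot.exists_hasProfileAt hn ho hx
  have hQ : ∀ y, F.energy o r y = F.energy o r x := fun y =>
    energy_const hn hr hrn ho hrot hF y x
  have hpos : 0 < F.energy o r x := hg.energy_pos ho
  -- the energy vanishes at the points where the height is not regular, so there are none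
  have hprof : ∀ y, ∃ g, F.HasProfileAt o g y := fun y =>
    hrot.exists_hasProfileAt hn ho ((dF_snd_ne_zero_iff y).2 fun h => by
      have := hQ y
      rw [energy, h, sub_self, zero_pow (by omega), zero_mul] at this
      exact hpos.ne this)
  rcases (energy_le_one ho x).lt_or_eq with hlt | heq
  · -- where `g = g' = 0`, the energy would be `1`
    have hne : ∀ y g, F.HasProfileAt o g y → g (F.height y) ≠ 0 ∨ deriv g (F.height y) ≠ 0 := by
      intro y g hg
      by_contra! h
      have := hg.energy_eq (r := r) ho
      rw [hQ, profileEnergy, h.1, h.2] at this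
      norm_num at this
      exact hlt.ne this
    rcases hrn.lt_or_eq with hrn' | rfl
    · -- the unduloid with the same first integral, translated to have the same slope
      refine Or.inr (Or.inr ⟨hrn', ?_⟩)
      obtain ⟨a, ha, hQa⟩ := exists_sin_sq_pow_eq (by omega : n - r ≠ 0) hpos hlt
      obtain ⟨hU1, hU2, hU3, hU4⟩ := hU hrn' a ha
      obtain ⟨t₁, ht1, ht2⟩ := hU4 (g (F.height x)) (deriv g (F.height x)) hg.sq_lt_one (by
        rw [hQa, hg.energy_eq ho]
        rfl)
      refine ⟨a, ha, t₁ - F.height x, hc.range_eq_rotationalSet hn ho (hU1.comp (by fun_prop))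
        (fun t => hU2 _) fun y => ?_⟩
      have := hasProfileAt_of_tangent (G := fun t => Real.cos (U a (t + (t₁ - F.height x)))) hr hrn
        ho hF hprof hne ((hU1.comp (by fun_prop : ContDiff ℝ ∞ fun t => t + (t₁ - F.height x))).cos)
        (fun t => by
          rw [profileOp_comp_add_const n r (fun t => Real.cos (U a t))]
          exact hU3 _) hg
        (by simp only [add_sub_cancel, ht1])
        (by rw [deriv_comp_add_const (fun t => Real.cos (U a t)), add_sub_cancel, ht2]) y
      exact this.eventually_eq.self_of_nhds
    · exfalso
      have h0 := hc.deriv_eq_zero_of_eq (by omega) ho hF hprof hne hg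
      have := hg.energy_eq (r := r) ho
      have hA : 1 - g (F.height x) ^ 2 ≠ 0 := by linarith [hg.sq_lt_one]
      rw [profileEnergy, h0] at this
      norm_num [hA] at this
      exact hlt.ne this
  · have hE : ∀ y, (1 - (F.normal y).snd ^ 2) ^ r *
        (1 - (inner ℝ o (F.toFun y).fst) ^ 2) ^ (n - r) = 1 := fun y => (hQ y).trans heq
    have hν : ∀ y, (F.normal y).snd = 0 := fun y => by
      have h1 := sq_normal_snd_le_one (F := F) y
      have h2 := sq_axisInner_le_one (F := F) ho y
      have := eq_one_of_pow_mul_pow_eq_one (by omega) (by linarith)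
        (by linarith [sq_nonneg (F.normal y).snd]) (by linarith)
        (by linarith [sq_nonneg (inner ℝ o (F.toFun y).fst)]) (hE y)
      exact pow_eq_zero_iff two_ne_zero |>.1 (by linarith)
    obtain ⟨h1, h2⟩ := hc.range_eq_cylinder hn ho hprof hν x
    rcases hrn.lt_or_eq with hrn' | rfl
    · refine Or.inr (Or.inl ⟨hrn', ?_⟩)
      have h3 := hE x
      rw [hν x] at h3
      have h4 := sq_axisInner_le_one (F := F) ho x
      have h5 : (1 - (inner ℝ o (F.toFun x).fst) ^ 2) = 1 := by
        refine eq_one_of_pow_mul_pow_eq_one (b := 1) (l := 0) (by omega : n - r ≠ 0) (by linarith)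
          (by linarith [sq_nonneg (inner ℝ o (F.toFun x).fst)]) zero_le_one le_rfl ?_
        simpa using h3
      have h6 : inner ℝ o (F.toFun x).fst = 0 := pow_eq_zero_iff two_ne_zero |>.1 (by linarith)
      rw [h2, h6, Real.arccos_zero]
    · exact Or.inl ⟨rfl, _, h1, h2⟩

end OrientedHypersurface


/-! ### Ambient isometries and the classification up to congruence -/

section AmbientIsometries

open Set

variable {n : ℕ}

theorem exists_linearIsometryEquiv_apply_eq {E : Type*} [NormedAddCommGroup E]
    [InnerProductSpace ℝ E] {v w : E} (h : ‖v‖ = ‖w‖) : ∃ L : E ≃ₗᵢ[ℝ] E, L v = w :=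
  ⟨_, Submodule.reflection_sub h⟩

theorem image_ambientIsometry_rotationalSet
    (L : EuclideanSpace ℝ (Fin (n + 1)) ≃ₗᵢ[ℝ] EuclideanSpace ℝ (Fin (n + 1)))
    (o : EuclideanSpace ℝ (Fin (n + 1))) (R : ℝ → ℝ) (c : ℝ) :
    ambientIsometry L (IsometryEquiv.addRight c) '' rotationalSet o R =
      rotationalSet (L o) fun t => R (t - c) := by
  ext y
  constructor
  · rintro ⟨x, ⟨h1, h2⟩, rfl⟩
    refine ⟨(L.norm_map x.fst).trans h1, ?_⟩
    change InnerProductGeometry.angle (L o) (L x.fst) = R (x.snd + c - c)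
    rw [add_sub_cancel_right, ← h2]
    exact L.toLinearIsometry.angle_map _ _
  · rintro ⟨h1, h2⟩
    refine ⟨WithLp.toLp 2 (L.symm y.fst, y.snd - c), ⟨?_, ?_⟩, ?_⟩
    · exact (L.symm.norm_map y.fst).trans h1
    · change InnerProductGeometry.angle o (L.symm y.fst) = R (y.snd - c)
      rw [← L.toLinearIsometry.angle_map]
      simpa using h2
    · refine eucProd_ext (L.apply_symm_apply y.fst) ?_
      change y.snd - c + c = y.snd
      ring

theorem image_ambientIsometry_horizontalHyperplane (t : ℝ) :
    ambientIsometry (LinearIsometryEquiv.refl ℝ _) (IsometryEquiv.addRight t) ''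
      horizontalHyperplane n 0 = horizontalHyperplane n t := by
  ext y
  constructor
  · rintro ⟨x, ⟨h1, h2⟩, rfl⟩
    refine ⟨h1, ?_⟩
    change x.snd + t = t
    rw [h2, zero_add]
  · rintro ⟨h1, h2⟩
    refine ⟨WithLp.toLp 2 (y.fst, 0), ⟨h1, rfl⟩, eucProd_ext rfl ?_⟩
    exact (zero_add t).trans h2.symm

theorem profileOp_const (n r : ℕ) (c t : ℝ) :
    profileOp n r (fun _ => c) t = (n - r) * c * (1 - c ^ 2) := by
  simp only [profileOp, deriv_const']
  ring

end AmbientIsometries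

theorem mainTheorem10 (n r : ℕ) (hn : 2 ≤ n) (hr : 1 ≤ r) (hrn : r ≤ n)
    (o : EuclideanSpace ℝ (Fin (n + 1))) (ho : ‖o‖ = 1) :
    ∃ S : ℝ → Set (EucProd n),
      (∀ a ∈ Set.Ioo 0 (parameterBound n r),
        IsCompleteRotationalMinimal n r o (S a) ∧ IsAnnulus n (S a) ∧
        (r = n → S a = cylinder o a) ∧
        (r < n → IsDelaunayType o a (S a))) ∧
      (∀ t, IsCompleteRotationalMinimal n r o (horizontalHyperplane n t)) ∧
      IsCompleteRotationalMinimal n r o (cylinder o (Real.pi / 2)) ∧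
      ∀ (M : Type*) [TopologicalSpace M] [ChartedSpace (EuclideanSpace ℝ (Fin n)) M]
        [IsManifold (𝓡 n) ∞ M] [T2Space M] [SecondCountableTopology M] [ConnectedSpace M]
        (F : OrientedHypersurface n M),
        F.IsComplete → F.IsRotational → F.IsMinimal r →
          ∃ (L : EuclideanSpace ℝ (Fin (n + 1)) ≃ₗᵢ[ℝ] EuclideanSpace ℝ (Fin (n + 1)))
            (τ : ℝ ≃ᵢ ℝ),
            (∃ a ∈ Set.Ioo 0 (parameterBound n r),
              Set.range F.toFun = ambientIsometry L τ '' S a) ∨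
            Set.range F.toFun = ambientIsometry L τ '' horizontalHyperplane n 0 ∨
            (r < n ∧ Set.range F.toFun = ambientIsometry L τ '' cylinder o (Real.pi / 2)) := by
  have hcyl : ∀ a ∈ Set.Ioo 0 Real.pi, (r = n ∨ a = Real.pi / 2) →
      IsCompleteRotationalMinimal n r o (cylinder o a) := by
    intro a ha h
    refine isCompleteRotationalMinimal_rotationalSet hn hr hrn ho contDiff_const (fun _ => ha)
      fun t => ?_
    rw [profileOp_const]
    rcases h with rfl | rfl <;> simp
  have hpi : Real.pi / 2 ∈ Set.Ioo 0 Real.pi := ⟨by positivity, by linarith [Real.pi_pos]⟩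
  -- the unduloids; their value is irrelevant for other `r` and `a`
  have hU : ∀ a : ℝ, ∃ R : ℝ → ℝ, r < n → a ∈ Set.Ioo 0 (Real.pi / 2) → IsUnduloidProfile a R ∧
      ContDiff ℝ ∞ R ∧ (∀ t, R t ∈ Set.Ioo 0 Real.pi) ∧
      (∀ t, profileOp n r (fun t => Real.cos (R t)) t = 0) ∧ ∀ x y, x ^ 2 < 1 →
        ((1 - x ^ 2) / (1 - x ^ 2 + y ^ 2)) ^ r * (1 - x ^ 2) ^ (n - r) =
          (Real.sin a ^ 2) ^ (n - r) →
        ∃ t, Real.cos (R t) = x ∧ deriv (fun t => Real.cos (R t)) t = y := by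
    intro a
    by_cases h : r < n ∧ a ∈ Set.Ioo 0 (Real.pi / 2)
    · obtain ⟨R, hR⟩ := exists_isUnduloidProfile hr h.1 h.2.1 h.2.2
      exact ⟨R, fun _ _ => hR⟩
    · exact ⟨0, fun h1 h2 => absurd ⟨h1, h2⟩ h⟩
  choose U hU using hU
  refine ⟨fun a => if r = n then cylinder o a else rotationalSet o (U a), fun a ha => ?_,
    isCompleteRotationalMinimal_horizontalHyperplane hn hr o, hcyl _ hpi (Or.inr rfl), ?_⟩
  · rcases hrn.eq_or_lt with h | h
    · rw [parameterBound, if_pos h] at ha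
      simp only [if_pos h]
      exact ⟨hcyl a ha (Or.inl h), isAnnulus_rotationalSet ho contDiff_const fun _ => ha,
        fun _ => trivial, fun h' => absurd h h'.ne⟩
    · rw [parameterBound, if_neg h.ne] at ha
      simp only [if_neg h.ne]
      obtain ⟨h1, h2, h3, h4, -⟩ := hU a h ha
      exact ⟨isCompleteRotationalMinimal_rotationalSet hn hr hrn ho h2 h3 h4,
        isAnnulus_rotationalSet ho h2 h3, fun h' => absurd h' h.ne, fun _ => ⟨U a, h1, rfl⟩⟩
  · intro M _ _ _ _ _ _ F hc hrot hF
    obtain ⟨o', ho', hrot⟩ := hrot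
    -- an isometry carrying the axis over `o` to the axis of the given hypersurface
    obtain ⟨L, rfl⟩ := exists_linearIsometryEquiv_apply_eq (ho.trans ho'.symm)
    rcases hc.classification hn hr hrn ho' hrot hF (U := U) (fun h a ha => (hU a h ha).2) with
      ⟨t, h⟩ | ⟨h, a, ha, h'⟩ | ⟨h, h'⟩ | ⟨h, a, ha, c, h'⟩
    · exact ⟨_, IsometryEquiv.addRight t, Or.inr (Or.inl
        (h.trans (image_ambientIsometry_horizontalHyperplane t).symm))⟩
    · refine ⟨L, IsometryEquiv.addRight 0, Or.inl ⟨a, ?_, ?_⟩⟩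
      · rwa [parameterBound, if_pos h]
      · simp only [if_pos h]
        exact h'.trans (image_ambientIsometry_rotationalSet L o (fun _ => _) 0).symm
    · exact ⟨L, IsometryEquiv.addRight 0, Or.inr (Or.inr ⟨h,
        h'.trans (image_ambientIsometry_rotationalSet L o (fun _ => _) 0).symm⟩)⟩
    · refine ⟨L, IsometryEquiv.addRight (-c), Or.inl ⟨a, ?_, ?_⟩⟩
      · rwa [parameterBound, if_neg h.ne]
      · simp only [if_neg h.ne]
        rw [image_ambientIsometry_rotationalSet, h']
        simp only [sub_neg_eq_add]
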